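/- **Conventions.** Let $A$, $B$ be C*-algebras (not necessarily unital). An $A$–$B$ C*-correspondence $(X,\pi_X)$ is a (right) Hilbert $B$-module $X$ with a $*$-homomorphism $\pi_X$ from $A$ into the adjointable operators on $X$; if $A=B$ it is called a C*-correspondence over $A$. For a $*$-representation $\varphi$ of $B$ on a Hilbert space $H$, let $X\otimes_\varphi H$ be the interior tensor product, i.e. the Hilbert space obtained from the algebraic tensor product $X\odot H$ by separation and completion for $\langle x\otimes h, y\otimes k\rangle=\langle h,\varphi(\langle x,y\rangle)k\rangle$. * *Identity correspondence.* $(A,\lambda_A)$ is $A$ as a Hilbert module over itself, $\langle a,b\rangle=a^*b$, with $\lambda_A(a)b=ab$. * *Scalar representation.* For a $*$-representation $\pi_H:A\to\mathbb B(H)$, $(H\otimes A,\pi_H\otimes 1_A)$ is the C*-correspondence over $A$ whose Hilbert module is the completion of $H\odot A$ for $\langle h\otimes a,k\otimes b\rangle=\langle h,k\rangle a^*b$, with left action $(\pi_H\otimes 1_A)(c)(h\otimes a)=\pi_H(c)h\otimes a$. * *Weak containment.* A $*$-representation $\sigma$ of a C*-algebra is weakly contained in a $*$-representation $\tau$ if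 $\ker\tau\subseteq\ker\sigma$. For $A$–$B$ C*-correspondences $X$, $Y$ write $X\prec_{\mathrm{univ}}Y$ if the representation $\theta_X:A\otimes_{\max}\pi_u(B)'\to\mathbb B(X\otimes_{\pi_u}H_u)$, $\theta_X(a\otimes y)=\pi_X(a)\otimes y$, is weakly contained in $\theta_Y$, where $(H_u,\pi_u)$ is the universal representation of $B$ (the direct sum of the GNS representations of all states) and $\pi_u(B)'$ is the commutant of $\pi_u(B)$. * *UFP.* A C*-correspondence $(X,\pi_X)$ over $A$ has the universal factorization property (UFP) if for every C*-algebra $B$, every nondegenerate $*$-representation $\sigma$ of $A\otimes_{\max}B$ on a Hilbert space $H$, written $\sigma(a\otimes b)=\sigma_A(a)\sigma_B(b)$ with $*$-representations $\sigma_A$, $\sigma_B$ of $A$, $B$ on $H$ with commuting ranges, is weakly contained in the representation $a\otimes b\mapsto\pi_X(a)\otimes\sigma_B(b)$ of $A\otimes_{\max}B$ on $X\otimes_{\sigma_A}H$. * *Nuclearity.* $A$ is nuclear if for every C*-algebra $B$ the maximal and the minimal (spatial) C*-norms on the algebraic tensor product $A\odot B$ coincide. **Theorem.** Let $A$ be a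 C*-algebra. 1. For every C*-correspondence $(X,\pi_X)$ over $A$: $(X,\pi_X)$ has the UFP if and only if $(A,\lambda_A)\prec_{\mathrm{univ}}(X,\pi_X)$. 2. For every faithful $*$-representation $\pi_H:A\to\mathbb B(H)$ the following are equivalent: (a) $A$ is nuclear; (b) $(H\otimes A,\pi_H\otimes 1_A)$ has the UFP; (c) $(A,\lambda_A)\prec_{\mathrm{univ}}(H\otimes A,\pi_H\otimes 1_A)$. -/

import Mathlib

open scoped TensorProduct InnerProductSpace ComplexOrder

universe u

set_option linter.unusedSectionVars false

noncomputable section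

namespace CStarCorr

/-- A (right) Hilbert C*-module over `A`: a complex Banach space `X` (completeness is a separate
type class) with a right action `rsmul` of `A` and an `A`-valued inner product, linear in the second
variable, whose norm is `‖x‖ = ‖⟨x, x⟩‖ ^ (1/2)`. Since `X` is a normed group, `⟨x, x⟩ = 0` forces
`x = 0`, and the bilinearity and associativity of the right action follow from the other laws. -/
class HilbertModule (A X : Type*) [NonUnitalCStarAlgebra A] [PartialOrder A]
    [NormedAddCommGroup X] [NormedSpace ℂ X] where
  inner : X → X → A
  rsmul : X → A → X
  inner_add_right : ∀ x y z, inner x (y + z) = inner x y + inner x z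
  inner_smul_right : ∀ x (c : ℂ) y, inner x (c • y) = c • inner x y
  inner_rsmul_right : ∀ x y a, inner x (rsmul y a) = inner x y * a
  star_inner : ∀ x y, star (inner x y) = inner y x
  inner_self_nonneg : ∀ x, 0 ≤ inner x x
  norm_eq : ∀ x, ‖x‖ = √‖inner x x‖

theorem exists_negPart {M : Type*} [NonUnitalCStarAlgebra M] [PartialOrder M] [StarOrderedRing M]
    (g : M) (hg : IsSelfAdjoint g) :
    ∃ n : M, star n = n ∧ (∃ c, n * n * n = star c * c) ∧ n * g * n = -(n * n * n) ∧
      (n = 0 → ∃ d, g = star d * d) := by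
  have hs : star (g⁻) = g⁻ := (CFC.negPart_nonneg g).isSelfAdjoint.star_eq
  refine ⟨g⁻, hs, ?_, ?_, ?_⟩
  · rw [← CStarAlgebra.nonneg_iff_eq_star_mul_self]
    have h := star_left_conjugate_nonneg (CFC.negPart_nonneg g) (g⁻)
    rwa [hs] at h
  · have h : g⁻ * (g⁺ - g⁻) * g⁻ = -(g⁻ * g⁻ * g⁻) := by
      rw [mul_sub, sub_mul]
      simp
    rwa [CFC.posPart_sub_negPart g hg] at h
  · intro hN
    rw [← CStarAlgebra.nonneg_iff_eq_star_mul_self]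
    rw [← CFC.posPart_sub_negPart g hg, hN, sub_zero]
    exact CFC.posPart_nonneg g

namespace HilbertModule

section basic

variable {A X : Type*} [NonUnitalCStarAlgebra A] [PartialOrder A]
  [NormedAddCommGroup X] [NormedSpace ℂ X] [HilbertModule A X]

variable (A) in
/-- The inner product as a sesquilinear map. -/
def innerₛₗ : X →ₗ⋆[ℂ] X →ₗ[ℂ] A :=
  LinearMap.mk₂'ₛₗ (starRingEnd ℂ) (RingHom.id ℂ) (fun x y => inner (A := A) x y)
    (fun x y z => by rw [← star_inner, inner_add_right, star_add, star_inner, star_inner])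
    (fun c x y => by rw [← star_inner, inner_smul_right, star_smul, star_inner]; rfl)
    (fun x y z => inner_add_right x y z)
    (fun c x y => inner_smul_right x c y)

theorem innerₛₗ_apply (x y : X) : innerₛₗ A x y = inner (A := A) x y := rfl

theorem inner_rsmul_left (x y : X) (a : A) :
    inner (rsmul x a) y = star a * inner x y := by
  rw [← star_inner, inner_rsmul_right, star_mul, star_inner]

/-- The Gram matrix of finitely many vectors is a positive matrix, hence of the form `Dᴴ D`. -/
theorem exists_gram [StarOrderedRing A] {ι : Type*} [Fintype ι] [DecidableEq ι] (x : ι → X) :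
    ∃ D : ι → ι → A, ∀ i j, inner (x i) (x j) = ∑ k, star (D k i) * D k j := by
  let G : CStarMatrix ι ι A := CStarMatrix.ofMatrix fun i j => inner (x i) (x j)
  have hGa : ∀ i j, G i j = inner (x i) (x j) := fun _ _ => rfl
  have hG : IsSelfAdjoint G := by
    ext i j
    rw [CStarMatrix.star_apply, hGa, hGa, star_inner]
  obtain ⟨N, hsa, ⟨C, hC⟩, key, hN0⟩ := exists_negPart G hG
  have hC0 : C = 0 := by
    have hdiag : ∀ k, ∑ j, star (C j k) * C j k = 0 := by
      intro k
      have h1 : (N * N * N) k k = ∑ j, star (C j k) * C j k := by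
        rw [hC]; simp [CStarMatrix.mul_apply, CStarMatrix.star_apply]
      have h2 : (N * G * N) k k
          = innerₛₗ A (∑ i, rsmul (x i) (N i k)) (∑ j, rsmul (x j) (N j k)) := by
        have hs : ∀ i, N k i = star (N i k) := by
          intro i
          conv_lhs => rw [← hsa]
          simp [CStarMatrix.star_apply]
        simp only [map_sum, LinearMap.sum_apply, innerₛₗ_apply, inner_rsmul_left,
          inner_rsmul_right, CStarMatrix.mul_apply, Finset.sum_mul, hs]
        refine Finset.sum_congr rfl fun i _ => Finset.sum_congr rfl fun j _ => ?_
        simp [hGa, mul_assoc]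
      have h3 : 0 ≤ (N * G * N) k k := by rw [h2]; exact inner_self_nonneg _
      rw [key] at h3
      have h4 : (-(N * N * N)) k k = - ((N * N * N) k k) := rfl
      rw [h4, h1] at h3
      exact le_antisymm (neg_nonneg.mp h3) (Finset.sum_nonneg fun j _ => star_mul_self_nonneg _)
    ext j k
    have h := (Finset.sum_eq_zero_iff_of_nonneg
      (fun j _ => star_mul_self_nonneg (C j k))).mp (hdiag k) j (Finset.mem_univ j)
    simpa using h
  have hN : N = 0 := by
    have h0 : N * N * N = 0 := by rw [hC, hC0]; simp
    have h1 : (N * N) = 0 := by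
      have : star (N * N) * (N * N) = 0 := by
        rw [star_mul, hsa, ← mul_assoc, h0, zero_mul]
      exact (CStarRing.star_mul_self_eq_zero_iff _).mp this
    have h2 : star N * N = 0 := by rw [hsa, h1]
    exact (CStarRing.star_mul_self_eq_zero_iff _).mp h2
  obtain ⟨D, hD⟩ := hN0 hN
  refine ⟨fun k i => D k i, fun i j => ?_⟩
  have : G i j = (star D * D) i j := by rw [← hD]
  simpa [hGa, CStarMatrix.mul_apply, CStarMatrix.star_apply] using this

end basic

end HilbertModule

/-- Let `p k` be the norms of `Pᵏ x` for a positive operator `P`: if they satisfy the Cauchy–Schwarz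
inequalities and grow at most like `rᵏ`, then `‖P x‖ ≤ r ‖x‖`. -/
theorem le_of_growth (p : ℕ → ℝ) (hp : ∀ k, 0 ≤ p k) (r C : ℝ) (hr : 0 ≤ r)
    (h2 : ∀ k, p k ^ 2 ≤ p 0 * p (2 * k)) (hC : ∀ k, p k ≤ C * r ^ k) : p 1 ≤ r * p 0 := by
  by_contra hlt
  push Not at hlt
  have hp0 : 0 < p 0 := by
    rcases (hp 0).lt_or_eq with h | h
    · exact h
    · have := h2 1
      rw [← h, zero_mul] at this
      have h1 : p 1 = 0 := by nlinarith [hp 1]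
      rw [h1, ← h] at hlt; simp at hlt
  have hr' : 0 < r := by
    rcases hr.lt_or_eq with h | h
    · exact h
    · have := hC 1
      rw [← h] at this hlt
      simp at this hlt
      linarith
  set q := p 1 / (r * p 0) with hq
  have hq1 : 1 < q := by rw [hq, one_lt_div (by positivity)]; exact hlt
  have key : ∀ m : ℕ, p 0 * (q * r) ^ (2 ^ m) ≤ p (2 ^ m) := by
    intro m
    induction m with
    | zero => simp only [pow_zero, pow_one]; rw [hq]; apply le_of_eq; field_simp
    | succ m ih =>
      have h := h2 (2 ^ m)
      have h3 : (p 0 * (q * r) ^ (2 ^ m)) ^ 2 ≤ p (2 ^ m) ^ 2 := by gcongr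
      have h4 : p 0 * (p 0 * (q * r) ^ (2 ^ (m + 1))) ≤ p 0 * p (2 ^ (m + 1)) := by
        calc _ = (p 0 * (q * r) ^ (2 ^ m)) ^ 2 := by rw [pow_succ 2 m, pow_mul]; ring
          _ ≤ _ := h3.trans (by rw [pow_succ 2 m, mul_comm (2 ^ m) 2]; exact h)
      exact le_of_mul_le_mul_left h4 hp0
  have hb : ∀ m : ℕ, q ^ (2 ^ m) ≤ C / p 0 := by
    intro m
    have h := (key m).trans (hC _)
    rw [mul_pow, ← mul_assoc] at h
    rw [le_div_iff₀ hp0, mul_comm]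
    exact le_of_mul_le_mul_right h (by positivity)
  obtain ⟨n, hn⟩ := pow_unbounded_of_one_lt (C / p 0) hq1
  have : q ^ n ≤ q ^ (2 ^ n) := pow_le_pow_right₀ hq1.le Nat.lt_two_pow_self.le
  linarith [hb n]

section interior

variable {A B X H : Type*} [NonUnitalCStarAlgebra A] [NonUnitalCStarAlgebra B] [PartialOrder B]
  [NormedAddCommGroup X] [NormedSpace ℂ X] [HilbertModule B X]
  [NormedAddCommGroup H] [InnerProductSpace ℂ H] [CompleteSpace H]

/-- The sesquilinear form `⟨x ⊗ h, x' ⊗ h'⟩ = ⟨h, φ(⟨x, x'⟩) h'⟩` on the algebraic tensor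
product `X ⊙ H`. -/
def interiorForm (X : Type*) [NormedAddCommGroup X] [NormedSpace ℂ X] [HilbertModule B X]
    (φ : B →⋆ₙₐ[ℂ] (H →L[ℂ] H)) : (X ⊗[ℂ] H) →ₗ⋆[ℂ] (X ⊗[ℂ] H) →ₗ[ℂ] ℂ :=
  TensorProduct.lift <| LinearMap.mk₂'ₛₗ (starRingEnd ℂ) (starRingEnd ℂ)
    (fun x h => TensorProduct.lift <| LinearMap.mk₂ ℂ
      (fun x' h' => ⟪h, φ (HilbertModule.innerₛₗ B x x') h'⟫_ℂ)
      (fun _ _ _ => by simp) (fun _ _ _ => by simp)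
      (fun _ _ _ => by simp) (fun _ _ _ => by simp))
    (fun _ _ _ => by ext; simp)
    (fun _ _ _ => by ext; simp)
    (fun _ _ _ => by ext; simp)
    (fun _ _ _ => by ext; simp [mul_comm])

theorem interiorForm_tmul (φ : B →⋆ₙₐ[ℂ] (H →L[ℂ] H)) (x x' : X) (h h' : H) :
    interiorForm X φ (x ⊗ₜ h) (x' ⊗ₜ h') = ⟪h, φ (HilbertModule.inner x x') h'⟫_ℂ := rfl

theorem star_interiorForm (φ : B →⋆ₙₐ[ℂ] (H →L[ℂ] H)) (z w : X ⊗[ℂ] H) :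
    starRingEnd ℂ (interiorForm X φ z w) = interiorForm X φ w z := by
  induction z using TensorProduct.induction_on with
  | zero => simp
  | add z₁ z₂ h₁ h₂ => simp [h₁, h₂]
  | tmul x h =>
    induction w using TensorProduct.induction_on with
    | zero => simp
    | add z₁ z₂ h₁ h₂ => simp [h₁, h₂]
    | tmul x' h' =>
      rw [interiorForm_tmul, interiorForm_tmul, inner_conj_symm, ← HilbertModule.star_inner x' x,
        map_star, ContinuousLinearMap.star_eq_adjoint, ContinuousLinearMap.adjoint_inner_left]

theorem exists_fin_sum {E F : Type*} [AddCommGroup E] [Module ℂ E] [AddCommGroup F] [Module ℂ F]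
    (z : E ⊗[ℂ] F) : ∃ (n : ℕ) (x : Fin n → E) (h : Fin n → F), z = ∑ i, x i ⊗ₜ[ℂ] h i := by
  induction z using TensorProduct.induction_on with
  | zero => exact ⟨0, Fin.elim0, Fin.elim0, by simp⟩
  | tmul x h => exact ⟨1, fun _ => x, fun _ => h, by simp⟩
  | add z w hz hw =>
    obtain ⟨n, x, h, rfl⟩ := hz
    obtain ⟨m, x', h', rfl⟩ := hw
    exact ⟨n + m, Fin.append x x', Fin.append h h', by simp [Fin.sum_univ_add]⟩

theorem interiorForm_self [StarOrderedRing B] (φ : B →⋆ₙₐ[ℂ] (H →L[ℂ] H)) (z : X ⊗[ℂ] H) :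
    0 ≤ (interiorForm X φ z z).re := by
  obtain ⟨n, x, h, rfl⟩ := exists_fin_sum z
  obtain ⟨D, hD⟩ := HilbertModule.exists_gram (A := B) x
  have : interiorForm X φ (∑ i, x i ⊗ₜ[ℂ] h i) (∑ i, x i ⊗ₜ[ℂ] h i)
      = ∑ k, ⟪∑ i, φ (D k i) (h i), ∑ i, φ (D k i) (h i)⟫_ℂ := by
    simp only [map_sum, LinearMap.sum_apply, interiorForm_tmul, hD, sum_inner, inner_sum,
      map_mul, map_star, _root_.sum_apply, mul_apply_eq_comp,
      ContinuousLinearMap.star_eq_adjoint, ContinuousLinearMap.adjoint_inner_right]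
    rw [Finset.sum_comm]
    conv_rhs => rw [Finset.sum_comm]
    rw [Finset.sum_comm]
    refine Finset.sum_congr rfl fun i _ => ?_
    rw [Finset.sum_comm]
  rw [this, Complex.re_sum]
  exact Finset.sum_nonneg fun k _ => inner_self_nonneg (𝕜 := ℂ)

/-- The algebraic tensor product `X ⊙ H` with the semi-inner product given by `φ`. -/
def PreInteriorTensor (X : Type*) [NormedAddCommGroup X] [NormedSpace ℂ X] [HilbertModule B X]
    (_φ : B →⋆ₙₐ[ℂ] (H →L[ℂ] H)) : Type _ := X ⊗[ℂ] H

variable (φ : B →⋆ₙₐ[ℂ] (H →L[ℂ] H))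

instance : AddCommGroup (PreInteriorTensor X φ) := inferInstanceAs (AddCommGroup (X ⊗[ℂ] H))
instance : Module ℂ (PreInteriorTensor X φ) := inferInstanceAs (Module ℂ (X ⊗[ℂ] H))

/-- `S` is an adjoint of `T` with respect to the `B`-valued inner product of `X`. -/
def IsAdjointPair (B : Type*) {X : Type*} [NonUnitalCStarAlgebra B] [PartialOrder B]
    [NormedAddCommGroup X] [NormedSpace ℂ X] [HilbertModule B X] (T S : X →L[ℂ] X) : Prop :=
  ∀ x y, HilbertModule.inner (A := B) (T x) y = HilbertModule.inner (A := B) x (S y)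

theorem IsAdjointPair.symm {T S : X →L[ℂ] X} (h : IsAdjointPair B T S) : IsAdjointPair B S T := by
  intro x y
  rw [← HilbertModule.star_inner, ← h, HilbertModule.star_inner]

theorem interiorForm_map {T S : X →L[ℂ] X} (hTS : IsAdjointPair B T S) (y : H →L[ℂ] H)
    (hy : ∀ b, Commute (φ b) y) (z w : X ⊗[ℂ] H) :
    interiorForm X φ (TensorProduct.map T.toLinearMap y.toLinearMap z) w
      = interiorForm X φ z (TensorProduct.map S.toLinearMap (star y).toLinearMap w) := by
  have hy' : ∀ b, φ b * star y = star y * φ b := by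
    intro b
    have h := (hy (star b)).star_star
    rw [map_star, star_star] at h
    exact h
  induction z using TensorProduct.induction_on with
  | zero => simp
  | add z₁ z₂ h₁ h₂ => simp [h₁, h₂]
  | tmul x h =>
    induction w using TensorProduct.induction_on with
    | zero => simp
    | add z₁ z₂ h₁ h₂ => rw [map_add, map_add, map_add, h₁, h₂]
    | tmul x' h' =>
      have h1 := congrArg (fun f : H →L[ℂ] H => f h') (hy' (HilbertModule.inner x (S x')))
      simp only [mul_apply_eq_comp] at h1
      rw [TensorProduct.map_tmul, TensorProduct.map_tmul]
      simp only [ContinuousLinearMap.coe_coe, interiorForm_tmul]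
      rw [hTS, h1, ContinuousLinearMap.star_eq_adjoint, ContinuousLinearMap.adjoint_inner_right]

/-- The identification of `X ⊙ H` with its copy that carries the semi-inner product. -/
def PreInteriorTensor.mk : (X ⊗[ℂ] H) ≃ₗ[ℂ] PreInteriorTensor X φ := LinearEquiv.refl ℂ _

variable [StarOrderedRing B]

/-- The semi-inner product on `X ⊙ H`. -/
abbrev PreInteriorTensor.core : PreInnerProductSpace.Core ℂ (PreInteriorTensor X φ) where
  inner z w := interiorForm X φ ((mk φ).symm z) ((mk φ).symm w)
  conj_inner_symm z w := star_interiorForm φ _ _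
  re_inner_nonneg z := interiorForm_self φ _
  add_left z w v := by simp
  smul_left z w c := by simp

instance : SeminormedAddCommGroup (PreInteriorTensor X φ) :=
  InnerProductSpace.Core.toSeminormedAddCommGroup (c := PreInteriorTensor.core φ)
instance : InnerProductSpace ℂ (PreInteriorTensor X φ) :=
  InnerProductSpace.ofCore (PreInteriorTensor.core φ)

variable (X) in
/-- The interior tensor product `X ⊗_φ H` of a Hilbert `B`-module `X` and a `*`-representation
`φ : B → 𝓑(H)`: the Hilbert space obtained by separation and completion of `X ⊙ H`. -/
abbrev InteriorTensor : Type _ := UniformSpace.Completion (PreInteriorTensor X φ)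

/-- The elementary tensor `x ⊗ h`. -/
def InteriorTensor.tmul (x : X) (h : H) : InteriorTensor X φ :=
  (PreInteriorTensor.mk φ (x ⊗ₜ[ℂ] h) : PreInteriorTensor X φ)

theorem PreInteriorTensor.inner_def (z w : X ⊗[ℂ] H) :
    inner ℂ (mk φ z) (mk φ w) = interiorForm X φ z w := rfl

theorem PreInteriorTensor.norm_tmul_le (x : X) (h : H) :
    ‖mk φ (x ⊗ₜ[ℂ] h)‖ ≤ ‖x‖ * ‖h‖ := by
  have h1 : ‖mk φ (x ⊗ₜ[ℂ] h)‖ ^ 2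
      = ‖⟪h, φ (HilbertModule.inner x x) h⟫_ℂ‖ := by
    rw [← interiorForm_tmul, ← PreInteriorTensor.inner_def, inner_self_eq_norm_sq_to_K]
    simp
  have h2 : ‖⟪h, φ (HilbertModule.inner x x) h⟫_ℂ‖ ≤ (‖x‖ * ‖h‖) ^ 2 := by
    have hx : ‖HilbertModule.inner (A := B) x x‖ = ‖x‖ ^ 2 := by
      rw [HilbertModule.norm_eq (A := B) x, Real.sq_sqrt (norm_nonneg _)]
    calc _ ≤ ‖h‖ * ‖φ (HilbertModule.inner x x) h‖ := norm_inner_le_norm _ _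
      _ ≤ ‖h‖ * (‖HilbertModule.inner (A := B) x x‖ * ‖h‖) := by
        gcongr
        exact (ContinuousLinearMap.le_opNorm _ _).trans
          (by gcongr; exact NonUnitalStarAlgHom.norm_apply_le φ _)
      _ = _ := by rw [hx]; ring
  rw [← h1] at h2
  exact (sq_le_sq₀ (norm_nonneg _) (by positivity)).mp h2

/-- The operator `T ⊗ y` on `X ⊙ H`. -/
def preTensorOp (T : X →L[ℂ] X) (y : H →L[ℂ] H) :
    PreInteriorTensor X φ →ₗ[ℂ] PreInteriorTensor X φ :=
  (PreInteriorTensor.mk φ).toLinearMap ∘ₗ TensorProduct.map T.toLinearMap y.toLinearMap ∘ₗ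
    (PreInteriorTensor.mk φ).symm.toLinearMap

theorem preTensorOp_mk (T : X →L[ℂ] X) (y : H →L[ℂ] H) (x : X) (h : H) :
    preTensorOp φ T y (PreInteriorTensor.mk φ (x ⊗ₜ h))
      = PreInteriorTensor.mk φ (T x ⊗ₜ y h) := rfl

theorem preTensorOp_inner {T S : X →L[ℂ] X} (hTS : IsAdjointPair B T S) (y : H →L[ℂ] H)
    (hy : ∀ b, Commute (φ b) y) (z w : PreInteriorTensor X φ) :
    inner ℂ (preTensorOp φ T y z) w = inner ℂ z (preTensorOp φ S (star y) w) :=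
  interiorForm_map φ hTS y hy _ _

theorem commute_star {φ : B →⋆ₙₐ[ℂ] (H →L[ℂ] H)} {y : H →L[ℂ] H} (hy : ∀ b, Commute (φ b) y)
    (b : B) : Commute (φ b) (star y) := by
  have h := (hy (star b)).star_star
  rwa [map_star, star_star] at h

theorem preTensorOp_bound {T S : X →L[ℂ] X} (hTS : IsAdjointPair B T S) (y : H →L[ℂ] H)
    (hy : ∀ b, Commute (φ b) y) (z : PreInteriorTensor X φ) :
    ‖preTensorOp φ T y z‖ ≤ √((‖S‖ * ‖T‖) * (‖y‖ * ‖y‖)) * ‖z‖ := by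
  let M := preTensorOp φ T y
  let M' := preTensorOp φ S (star y)
  let P : PreInteriorTensor X φ →ₗ[ℂ] PreInteriorTensor X φ := M' ∘ₗ M
  let Pk : ℕ → PreInteriorTensor X φ → PreInteriorTensor X φ := fun k z => (P ^ k) z
  have hM : ∀ u v, inner ℂ (M u) v = inner ℂ u (M' v) := preTensorOp_inner φ hTS y hy
  have hM' : ∀ u v, inner ℂ (M' u) v = inner ℂ u (M v) := by
    intro u v
    have := preTensorOp_inner φ hTS.symm (star y) (commute_star hy) u v
    rwa [star_star] at this
  have hP : ∀ u v : PreInteriorTensor X φ, inner ℂ (P u) v = inner ℂ u (P v) := by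
    intro u v
    change inner ℂ (M' (M u)) v = inner ℂ u (M' (M v))
    rw [hM', hM]
  have hadd : ∀ j k u, Pk (j + k) u = Pk j (Pk k u) := by
    intro j k u
    change (P ^ (j + k)) u = (P ^ j) ((P ^ k) u)
    rw [pow_add]; rfl
  have hPk1 : ∀ u, Pk 1 u = P u := fun u => by simp [Pk]
  have hPk : ∀ k, ∀ u v : PreInteriorTensor X φ, inner ℂ (Pk k u) v = inner ℂ u (Pk k v) := by
    intro k
    induction k with
    | zero => intro u v; rfl
    | succ k ih =>
      intro u v
      rw [hadd k 1, ih, hPk1, hP, ← hPk1, ← hadd, add_comm 1 k]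
  have hcs : ∀ k, ‖Pk k z‖ ^ 2 ≤ ‖Pk 0 z‖ * ‖Pk (2 * k) z‖ := by
    intro k
    have h1 : ‖Pk k z‖ ^ 2 = ‖inner ℂ z (Pk (2 * k) z)‖ := by
      rw [two_mul, hadd, ← hPk, inner_self_eq_norm_sq_to_K]; simp
    rw [h1]
    exact norm_inner_le_norm _ _
  obtain ⟨n, x, h, hz⟩ := exists_fin_sum ((PreInteriorTensor.mk φ).symm z)
  rw [LinearEquiv.symm_apply_eq, map_sum] at hz
  have hgrow : ∀ k, ‖Pk k z‖ ≤ (∑ i, ‖x i‖ * ‖h i‖) * ((‖S‖ * ‖T‖) * (‖y‖ * ‖y‖)) ^ k := by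
    intro k
    have hk : ∀ (k : ℕ) (x : X) (h : H), (P ^ k) (PreInteriorTensor.mk φ (x ⊗ₜ h))
        = PreInteriorTensor.mk φ ((((S * T) ^ k) x) ⊗ₜ (((star y * y) ^ k) h)) := by
      intro k
      induction k with
      | zero => intro x h; simp
      | succ k ih =>
        intro x h
        have h1 : P (PreInteriorTensor.mk φ (x ⊗ₜ h))
          = PreInteriorTensor.mk φ ((S (T x)) ⊗ₜ (star y (y h))) := rfl
        rw [pow_succ, Module.End.mul_apply, h1, ih, pow_succ, pow_succ]
        rfl
    have h1 : Pk k z = ∑ i, PreInteriorTensor.mk φ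
        ((((S * T) ^ k) (x i)) ⊗ₜ (((star y * y) ^ k) (h i))) := by
      change (P ^ k) z = _
      rw [hz, map_sum]
      exact Finset.sum_congr rfl fun i _ => hk k _ _
    rw [h1, Finset.sum_mul]
    refine (norm_sum_le _ _).trans (Finset.sum_le_sum fun i _ => ?_)
    refine (PreInteriorTensor.norm_tmul_le φ _ _).trans ?_
    have hST : ‖((S * T) ^ k) (x i)‖ ≤ (‖S‖ * ‖T‖) ^ k * ‖x i‖ := by
      clear * -
      induction k with
      | zero => simp
      | succ k ih =>
        rw [pow_succ' (S * T), mul_apply_eq_comp, pow_succ', mul_assoc]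
        refine (ContinuousLinearMap.le_opNorm _ _).trans ?_
        gcongr
        exact norm_mul_le _ _
    have hyy : ‖((star y * y) ^ k) (h i)‖ ≤ (‖y‖ * ‖y‖) ^ k * ‖h i‖ := by
      clear * -
      induction k with
      | zero => simp
      | succ k ih =>
        rw [pow_succ' (star y * y), mul_apply_eq_comp, pow_succ', mul_assoc]
        refine (ContinuousLinearMap.le_opNorm _ _).trans ?_
        gcongr
        exact (norm_mul_le _ _).trans (by rw [norm_star])
    calc _ ≤ ((‖S‖ * ‖T‖) ^ k * ‖x i‖) * ((‖y‖ * ‖y‖) ^ k * ‖h i‖) := by gcongr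
      _ = _ := by rw [mul_pow (‖S‖ * ‖T‖)]; ring
  have hfin := le_of_growth (fun k => ‖Pk k z‖) (fun k => norm_nonneg _) _ _ (by positivity)
    hcs hgrow
  have hlast : ‖M z‖ ^ 2 ≤ ((‖S‖ * ‖T‖) * (‖y‖ * ‖y‖)) * ‖z‖ ^ 2 := by
    have h1 : ‖M z‖ ^ 2 = ‖inner ℂ z (Pk 1 z)‖ := by
      rw [hPk1]
      change _ = ‖inner ℂ z (M' (M z))‖
      rw [← hM, inner_self_eq_norm_sq_to_K]; simp
    rw [h1]
    refine (norm_inner_le_norm _ _).trans ?_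
    have : ‖Pk 1 z‖ ≤ ((‖S‖ * ‖T‖) * (‖y‖ * ‖y‖)) * ‖z‖ := hfin
    nlinarith [norm_nonneg z]
  have := Real.sqrt_le_sqrt hlast
  rwa [Real.sqrt_sq (norm_nonneg _), Real.sqrt_mul (by positivity), Real.sqrt_sq (norm_nonneg _)]
    at this

/-- The operator `T ⊗ y` on `X ⊗_φ H`, for an adjointable operator `T` on `X` and an operator `y`
in the commutant of `φ(B)`. -/
def tensorOp {T S : X →L[ℂ] X} (hTS : IsAdjointPair B T S) (y : H →L[ℂ] H)
    (hy : ∀ b, Commute (φ b) y) : InteriorTensor X φ →L[ℂ] InteriorTensor X φ :=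
  ((preTensorOp φ T y).mkContinuous _ (preTensorOp_bound φ hTS y hy)).completion

theorem tensorOp_coe {T S : X →L[ℂ] X} (hTS : IsAdjointPair B T S) (y : H →L[ℂ] H)
    (hy : ∀ b, Commute (φ b) y) (z : PreInteriorTensor X φ) :
    tensorOp φ hTS y hy (z : InteriorTensor X φ)
      = (preTensorOp φ T y z : PreInteriorTensor X φ) := by
  rw [tensorOp, ContinuousLinearMap.completion_apply_coe]
  rfl

theorem tensorOp_tmul {T S : X →L[ℂ] X} (hTS : IsAdjointPair B T S) (y : H →L[ℂ] H)
    (hy : ∀ b, Commute (φ b) y) (x : X) (h : H) :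
    tensorOp φ hTS y hy (InteriorTensor.tmul φ x h) = InteriorTensor.tmul φ (T x) (y h) := by
  rw [InteriorTensor.tmul, tensorOp_coe, preTensorOp_mk]
  rfl

theorem InteriorTensor.ext_clm {F : Type*} [NormedAddCommGroup F] [NormedSpace ℂ F]
    {f g : InteriorTensor X φ →L[ℂ] F}
    (hfg : ∀ x h, f (InteriorTensor.tmul φ x h) = g (InteriorTensor.tmul φ x h)) : f = g := by
  ext z
  induction z using UniformSpace.Completion.induction_on with
  | hp => exact isClosed_eq f.continuous g.continuous
  | ih z =>
    obtain ⟨n, x, h, hz⟩ := exists_fin_sum ((PreInteriorTensor.mk φ).symm z)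
    rw [LinearEquiv.symm_apply_eq, map_sum] at hz
    have hz' : (z : InteriorTensor X φ) = ∑ i, InteriorTensor.tmul φ (x i) (h i) := by
      have h1 : (z : InteriorTensor X φ) = UniformSpace.Completion.toComplL (𝕜 := ℂ) z := rfl
      rw [h1, hz, map_sum]; rfl
    rw [hz', map_sum, map_sum]
    exact Finset.sum_congr rfl fun i _ => hfg _ _

theorem InteriorTensor.inner_tmul (x x' : X) (h h' : H) :
    ⟪InteriorTensor.tmul φ x h, InteriorTensor.tmul φ x' h'⟫_ℂ
      = ⟪h, φ (HilbertModule.inner x x') h'⟫_ℂ := by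
  rw [InteriorTensor.tmul, InteriorTensor.tmul, UniformSpace.Completion.inner_coe,
    PreInteriorTensor.inner_def, interiorForm_tmul]

theorem InteriorTensor.tmul_add (x : X) (h h' : H) : InteriorTensor.tmul φ x (h + h')
    = InteriorTensor.tmul φ x h + InteriorTensor.tmul φ x h' := by
  simp only [InteriorTensor.tmul, TensorProduct.tmul_add, map_add, UniformSpace.Completion.coe_add]

theorem InteriorTensor.add_tmul (x x' : X) (h : H) : InteriorTensor.tmul φ (x + x') h
    = InteriorTensor.tmul φ x h + InteriorTensor.tmul φ x' h := by
  simp only [InteriorTensor.tmul, TensorProduct.add_tmul, map_add, UniformSpace.Completion.coe_add]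

theorem InteriorTensor.tmul_smul (c : ℂ) (x : X) (h : H) : InteriorTensor.tmul φ x (c • h)
    = c • InteriorTensor.tmul φ x h := by
  simp only [InteriorTensor.tmul, TensorProduct.tmul_smul, map_smul,
    UniformSpace.Completion.coe_smul]

theorem InteriorTensor.smul_tmul (c : ℂ) (x : X) (h : H) : InteriorTensor.tmul φ (c • x) h
    = c • InteriorTensor.tmul φ x h := by
  simp only [InteriorTensor.tmul, ← TensorProduct.smul_tmul', map_smul,
    UniformSpace.Completion.coe_smul]

theorem tensorOp_star {T S : X →L[ℂ] X} (hTS : IsAdjointPair B T S) (y : H →L[ℂ] H)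
    (hy : ∀ b, Commute (φ b) y) :
    tensorOp φ hTS.symm (star y) (commute_star hy) = star (tensorOp φ hTS y hy) := by
  refine (ContinuousLinearMap.eq_adjoint_iff _ _).mpr fun z w => ?_
  induction z, w using UniformSpace.Completion.induction_on₂ with
  | hp => apply isClosed_eq <;> fun_prop
  | ih z w =>
    rw [tensorOp_coe, tensorOp_coe, UniformSpace.Completion.inner_coe,
      UniformSpace.Completion.inner_coe, preTensorOp_inner φ hTS.symm (star y) (commute_star hy),
      star_star]

end interior

section maxTensor

variable {A B : Type u} [NonUnitalCStarAlgebra A] [NonUnitalCStarAlgebra B]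

/-- The linear map `σ_A × σ_B : A ⊙ B → 𝓑(H)`, `a ⊗ b ↦ σ_A(a) σ_B(b)`. -/
def pairMap {A B H : Type*} [NonUnitalCStarAlgebra A] [NonUnitalCStarAlgebra B]
    [NormedAddCommGroup H] [InnerProductSpace ℂ H] [CompleteSpace H]
    (σA : A →⋆ₙₐ[ℂ] (H →L[ℂ] H)) (σB : B →⋆ₙₐ[ℂ] (H →L[ℂ] H)) :
    (A ⊗[ℂ] B) →ₗ[ℂ] (H →L[ℂ] H) :=
  TensorProduct.lift <| LinearMap.mk₂ ℂ (fun a b => σA a * σB b)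
    (fun _ _ _ => by rw [map_add, add_mul]) (fun _ _ _ => by rw [map_smul, smul_mul_assoc])
    (fun _ _ _ => by rw [map_add, mul_add]) (fun _ _ _ => by rw [map_smul, mul_smul_comm])

section pairMap

variable {H : Type*} [NormedAddCommGroup H] [InnerProductSpace ℂ H] [CompleteSpace H]
  (σA : A →⋆ₙₐ[ℂ] (H →L[ℂ] H)) (σB : B →⋆ₙₐ[ℂ] (H →L[ℂ] H))

theorem pairMap_tmul (a : A) (b : B) : pairMap σA σB (a ⊗ₜ b) = σA a * σB b := rfl

variable {σA σB}

theorem pairMap_mul (hc : ∀ a b, Commute (σA a) (σB b)) (s t : A ⊗[ℂ] B) :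
    pairMap σA σB (s * t) = pairMap σA σB s * pairMap σA σB t := by
  induction s using TensorProduct.induction_on with
  | zero => simp
  | add s₁ s₂ h₁ h₂ => rw [add_mul, map_add, h₁, h₂, map_add, add_mul]
  | tmul a b =>
    induction t using TensorProduct.induction_on with
    | zero => simp
    | add s₁ s₂ h₁ h₂ => rw [mul_add, map_add, h₁, h₂, map_add, mul_add]
    | tmul a' b' =>
      rw [Algebra.TensorProduct.tmul_mul_tmul, pairMap_tmul, pairMap_tmul, pairMap_tmul, map_mul,
        map_mul, mul_assoc, mul_assoc, ← mul_assoc (σA a'), (hc a' b).eq, mul_assoc]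

theorem pairMap_star (hc : ∀ a b, Commute (σA a) (σB b)) (s : A ⊗[ℂ] B) :
    pairMap σA σB (star s) = star (pairMap σA σB s) := by
  induction s using TensorProduct.induction_on with
  | zero => simp
  | add s₁ s₂ h₁ h₂ => rw [star_add, map_add, h₁, h₂, map_add, star_add]
  | tmul a b =>
    rw [TensorProduct.star_tmul, pairMap_tmul, pairMap_tmul, star_mul, map_star, map_star,
      ← map_star σA, ← map_star σB, (hc _ _).eq]

end pairMap

/-- The values `‖(σ_A × σ_B)(t)‖` over all pairs of `*`-representations of `A` and `B` on the same
Hilbert space with commuting ranges. -/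
def maxNormSet (t : A ⊗[ℂ] B) : Set ℝ :=
  {r | ∃ (H : Type u) (_ : NormedAddCommGroup H) (_ : InnerProductSpace ℂ H) (_ : CompleteSpace H)
    (σA : A →⋆ₙₐ[ℂ] (H →L[ℂ] H)) (σB : B →⋆ₙₐ[ℂ] (H →L[ℂ] H)),
    (∀ a b, Commute (σA a) (σB b)) ∧ r = ‖pairMap σA σB t‖}

/-- The maximal C*-norm on `A ⊙ B`. -/
def maxNorm (t : A ⊗[ℂ] B) : ℝ := sSup (maxNormSet t)

theorem maxNormSet_bddAbove (t : A ⊗[ℂ] B) : BddAbove (maxNormSet t) := by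
  obtain ⟨n, a, b, rfl⟩ := exists_fin_sum t
  refine ⟨∑ i, ‖a i‖ * ‖b i‖, ?_⟩
  rintro r ⟨H, _, _, _, σA, σB, hc, rfl⟩
  rw [map_sum]
  refine (norm_sum_le _ _).trans (Finset.sum_le_sum fun i _ => ?_)
  rw [pairMap_tmul]
  refine (norm_mul_le _ _).trans ?_
  gcongr
  · exact NonUnitalStarAlgHom.norm_apply_le σA _
  · exact NonUnitalStarAlgHom.norm_apply_le σB _

theorem maxNorm_nonneg (t : A ⊗[ℂ] B) : 0 ≤ maxNorm t := by
  refine Real.sSup_nonneg ?_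
  rintro r ⟨H, _, _, _, σA, σB, hc, rfl⟩
  exact norm_nonneg _

theorem maxNorm_le {t : A ⊗[ℂ] B} {c : ℝ} (hc0 : 0 ≤ c)
    (h : ∀ (H : Type u) [NormedAddCommGroup H] [InnerProductSpace ℂ H] [CompleteSpace H]
      (σA : A →⋆ₙₐ[ℂ] (H →L[ℂ] H)) (σB : B →⋆ₙₐ[ℂ] (H →L[ℂ] H)),
      (∀ a b, Commute (σA a) (σB b)) → ‖pairMap σA σB t‖ ≤ c) : maxNorm t ≤ c := by
  refine Real.sSup_le ?_ hc0
  rintro r ⟨H, _, _, _, σA, σB, hc, rfl⟩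
  exact h H σA σB hc

theorem le_maxNorm {H : Type u} [NormedAddCommGroup H] [InnerProductSpace ℂ H] [CompleteSpace H]
    {σA : A →⋆ₙₐ[ℂ] (H →L[ℂ] H)} {σB : B →⋆ₙₐ[ℂ] (H →L[ℂ] H)}
    (hc : ∀ a b, Commute (σA a) (σB b)) (t : A ⊗[ℂ] B) : ‖pairMap σA σB t‖ ≤ maxNorm t :=
  le_csSup (maxNormSet_bddAbove t) ⟨H, _, _, _, σA, σB, hc, rfl⟩

/-- The algebraic tensor product `A ⊙ B` equipped with the maximal C*-norm. -/
def PreMaxTensor (A B : Type u) [NonUnitalCStarAlgebra A] [NonUnitalCStarAlgebra B] : Type u :=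
  A ⊗[ℂ] B

namespace PreMaxTensor

instance : NonUnitalRing (PreMaxTensor A B) := inferInstanceAs (NonUnitalRing (A ⊗[ℂ] B))
instance : Module ℂ (PreMaxTensor A B) := inferInstanceAs (Module ℂ (A ⊗[ℂ] B))
instance : IsScalarTower ℂ (PreMaxTensor A B) (PreMaxTensor A B) :=
  inferInstanceAs (IsScalarTower ℂ (A ⊗[ℂ] B) (A ⊗[ℂ] B))
instance : SMulCommClass ℂ (PreMaxTensor A B) (PreMaxTensor A B) :=
  inferInstanceAs (SMulCommClass ℂ (A ⊗[ℂ] B) (A ⊗[ℂ] B))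
instance : StarAddMonoid (PreMaxTensor A B) := inferInstanceAs (StarAddMonoid (A ⊗[ℂ] B))
instance : StarModule ℂ (PreMaxTensor A B) := inferInstanceAs (StarModule ℂ (A ⊗[ℂ] B))

variable (A B) in
/-- The identification of `A ⊙ B` with its normed copy. -/
def mk : (A ⊗[ℂ] B) ≃ₗ[ℂ] PreMaxTensor A B := LinearEquiv.refl ℂ _

theorem mk_mul (s t : A ⊗[ℂ] B) : mk A B (s * t) = mk A B s * mk A B t := rfl
theorem mk_star (s : A ⊗[ℂ] B) : mk A B (star s) = star (mk A B s) := rfl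

instance : StarRing (PreMaxTensor A B) where
  star_mul := by
    have h : ∀ s t : A ⊗[ℂ] B, star (s * t) = star t * star s := by
      intro s t
      induction s using TensorProduct.induction_on with
      | zero => simp
      | add s₁ s₂ h₁ h₂ => rw [add_mul, star_add, h₁, h₂, star_add, mul_add]
      | tmul a b =>
        induction t using TensorProduct.induction_on with
        | zero => simp
        | add s₁ s₂ h₁ h₂ => rw [mul_add, star_add, h₁, h₂, star_add, add_mul]
        | tmul a' b' => simp
    exact h
  star_add := star_add

instance : Norm (PreMaxTensor A B) := ⟨fun t => maxNorm ((mk A B).symm t)⟩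

theorem norm_mk (t : A ⊗[ℂ] B) : ‖mk A B t‖ = maxNorm t := rfl

theorem core : SeminormedSpace.Core ℂ (PreMaxTensor A B) where
  norm_nonneg _ := maxNorm_nonneg _
  norm_smul c t := by
    obtain ⟨t, rfl⟩ := (mk A B).surjective t
    rw [← map_smul, norm_mk, norm_mk]
    have hle : ∀ (c : ℂ) (t : A ⊗[ℂ] B), maxNorm (c • t) ≤ ‖c‖ * maxNorm t := by
      intro c t
      refine maxNorm_le (mul_nonneg (norm_nonneg _) (maxNorm_nonneg _)) ?_
      intro H _ _ _ σA σB hc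
      rw [map_smul, norm_smul]
      gcongr
      exact le_maxNorm hc t
    refine le_antisymm (hle c t) ?_
    rcases eq_or_ne c 0 with rfl | hc
    · simpa using maxNorm_nonneg _
    · have h := hle c⁻¹ (c • t)
      rw [smul_smul, inv_mul_cancel₀ hc, one_smul, norm_inv] at h
      have hpos : 0 < ‖c‖ := norm_pos_iff.mpr hc
      calc ‖c‖ * maxNorm t ≤ ‖c‖ * (‖c‖⁻¹ * maxNorm (c • t)) := by gcongr
        _ = _ := by field_simp
  norm_triangle s t := by
    obtain ⟨s, rfl⟩ := (mk A B).surjective s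
    obtain ⟨t, rfl⟩ := (mk A B).surjective t
    rw [← map_add, norm_mk, norm_mk, norm_mk]
    refine maxNorm_le (add_nonneg (maxNorm_nonneg _) (maxNorm_nonneg _)) ?_
    intro H _ _ _ σA σB hc
    rw [map_add]
    exact (norm_add_le _ _).trans (add_le_add (le_maxNorm hc s) (le_maxNorm hc t))

instance : SeminormedAddCommGroup (PreMaxTensor A B) := SeminormedAddCommGroup.ofCore core
instance : NormedSpace ℂ (PreMaxTensor A B) where
  norm_smul_le c t := (core.norm_smul c t).le

instance : NonUnitalSeminormedRing (PreMaxTensor A B) where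
  dist_eq := SeminormedAddCommGroup.dist_eq
  norm_mul_le s t := by
    obtain ⟨s, rfl⟩ := (mk A B).surjective s
    obtain ⟨t, rfl⟩ := (mk A B).surjective t
    rw [← mk_mul, norm_mk, norm_mk, norm_mk]
    refine maxNorm_le (mul_nonneg (maxNorm_nonneg _) (maxNorm_nonneg _)) ?_
    intro H _ _ _ σA σB hc
    rw [pairMap_mul hc]
    refine (norm_mul_le _ _).trans ?_
    gcongr
    · exact maxNorm_nonneg _
    · exact le_maxNorm hc s
    · exact le_maxNorm hc t

theorem norm_star_eq (t : PreMaxTensor A B) : ‖star t‖ = ‖t‖ := by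
  have hle : ∀ t : A ⊗[ℂ] B, maxNorm (star t) ≤ maxNorm t := by
    intro t
    refine maxNorm_le (maxNorm_nonneg _) ?_
    intro H _ _ _ σA σB hc
    rw [pairMap_star hc, norm_star]
    exact le_maxNorm hc t
  obtain ⟨t, rfl⟩ := (mk A B).surjective t
  rw [← mk_star, norm_mk, norm_mk]
  refine le_antisymm (hle t) ?_
  have h := hle (star t)
  rwa [star_star] at h

theorem norm_mul_self_le (t : PreMaxTensor A B) : ‖t‖ * ‖t‖ ≤ ‖star t * t‖ := by
  obtain ⟨t, rfl⟩ := (mk A B).surjective t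
  rw [← mk_star, ← mk_mul, norm_mk, norm_mk]
  have h : maxNorm t ≤ √(maxNorm (star t * t)) := by
    refine maxNorm_le (Real.sqrt_nonneg _) ?_
    intro H _ _ _ σA σB hc
    refine Real.le_sqrt_of_sq_le ?_
    have h1 := le_maxNorm hc (star t * t)
    rwa [pairMap_mul hc, pairMap_star hc, CStarRing.norm_star_mul_self, ← sq] at h1
  calc maxNorm t * maxNorm t ≤ √(maxNorm (star t * t)) * √(maxNorm (star t * t)) :=
        mul_le_mul h h (maxNorm_nonneg _) (Real.sqrt_nonneg _)
    _ = _ := Real.mul_self_sqrt (maxNorm_nonneg _)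

end PreMaxTensor

/-- The maximal tensor product `A ⊗_max B`: the completion of `A ⊙ B` in the maximal C*-norm. -/
def MaxTensor (A B : Type u) [NonUnitalCStarAlgebra A] [NonUnitalCStarAlgebra B] : Type u :=
  UniformSpace.Completion (PreMaxTensor A B)

namespace MaxTensor

open UniformSpace UniformSpace.Completion

instance : NormedAddCommGroup (MaxTensor A B) :=
  inferInstanceAs (NormedAddCommGroup (Completion (PreMaxTensor A B)))
instance : NormedSpace ℂ (MaxTensor A B) :=
  inferInstanceAs (NormedSpace ℂ (Completion (PreMaxTensor A B)))
instance : CompleteSpace (MaxTensor A B) :=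
  inferInstanceAs (CompleteSpace (Completion (PreMaxTensor A B)))

variable (A B) in
/-- The canonical map `A ⊙ B → A ⊗_max B`. -/
def ofAlg : PreMaxTensor A B →ₗᵢ[ℂ] MaxTensor A B := Completion.toComplₗᵢ

/-- The elementary tensor `a ⊗ b ∈ A ⊗_max B`. -/
def tmul (a : A) (b : B) : MaxTensor A B := ofAlg A B (PreMaxTensor.mk A B (a ⊗ₜ b))

theorem isDenseInducing_ofAlg : IsDenseInducing (ofAlg A B) := Completion.isDenseInducing_coe

theorem denseRange_ofAlg : DenseRange (ofAlg A B) := isDenseInducing_ofAlg.dense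

theorem induction_on {p : MaxTensor A B → Prop} (z : MaxTensor A B) (hp : IsClosed {z | p z})
    (ih : ∀ t, p (ofAlg A B t)) : p z := denseRange_ofAlg.induction_on z hp ih

theorem induction_on₂ {p : MaxTensor A B → MaxTensor A B → Prop} (z w : MaxTensor A B)
    (hp : IsClosed {x : MaxTensor A B × MaxTensor A B | p x.1 x.2})
    (ih : ∀ s t, p (ofAlg A B s) (ofAlg A B t)) : p z w :=
  denseRange_ofAlg.induction_on₂ hp ih z w

theorem induction_on₃ {p : MaxTensor A B → MaxTensor A B → MaxTensor A B → Prop}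
    (z w v : MaxTensor A B)
    (hp : IsClosed {x : MaxTensor A B × MaxTensor A B × MaxTensor A B | p x.1 x.2.1 x.2.2})
    (ih : ∀ s t r, p (ofAlg A B s) (ofAlg A B t) (ofAlg A B r)) : p z w v :=
  denseRange_ofAlg.induction_on₃ hp ih z w v

instance : Mul (MaxTensor A B) :=
  ⟨Function.curry <| (isDenseInducing_ofAlg.prodMap isDenseInducing_ofAlg).extend
    (fun p => ofAlg A B (p.1 * p.2))⟩

theorem ofAlg_mul (s t : PreMaxTensor A B) : ofAlg A B (s * t) = ofAlg A B s * ofAlg A B t :=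
  ((isDenseInducing_ofAlg.prodMap isDenseInducing_ofAlg).extend_eq
    ((ofAlg A B).continuous.comp continuous_mul) (s, t)).symm

instance : ContinuousMul (MaxTensor A B) where
  continuous_mul := by
    let m := (AddMonoidHom.mul : PreMaxTensor A B →+ PreMaxTensor A B →+ PreMaxTensor A B).compr₂
      (ofAlg A B).toLinearMap.toAddMonoidHom
    have hm : Continuous fun p : PreMaxTensor A B × PreMaxTensor A B => m p.1 p.2 :=
      (ofAlg A B).continuous.comp continuous_mul
    have di : IsDenseInducing ((ofAlg A B).toLinearMap.toAddMonoidHom) := isDenseInducing_ofAlg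
    exact (di.extend_Z_bilin di hm :)

instance : Star (MaxTensor A B) :=
  ⟨isDenseInducing_ofAlg.extend (fun t => ofAlg A B (star t))⟩

theorem isometry_star_aux : Isometry (fun t : PreMaxTensor A B => ofAlg A B (star t)) := by
  refine (ofAlg A B).isometry.comp (Isometry.of_dist_eq fun s t => ?_)
  rw [dist_eq_norm, dist_eq_norm, ← star_sub, PreMaxTensor.norm_star_eq]

theorem ofAlg_star (t : PreMaxTensor A B) : ofAlg A B (star t) = star (ofAlg A B t) :=
  (isDenseInducing_ofAlg.extend_eq isometry_star_aux.continuous t).symm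

theorem continuous_star_max : Continuous (star : MaxTensor A B → MaxTensor A B) :=
  (uniformContinuous_uniformly_extend
    (Completion.isUniformInducing_coe (PreMaxTensor A B)) Completion.denseRange_coe
    isometry_star_aux.uniformContinuous).continuous

instance : ContinuousStar (MaxTensor A B) := ⟨continuous_star_max⟩

instance : NonUnitalRing (MaxTensor A B) where
  zero_mul z := by
    induction z using induction_on with
    | hp => apply isClosed_eq <;> fun_prop
    | ih t =>
      rw [← map_zero (ofAlg A B), ← ofAlg_mul, zero_mul]
  mul_zero z := by
    induction z using induction_on with
    | hp => apply isClosed_eq <;> fun_prop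
    | ih t =>
      rw [← map_zero (ofAlg A B), ← ofAlg_mul, mul_zero]
  left_distrib z w v := by
    induction z, w, v using induction_on₃ with
    | hp => apply isClosed_eq <;> fun_prop
    | ih s t r =>
      rw [← map_add, ← ofAlg_mul, ← ofAlg_mul, ← ofAlg_mul, ← map_add, mul_add]
  right_distrib z w v := by
    induction z, w, v using induction_on₃ with
    | hp => apply isClosed_eq <;> fun_prop
    | ih s t r =>
      rw [← map_add, ← ofAlg_mul, ← ofAlg_mul, ← ofAlg_mul, ← map_add, add_mul]
  mul_assoc z w v := by
    induction z, w, v using induction_on₃ with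
    | hp => apply isClosed_eq <;> fun_prop
    | ih s t r =>
      rw [← ofAlg_mul, ← ofAlg_mul, ← ofAlg_mul, ← ofAlg_mul, mul_assoc]

instance : StarRing (MaxTensor A B) where
  star_involutive z := by
    induction z using induction_on with
    | hp => apply isClosed_eq <;> fun_prop
    | ih t =>
      rw [← ofAlg_star, ← ofAlg_star, star_star]
  star_mul z w := by
    induction z, w using induction_on₂ with
    | hp => apply isClosed_eq <;> fun_prop
    | ih s t =>
      rw [← ofAlg_mul, ← ofAlg_star, ← ofAlg_star, ← ofAlg_star, ← ofAlg_mul, star_mul]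
  star_add z w := by
    induction z, w using induction_on₂ with
    | hp => apply isClosed_eq <;> fun_prop
    | ih s t =>
      rw [← map_add, ← ofAlg_star, ← ofAlg_star, ← ofAlg_star, ← map_add, star_add]

instance : NonUnitalNormedRing (MaxTensor A B) where
  dist_eq := NormedAddCommGroup.dist_eq
  norm_mul_le z w := by
    induction z, w using induction_on₂ with
    | hp => apply isClosed_le <;> fun_prop
    | ih s t =>
      rw [← ofAlg_mul, LinearIsometry.norm_map, LinearIsometry.norm_map, LinearIsometry.norm_map]
      exact norm_mul_le s t

instance : CStarRing (MaxTensor A B) where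
  norm_mul_self_le z := by
    induction z using induction_on with
    | hp => apply isClosed_le <;> fun_prop
    | ih t =>
      rw [← ofAlg_star, ← ofAlg_mul, LinearIsometry.norm_map, LinearIsometry.norm_map]
      exact PreMaxTensor.norm_mul_self_le t

instance : StarModule ℂ (MaxTensor A B) where
  star_smul c z := by
    induction z using induction_on with
    | hp =>
      exact isClosed_eq (continuous_star_max.comp (continuous_id.const_smul c))
        (continuous_star_max.const_smul (star c))
    | ih t =>
      rw [← map_smul, ← ofAlg_star, ← ofAlg_star, ← map_smul, star_smul]

theorem smul_mul_max (c : ℂ) (z w : MaxTensor A B) : (c • z) * w = c • (z * w) := by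
  induction z, w using induction_on₂ with
  | hp =>
    exact isClosed_eq ((continuous_fst.const_smul c).mul continuous_snd)
      ((continuous_fst.mul continuous_snd).const_smul c)
  | ih s t => rw [← map_smul, ← ofAlg_mul, ← ofAlg_mul, ← map_smul, smul_mul_assoc]

theorem mul_smul_max (c : ℂ) (z w : MaxTensor A B) : z * (c • w) = c • (z * w) := by
  induction z, w using induction_on₂ with
  | hp =>
    exact isClosed_eq (continuous_fst.mul (continuous_snd.const_smul c))
      ((continuous_fst.mul continuous_snd).const_smul c)
  | ih s t => rw [← map_smul, ← ofAlg_mul, ← ofAlg_mul, ← map_smul, mul_smul_comm]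

instance : IsScalarTower ℂ (MaxTensor A B) (MaxTensor A B) := ⟨smul_mul_max⟩
instance : SMulCommClass ℂ (MaxTensor A B) (MaxTensor A B) :=
  ⟨fun c z w => (mul_smul_max c z w).symm⟩

instance : NonUnitalCStarAlgebra (MaxTensor A B) where

section lift

variable {H : Type u} [NormedAddCommGroup H] [InnerProductSpace ℂ H] [CompleteSpace H]

/-- The `*`-representation `σ_A × σ_B` of `A ⊗_max B`, `a ⊗ b ↦ σ_A(a) σ_B(b)`, given by a pair of
`*`-representations with commuting ranges. -/
def lift (σA : A →⋆ₙₐ[ℂ] (H →L[ℂ] H)) (σB : B →⋆ₙₐ[ℂ] (H →L[ℂ] H))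
    (hc : ∀ a b, Commute (σA a) (σB b)) : MaxTensor A B →⋆ₙₐ[ℂ] (H →L[ℂ] H) :=
  let L : PreMaxTensor A B →L[ℂ] (H →L[ℂ] H) :=
    (pairMap σA σB ∘ₗ (PreMaxTensor.mk A B).symm.toLinearMap).mkContinuous 1
      (fun t => by rw [one_mul]; exact le_maxNorm hc _)
  let F : MaxTensor A B →L[ℂ] (H →L[ℂ] H) :=
    ContinuousLinearMap.fromCompletion (α := PreMaxTensor A B) L
  have hF : ∀ t, F (ofAlg A B t) = pairMap σA σB ((PreMaxTensor.mk A B).symm t) :=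
    fun t => ContinuousLinearMap.fromCompletion_apply_coe L t
  { toFun := F
    map_smul' := fun c z => map_smul F c z
    map_zero' := map_zero F
    map_add' := map_add F
    map_mul' := fun z w => by
      induction z, w using induction_on₂ with
      | hp => apply isClosed_eq <;> fun_prop
      | ih s t =>
        rw [← ofAlg_mul, hF, hF, hF, ← pairMap_mul hc]
        rfl
    map_star' := fun z => by
      induction z using induction_on with
      | hp => apply isClosed_eq <;> fun_prop
      | ih t =>
        rw [← ofAlg_star, hF, hF, ← pairMap_star hc]
        rfl }

theorem lift_tmul (σA : A →⋆ₙₐ[ℂ] (H →L[ℂ] H)) (σB : B →⋆ₙₐ[ℂ] (H →L[ℂ] H))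
    (hc : ∀ a b, Commute (σA a) (σB b)) (a : A) (b : B) :
    lift σA σB hc (tmul a b) = σA a * σB b :=
  ContinuousLinearMap.fromCompletion_apply_coe (α := PreMaxTensor A B) _ _

end lift

end MaxTensor

end maxTensor

/-- A left action of `A` on a Hilbert `B`-module `X`, i.e. a `*`-homomorphism from `A` into the
adjointable operators on `X`: `X` with such an action is an `A`-`B` C*-correspondence. -/
structure LeftAction (A B X : Type*) [NonUnitalCStarAlgebra A] [NonUnitalCStarAlgebra B]
    [PartialOrder B] [NormedAddCommGroup X] [NormedSpace ℂ X] [HilbertModule B X] where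
  toHom : A →ₙₐ[ℂ] (X →L[ℂ] X)
  adjoint : ∀ a, IsAdjointPair B (toHom a) (toHom (star a))

section reps

variable {A B C X H : Type*} [NonUnitalCStarAlgebra A] [NonUnitalCStarAlgebra B] [PartialOrder B]
  [StarOrderedRing B] [NonUnitalCStarAlgebra C]
  [NormedAddCommGroup X] [NormedSpace ℂ X] [HilbertModule B X]
  [NormedAddCommGroup H] [InnerProductSpace ℂ H] [CompleteSpace H]

theorem isAdjointPair_one : IsAdjointPair B (1 : X →L[ℂ] X) 1 := fun _ _ => rfl

/-- The `*`-representation `a ↦ π_X(a) ⊗ 1` of `A` on `X ⊗_φ H`. -/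
def leftRep (π : LeftAction A B X) (φ : B →⋆ₙₐ[ℂ] (H →L[ℂ] H)) :
    A →⋆ₙₐ[ℂ] (InteriorTensor X φ →L[ℂ] InteriorTensor X φ) where
  toFun a := tensorOp φ (π.adjoint a) 1 (fun _ => Commute.one_right _)
  map_smul' c a := InteriorTensor.ext_clm φ fun x h => by
    simp [tensorOp_tmul, InteriorTensor.smul_tmul]
  map_zero' := InteriorTensor.ext_clm φ fun x h => by
    rw [tensorOp_tmul]
    have h0 := InteriorTensor.smul_tmul φ 0 (0 : X) h
    simpa using h0
  map_add' a b := InteriorTensor.ext_clm φ fun x h => by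
    simp [tensorOp_tmul, InteriorTensor.add_tmul]
  map_mul' a b := InteriorTensor.ext_clm φ fun x h => by
    simp [tensorOp_tmul]
  map_star' a := by
    rw [← tensorOp_star]
    exact InteriorTensor.ext_clm φ fun x h => by simp [tensorOp_tmul]

/-- The `*`-representation `c ↦ 1 ⊗ ρ(c)` on `X ⊗_φ H`, for a `*`-representation `ρ` of `C` on `H`
whose range commutes with that of `φ`. -/
def rightRep (X : Type*) [NormedAddCommGroup X] [NormedSpace ℂ X] [HilbertModule B X]
    (φ : B →⋆ₙₐ[ℂ] (H →L[ℂ] H)) (ρ : C →⋆ₙₐ[ℂ] (H →L[ℂ] H))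
    (hc : ∀ b c, Commute (φ b) (ρ c)) :
    C →⋆ₙₐ[ℂ] (InteriorTensor X φ →L[ℂ] InteriorTensor X φ) where
  toFun c := tensorOp φ isAdjointPair_one (ρ c) (fun b => hc b c)
  map_smul' c a := InteriorTensor.ext_clm φ fun x h => by
    simp [tensorOp_tmul, InteriorTensor.tmul_smul]
  map_zero' := InteriorTensor.ext_clm φ fun x h => by
    rw [tensorOp_tmul]
    have h0 := InteriorTensor.tmul_smul φ 0 x (0 : H)
    simpa using h0
  map_add' a b := InteriorTensor.ext_clm φ fun x h => by
    simp [tensorOp_tmul, InteriorTensor.tmul_add]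
  map_mul' a b := InteriorTensor.ext_clm φ fun x h => by
    simp [tensorOp_tmul]
  map_star' a := by
    rw [← tensorOp_star]
    exact InteriorTensor.ext_clm φ fun x h => by rw [tensorOp_tmul, tensorOp_tmul, map_star]

theorem leftRep_tmul (π : LeftAction A B X) (φ : B →⋆ₙₐ[ℂ] (H →L[ℂ] H)) (a : A) (x : X) (h : H) :
    leftRep π φ a (InteriorTensor.tmul φ x h) = InteriorTensor.tmul φ (π.toHom a x) h :=
  tensorOp_tmul φ (π.adjoint a) 1 (fun _ => Commute.one_right _) x h

theorem rightRep_tmul (φ : B →⋆ₙₐ[ℂ] (H →L[ℂ] H)) (ρ : C →⋆ₙₐ[ℂ] (H →L[ℂ] H))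
    (hc : ∀ b c, Commute (φ b) (ρ c)) (c : C) (x : X) (h : H) :
    rightRep X φ ρ hc c (InteriorTensor.tmul φ x h) = InteriorTensor.tmul φ x (ρ c h) :=
  tensorOp_tmul φ isAdjointPair_one (ρ c) (fun b => hc b c) x h

theorem leftRep_commute_rightRep (π : LeftAction A B X) (φ : B →⋆ₙₐ[ℂ] (H →L[ℂ] H))
    (ρ : C →⋆ₙₐ[ℂ] (H →L[ℂ] H)) (hc : ∀ b c, Commute (φ b) (ρ c)) (a : A) (c : C) :
    Commute (leftRep π φ a) (rightRep X φ ρ hc c) :=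
  InteriorTensor.ext_clm φ fun x h => by
    simp [leftRep_tmul, rightRep_tmul]

end reps

/-- The `*`-representation `a ⊗ c ↦ π_X(a) ⊗ ρ(c)` of `A ⊗_max C` on `X ⊗_φ H`, for an `A`-`B`
C*-correspondence `X`, a `*`-representation `φ` of `B` on `H` and a `*`-representation `ρ` of `C` on
`H` with range in the commutant of `φ(B)`. -/
def corrRep {A B C X H : Type u} [NonUnitalCStarAlgebra A] [NonUnitalCStarAlgebra B]
    [PartialOrder B] [StarOrderedRing B] [NonUnitalCStarAlgebra C]
    [NormedAddCommGroup X] [NormedSpace ℂ X] [HilbertModule B X]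
    [NormedAddCommGroup H] [InnerProductSpace ℂ H] [CompleteSpace H]
    (π : LeftAction A B X) (φ : B →⋆ₙₐ[ℂ] (H →L[ℂ] H)) (ρ : C →⋆ₙₐ[ℂ] (H →L[ℂ] H))
    (hc : ∀ b c, Commute (φ b) (ρ c)) :
    MaxTensor A C →⋆ₙₐ[ℂ] (InteriorTensor X φ →L[ℂ] InteriorTensor X φ) :=
  MaxTensor.lift (leftRep π φ) (rightRep X φ ρ hc) (leftRep_commute_rightRep π φ ρ hc)

section commutant

variable {B H : Type u} [NonUnitalCStarAlgebra B]
  [NormedAddCommGroup H] [InnerProductSpace ℂ H] [CompleteSpace H]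

/-- The commutant `φ(B)'` of a `*`-representation. -/
def commutant (φ : B →⋆ₙₐ[ℂ] (H →L[ℂ] H)) : StarSubalgebra ℂ (H →L[ℂ] H) :=
  StarSubalgebra.centralizer ℂ (Set.range φ)

instance (φ : B →⋆ₙₐ[ℂ] (H →L[ℂ] H)) : IsClosed (commutant φ : Set (H →L[ℂ] H)) :=
  Set.isClosed_centralizer _

/-- The inclusion `φ(B)' ⊆ 𝓑(H)`. -/
def commutantIncl (φ : B →⋆ₙₐ[ℂ] (H →L[ℂ] H)) : commutant φ →⋆ₙₐ[ℂ] (H →L[ℂ] H) where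
  toFun y := y
  map_smul' _ _ := rfl
  map_zero' := rfl
  map_add' _ _ := rfl
  map_mul' _ _ := rfl
  map_star' _ := rfl

theorem commute_commutantIncl (φ : B →⋆ₙₐ[ℂ] (H →L[ℂ] H)) (b : B) (y : commutant φ) :
    Commute (φ b) (commutantIncl φ y) :=
  ((StarSubalgebra.mem_centralizer_iff ℂ).mp y.2 (φ b) ⟨b, rfl⟩).1

end commutant

/-- `X` is weakly contained in `Y` with respect to the `*`-representation `(H, φ)` of `B`: the
representation `θ_X : A ⊗_max φ(B)' → 𝓑(X ⊗_φ H)`, `θ_X(a ⊗ y) = π_X(a) ⊗ y`, is weakly contained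
in `θ_Y`, i.e. `ker θ_Y ⊆ ker θ_X`. -/
def WeaklyContained {A B X Y H : Type u} [NonUnitalCStarAlgebra A] [NonUnitalCStarAlgebra B]
    [PartialOrder B] [StarOrderedRing B]
    [NormedAddCommGroup X] [NormedSpace ℂ X] [HilbertModule B X]
    [NormedAddCommGroup Y] [NormedSpace ℂ Y] [HilbertModule B Y]
    [NormedAddCommGroup H] [InnerProductSpace ℂ H] [CompleteSpace H]
    (πX : LeftAction A B X) (πY : LeftAction A B Y) (φ : B →⋆ₙₐ[ℂ] (H →L[ℂ] H)) : Prop :=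
  ∀ z : MaxTensor A (commutant φ),
    corrRep πY φ (commutantIncl φ) (commute_commutantIncl φ) z = 0 →
      corrRep πX φ (commutantIncl φ) (commute_commutantIncl φ) z = 0

section universal

variable (B : Type u) [NonUnitalCStarAlgebra B] [PartialOrder B] [StarOrderedRing B]

/-- The states of `B`: the positive linear functionals of norm one. -/
def State : Type u := {f : B →ₚ[ℂ] ℂ // IsLUB {r : ℝ | ∃ b : B, ‖b‖ ≤ 1 ∧ r = ‖f b‖} 1}

/-- The Hilbert space of the universal representation: the direct sum of the GNS spaces of all
states of `B`. -/
abbrev UniversalSpace : Type u := lp (fun f : State B => f.1.GNS) 2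

/-- The universal representation of `B`: the direct sum of the GNS representations of all states
of `B`. -/
def universalRep : B →⋆ₙₐ[ℂ] (UniversalSpace B →L[ℂ] UniversalSpace B) where
  toFun b := lp.mapCLM 2 (fun f : State B => f.1.gnsNonUnitalStarAlgHom b) (norm_nonneg b)
    (fun f => NonUnitalStarAlgHom.norm_apply_le f.1.gnsNonUnitalStarAlgHom b)
  map_smul' c b := by ext; simp
  map_zero' := by ext; simp
  map_add' a b := by ext; simp
  map_mul' a b := by ext; simp
  map_star' b := by
    refine (ContinuousLinearMap.eq_adjoint_iff _ _).mpr fun x y => ?_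
    simp only [lp.inner_eq_tsum]
    refine tsum_congr fun f => ?_
    have h := map_star f.1.gnsNonUnitalStarAlgHom b
    simp only [lp.mapCLM_apply_coe]
    rw [h, ContinuousLinearMap.star_eq_adjoint, ContinuousLinearMap.adjoint_inner_left]

end universal

/-- `X ≺_univ Y`: weak containment with respect to the universal representation of `B`. -/
def WeaklyContainedUniv {A B X Y : Type u} [NonUnitalCStarAlgebra A] [NonUnitalCStarAlgebra B]
    [PartialOrder B] [StarOrderedRing B]
    [NormedAddCommGroup X] [NormedSpace ℂ X] [HilbertModule B X]
    [NormedAddCommGroup Y] [NormedSpace ℂ Y] [HilbertModule B Y]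
    (πX : LeftAction A B X) (πY : LeftAction A B Y) : Prop :=
  WeaklyContained πX πY (universalRep B)

/-- A `*`-representation is nondegenerate if the vectors `σ(a) h` span a dense subspace. -/
def IsNondegenerate {A H : Type*} [NonUnitalCStarAlgebra A]
    [NormedAddCommGroup H] [InnerProductSpace ℂ H] [CompleteSpace H]
    (σ : A →⋆ₙₐ[ℂ] (H →L[ℂ] H)) : Prop :=
  Dense (Submodule.span ℂ {x : H | ∃ a h, x = σ a h} : Set H)

/-- The universal factorization property of a C*-correspondence `X` over `A`: for every C*-algebra
`B`, every nondegenerate `*`-representation `σ` of `A ⊗_max B` on `H`, written as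
`σ(a ⊗ b) = σ_A(a) σ_B(b)` with commuting `*`-representations `σ_A` and `σ_B`, is weakly contained
in the representation `a ⊗ b ↦ π_X(a) ⊗ σ_B(b)` on `X ⊗_{σ_A} H`. -/
def HasUFP {A X : Type u} [NonUnitalCStarAlgebra A] [PartialOrder A] [StarOrderedRing A]
    [NormedAddCommGroup X] [NormedSpace ℂ X] [HilbertModule A X] (π : LeftAction A A X) : Prop :=
  ∀ (B : Type u) [NonUnitalCStarAlgebra B]
    (H : Type u) [NormedAddCommGroup H] [InnerProductSpace ℂ H] [CompleteSpace H]
    (σ : MaxTensor A B →⋆ₙₐ[ℂ] (H →L[ℂ] H)) (σA : A →⋆ₙₐ[ℂ] (H →L[ℂ] H))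
    (σB : B →⋆ₙₐ[ℂ] (H →L[ℂ] H)) (hc : ∀ a b, Commute (σA a) (σB b)),
    IsNondegenerate σ → (∀ a b, σ (MaxTensor.tmul a b) = σA a * σB b) →
      ∀ z, corrRep π σA σB hc z = 0 → σ z = 0

section minNorm

/-- The linear map `π ⊗ σ : A ⊙ B → 𝓑(H ⊗ K)`, where `H ⊗ K` is the Hilbert space tensor product
and `(π ⊗ σ)(a ⊗ b) = π(a) ⊗ σ(b)`. -/
def spatialMap {A B H K : Type*} [NonUnitalCStarAlgebra A] [NonUnitalCStarAlgebra B]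
    [NormedAddCommGroup H] [InnerProductSpace ℂ H] [CompleteSpace H]
    [NormedAddCommGroup K] [InnerProductSpace ℂ K] [CompleteSpace K]
    (π : A →⋆ₙₐ[ℂ] (H →L[ℂ] H)) (σ : B →⋆ₙₐ[ℂ] (K →L[ℂ] K)) :
    (A ⊗[ℂ] B) →ₗ[ℂ] (UniformSpace.Completion (H ⊗[ℂ] K) →L[ℂ]
      UniformSpace.Completion (H ⊗[ℂ] K)) :=
  have key : ∀ f g : UniformSpace.Completion (H ⊗[ℂ] K) →L[ℂ] UniformSpace.Completion (H ⊗[ℂ] K),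
      (∀ z : H ⊗[ℂ] K, f z = g z) → f = g := fun f g hfg => by
    ext z
    induction z using UniformSpace.Completion.induction_on with
    | hp => exact isClosed_eq f.continuous g.continuous
    | ih z => exact hfg z
  TensorProduct.lift <| LinearMap.mk₂ ℂ
    (fun a b => (TensorProduct.mapL (π a) (σ b)).completion)
    (fun a a' b => key _ _ fun z => by
      simp [TensorProduct.map_add_left, ← UniformSpace.Completion.coe_add])
    (fun c a b => key _ _ fun z => by
      simp [TensorProduct.map_smul_left, ← UniformSpace.Completion.coe_smul])
    (fun a b b' => key _ _ fun z => by
      simp [TensorProduct.map_add_right, ← UniformSpace.Completion.coe_add])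
    (fun c a b => key _ _ fun z => by
      simp [TensorProduct.map_smul_right, ← UniformSpace.Completion.coe_smul])

/-- The minimal (spatial) C*-norm on `A ⊙ B`: the supremum of `‖(π ⊗ σ)(t)‖` over all pairs of
`*`-representations, which is attained at any pair of faithful ones. -/
def minNorm {A B : Type u} [NonUnitalCStarAlgebra A] [NonUnitalCStarAlgebra B]
    (t : A ⊗[ℂ] B) : ℝ :=
  sSup {r : ℝ | ∃ (H : Type u) (_ : NormedAddCommGroup H) (_ : InnerProductSpace ℂ H)
    (_ : CompleteSpace H) (K : Type u) (_ : NormedAddCommGroup K) (_ : InnerProductSpace ℂ K)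
    (_ : CompleteSpace K) (π : A →⋆ₙₐ[ℂ] (H →L[ℂ] H)) (σ : B →⋆ₙₐ[ℂ] (K →L[ℂ] K)),
    r = ‖spatialMap π σ t‖}

/-- `A` is nuclear: for every C*-algebra `B` the maximal and the minimal C*-norm on `A ⊙ B`
coincide, i.e. the canonical surjection from `A ⊗_max B` onto `A ⊗ B` is an isomorphism. -/
def IsNuclear (A : Type u) [NonUnitalCStarAlgebra A] : Prop :=
  ∀ (B : Type u) [NonUnitalCStarAlgebra B] (t : A ⊗[ℂ] B), maxNorm t = minNorm t

end minNorm

section identity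

variable (A : Type*) [NonUnitalCStarAlgebra A] [PartialOrder A] [StarOrderedRing A]

/-- A C*-algebra as a Hilbert module over itself, `⟨a, b⟩ = a* b`. -/
instance HilbertModule.self : HilbertModule A A where
  inner a b := star a * b
  rsmul b a := b * a
  inner_add_right _ _ _ := mul_add _ _ _
  inner_smul_right _ _ _ := mul_smul_comm _ _ _
  inner_rsmul_right _ _ _ := (mul_assoc _ _ _).symm
  star_inner _ _ := by simp
  inner_self_nonneg _ := star_mul_self_nonneg _
  norm_eq a := by rw [CStarRing.norm_star_mul_self, Real.sqrt_mul_self (norm_nonneg a)]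

/-- The identity correspondence `(A, λ_A)`: the left action of `A` on itself by
multiplication. -/
def identityCorr : LeftAction A A A where
  toHom :=
    { toFun := fun a => ContinuousLinearMap.mul ℂ A a
      map_smul' := fun _ _ => by simp
      map_zero' := by simp
      map_add' := fun _ _ => by simp
      map_mul' := fun a b => by ext; simp [mul_assoc] }
  adjoint a x y := by
    change star (a * x) * y = star x * (star a * y)
    rw [star_mul, mul_assoc]

end identity

section scalar

variable {A H B : Type*} [NonUnitalCStarAlgebra A] [NonUnitalCStarAlgebra B] [PartialOrder B]
  [NormedAddCommGroup H] [InnerProductSpace ℂ H]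

/-- The `B`-valued sesquilinear form `⟨h ⊗ b, h' ⊗ b'⟩ = ⟨h, h'⟩ b* b'` on `H ⊙ B`. -/
def scalarForm (H B : Type*) [NonUnitalCStarAlgebra B] [NormedAddCommGroup H]
    [InnerProductSpace ℂ H] : (H ⊗[ℂ] B) →ₗ⋆[ℂ] (H ⊗[ℂ] B) →ₗ[ℂ] B :=
  TensorProduct.lift <| LinearMap.mk₂'ₛₗ (starRingEnd ℂ) (starRingEnd ℂ)
    (fun h b => TensorProduct.lift <| LinearMap.mk₂ ℂ
      (fun h' b' => ⟪h, h'⟫_ℂ • (star b * b'))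
      (fun _ _ _ => by rw [inner_add_right, add_smul])
      (fun _ _ _ => by rw [inner_smul_right, mul_smul])
      (fun _ _ _ => by rw [mul_add, smul_add])
      (fun _ _ _ => by rw [mul_smul_comm, smul_comm]))
    (fun _ _ _ => by ext; simp [add_smul])
    (fun _ _ _ => by ext; simp [smul_smul, mul_comm])
    (fun _ _ _ => by ext; simp [add_mul])
    (fun c h b => by ext; simp [smul_mul_assoc, smul_smul, mul_comm])

theorem scalarForm_tmul (h h' : H) (b b' : B) :
    scalarForm H B (h ⊗ₜ b) (h' ⊗ₜ b') = ⟪h, h'⟫_ℂ • (star b * b') := rfl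

theorem star_scalarForm (z w : H ⊗[ℂ] B) :
    star (scalarForm H B z w) = scalarForm H B w z := by
  induction z using TensorProduct.induction_on with
  | zero => simp
  | add z₁ z₂ h₁ h₂ => simp [h₁, h₂]
  | tmul x h =>
    induction w using TensorProduct.induction_on with
    | zero => simp
    | add z₁ z₂ h₁ h₂ => simp [h₁, h₂]
    | tmul x' h' =>
      rw [scalarForm_tmul, scalarForm_tmul, star_smul, star_mul, star_star]
      congr 1
      exact inner_conj_symm _ _

theorem scalarForm_self [StarOrderedRing B] (z : H ⊗[ℂ] B) : 0 ≤ scalarForm H B z z := by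
  obtain ⟨n, h, b, rfl⟩ := exists_fin_sum z
  let V : Submodule ℂ H := Submodule.span ℂ (Set.range h)
  have : FiniteDimensional ℂ V := FiniteDimensional.span_of_finite ℂ (Set.finite_range h)
  let e := stdOrthonormalBasis ℂ V
  let v : Fin n → V := fun i => ⟨h i, Submodule.subset_span ⟨i, rfl⟩⟩
  have hv : ∀ i j, ⟪h i, h j⟫_ℂ = ∑ k, ⟪v i, e k⟫_ℂ * ⟪e k, v j⟫_ℂ := fun i j => by
    rw [OrthonormalBasis.sum_inner_mul_inner]; rfl
  have : scalarForm H B (∑ i, h i ⊗ₜ[ℂ] b i) (∑ i, h i ⊗ₜ[ℂ] b i)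
      = ∑ k, star (∑ i, ⟪e k, v i⟫_ℂ • b i) * (∑ i, ⟪e k, v i⟫_ℂ • b i) := by
    have hconj : ∀ k i, star ⟪e k, v i⟫_ℂ = ⟪v i, e k⟫_ℂ := fun k i => inner_conj_symm _ _
    simp only [map_sum, LinearMap.sum_apply, scalarForm_tmul, hv, star_sum, star_smul,
      Finset.sum_mul, Finset.mul_sum, smul_mul_assoc, mul_smul_comm, Finset.sum_smul, mul_smul,
      Finset.smul_sum, hconj]
    conv_rhs => rw [Finset.sum_comm]
    refine Finset.sum_congr rfl fun i _ => ?_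
    conv_rhs => rw [Finset.sum_comm]
    refine Finset.sum_congr rfl fun j _ => Finset.sum_congr rfl fun k _ => ?_
    rw [smul_comm]
  rw [this]
  exact Finset.sum_nonneg fun k _ => star_mul_self_nonneg _

/-- Right multiplication by `b` on `H ⊙ B`. -/
def scalarRmul (H : Type*) [NormedAddCommGroup H] [InnerProductSpace ℂ H] (b : B) :
    (H ⊗[ℂ] B) →ₗ[ℂ] (H ⊗[ℂ] B) :=
  TensorProduct.map LinearMap.id (LinearMap.mulRight ℂ b)

theorem scalarForm_rmul (z w : H ⊗[ℂ] B) (b : B) :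
    scalarForm H B z (scalarRmul H b w) = scalarForm H B z w * b := by
  induction z using TensorProduct.induction_on with
  | zero => simp
  | add z₁ z₂ h₁ h₂ => simp [h₁, h₂, add_mul]
  | tmul x h =>
    induction w using TensorProduct.induction_on with
    | zero => simp
    | add z₁ z₂ h₁ h₂ => rw [map_add, map_add, map_add, h₁, h₂, add_mul]
    | tmul x' h' =>
      simp only [scalarRmul, TensorProduct.map_tmul, scalarForm_tmul, LinearMap.id_apply,
        LinearMap.mulRight_apply, smul_mul_assoc, mul_assoc]

variable [StarOrderedRing B]

/-- The Cauchy–Schwarz inequality. -/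
theorem norm_scalarForm_le (z w : H ⊗[ℂ] B) :
    ‖scalarForm H B z w‖ ≤ √‖scalarForm H B z z‖ * √‖scalarForm H B w w‖ := by
  set a := scalarForm H B z w with ha
  set c := ‖scalarForm H B z z‖ with hc
  have hc0 : 0 ≤ c := norm_nonneg _
  have hl : ∀ u v, scalarForm H B (scalarRmul H a u) v = star a * scalarForm H B u v := by
    intro u v
    rw [← star_scalarForm v, scalarForm_rmul, star_mul, star_scalarForm v]
  have hstar : scalarForm H B w z = star a := (star_scalarForm z w).symm
  have key : ∀ ε : ℝ, 0 < ε → ‖a‖ * ‖a‖ ≤ (c + ε) * ‖scalarForm H B w w‖ := by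
    intro ε hε
    set t : ℝ := (c + ε)⁻¹ with ht
    have hcε : 0 < c + ε := by positivity
    have htpos : 0 < t := by positivity
    have h0 := scalarForm_self (((t : ℂ) • scalarRmul H a z) - w)
    have hexp : scalarForm H B (((t : ℂ) • scalarRmul H a z) - w)
        (((t : ℂ) • scalarRmul H a z) - w)
        = (t ^ 2) • (star a * scalarForm H B z z * a) - (2 * t) • (star a * a)
          + scalarForm H B w w := by
      have e1 : scalarForm H B ((t : ℂ) • scalarRmul H a z)
          = (t : ℂ) • scalarForm H B (scalarRmul H a z) := by
        rw [LinearMap.map_smulₛₗ, Complex.conj_ofReal]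
      rw [map_sub (scalarForm H B), LinearMap.sub_apply, e1, LinearMap.smul_apply, map_sub, map_sub, map_smul,
        map_smul, hl, hl, scalarForm_rmul, scalarForm_rmul, hstar, ← ha, Complex.coe_smul,
        Complex.coe_smul, Complex.coe_smul, smul_sub, smul_smul, two_mul, add_smul, sq, mul_assoc]
      abel
    rw [hexp] at h0
    have h1 : star a * scalarForm H B z z * a ≤ c • (star a * a) :=
      CStarAlgebra.star_left_conjugate_le_norm_smul
        (hb := (scalarForm_self z).isSelfAdjoint)
    have h2 : (t ^ 2) • (star a * scalarForm H B z z * a) ≤ (t ^ 2) • (c • (star a * a)) :=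
      smul_le_smul_of_nonneg_left h1 (by positivity)
    have h3 : t • (star a * a) ≤ scalarForm H B w w := by
      have h4 : (t ^ 2 * c) ≤ t := by
        have : t * c ≤ 1 := by
          rw [ht, inv_mul_le_iff₀ hcε]; linarith
        nlinarith
      have h5 : (t ^ 2) • (c • (star a * a)) ≤ t • (star a * a) := by
        rw [smul_smul]
        exact smul_le_smul_of_nonneg_right h4 (star_mul_self_nonneg a)
      have h6 := h2.trans h5
      have h7 : 0 ≤ t • (star a * a) - (2 * t) • (star a * a) + scalarForm H B w w := by
        refine h0.trans ?_
        gcongr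
      have h8 : t • (star a * a) - (2 * t) • (star a * a) + scalarForm H B w w
          = scalarForm H B w w - t • (star a * a) := by
        rw [two_mul, add_smul]; abel
      rw [h8] at h7
      exact sub_nonneg.mp h7
    have h9 := CStarAlgebra.norm_le_norm_of_nonneg_of_le
      (smul_nonneg htpos.le (star_mul_self_nonneg a)) h3
    rw [norm_smul, CStarRing.norm_star_mul_self, Real.norm_of_nonneg htpos.le] at h9
    rwa [ht, inv_mul_le_iff₀ hcε] at h9
  have hlim : ‖a‖ * ‖a‖ ≤ c * ‖scalarForm H B w w‖ := by
    refine le_of_forall_pos_le_add fun δ hδ => ?_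
    have h := key (δ / (‖scalarForm H B w w‖ + 1)) (by positivity)
    refine h.trans ?_
    rw [add_mul]
    gcongr
    rw [div_mul_eq_mul_div, div_le_iff₀ (by positivity)]
    nlinarith [norm_nonneg (scalarForm H B w w)]
  rw [← Real.sqrt_mul hc0]
  refine Real.le_sqrt_of_sq_le ?_
  rw [sq]; exact hlim

/-- `H ⊙ B` with the `B`-valued semi-inner product. -/
def PreScalarModule (H B : Type*) [NonUnitalCStarAlgebra B] [NormedAddCommGroup H]
    [InnerProductSpace ℂ H] : Type _ := H ⊗[ℂ] B

namespace PreScalarModule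

instance : AddCommGroup (PreScalarModule H B) := inferInstanceAs (AddCommGroup (H ⊗[ℂ] B))
instance : Module ℂ (PreScalarModule H B) := inferInstanceAs (Module ℂ (H ⊗[ℂ] B))

variable (H B) in
/-- The identification of `H ⊙ B` with its normed copy. -/
def mk : (H ⊗[ℂ] B) ≃ₗ[ℂ] PreScalarModule H B := LinearEquiv.refl ℂ _

instance : Norm (PreScalarModule H B) :=
  ⟨fun z => √‖scalarForm H B ((mk H B).symm z) ((mk H B).symm z)‖⟩

theorem norm_def (z : PreScalarModule H B) :
    ‖z‖ = √‖scalarForm H B ((mk H B).symm z) ((mk H B).symm z)‖ := rfl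

theorem norm_sq (z : PreScalarModule H B) :
    ‖z‖ ^ 2 = ‖scalarForm H B ((mk H B).symm z) ((mk H B).symm z)‖ := by
  rw [norm_def, Real.sq_sqrt (norm_nonneg _)]

theorem norm_form_le (z w : PreScalarModule H B) :
    ‖scalarForm H B ((mk H B).symm z) ((mk H B).symm w)‖ ≤ ‖z‖ * ‖w‖ := norm_scalarForm_le _ _

theorem core : SeminormedSpace.Core ℂ (PreScalarModule H B) where
  norm_nonneg _ := Real.sqrt_nonneg _
  norm_smul c z := by
    rw [norm_def, norm_def, map_smul, LinearMap.map_smulₛₗ (scalarForm H B),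
      LinearMap.smul_apply, map_smul,
      norm_smul, norm_smul, RCLike.norm_conj, ← mul_assoc, Real.sqrt_mul (by positivity),
      Real.sqrt_mul_self (norm_nonneg _)]
  norm_triangle z w := by
    have h0 : 0 ≤ ‖z‖ + ‖w‖ := add_nonneg (Real.sqrt_nonneg _) (Real.sqrt_nonneg _)
    rw [norm_def (z + w)]
    refine Real.sqrt_le_iff.mpr ⟨h0, ?_⟩
    rw [map_add, map_add, map_add, LinearMap.add_apply, LinearMap.add_apply]
    refine (norm_add_le _ _).trans ?_
    have h1 := norm_add_le (scalarForm H B ((mk H B).symm z) ((mk H B).symm z))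
      (scalarForm H B ((mk H B).symm w) ((mk H B).symm z))
    have h2 := norm_add_le (scalarForm H B ((mk H B).symm z) ((mk H B).symm w))
      (scalarForm H B ((mk H B).symm w) ((mk H B).symm w))
    have h3 := norm_form_le z w
    have h4 := norm_form_le w z
    have h5 := norm_sq z
    have h6 := norm_sq w
    nlinarith

instance : SeminormedAddCommGroup (PreScalarModule H B) := SeminormedAddCommGroup.ofCore core
instance : NormedSpace ℂ (PreScalarModule H B) where
  norm_smul_le c t := (core.norm_smul c t).le

end PreScalarModule

/-- The Hilbert `B`-module `H ⊗ B` (exterior tensor product): the completion of `H ⊙ B` with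
respect to `⟨h ⊗ b, h' ⊗ b'⟩ = ⟨h, h'⟩ b* b'`. -/
def ScalarModule (H B : Type*) [NonUnitalCStarAlgebra B] [PartialOrder B] [StarOrderedRing B]
    [NormedAddCommGroup H] [InnerProductSpace ℂ H] : Type _ :=
  UniformSpace.Completion (PreScalarModule H B)

namespace ScalarModule

open UniformSpace

instance : NormedAddCommGroup (ScalarModule H B) :=
  inferInstanceAs (NormedAddCommGroup (Completion (PreScalarModule H B)))
instance : NormedSpace ℂ (ScalarModule H B) :=
  inferInstanceAs (NormedSpace ℂ (Completion (PreScalarModule H B)))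
instance : CompleteSpace (ScalarModule H B) :=
  inferInstanceAs (CompleteSpace (Completion (PreScalarModule H B)))

variable (H B) in
/-- The canonical map `H ⊙ B → H ⊗ B`. -/
def ofAlg : PreScalarModule H B →ₗᵢ[ℂ] ScalarModule H B := Completion.toComplₗᵢ

theorem isDenseInducing_ofAlg : IsDenseInducing (ofAlg H B) := Completion.isDenseInducing_coe

theorem denseRange_ofAlg : DenseRange (ofAlg H B) := isDenseInducing_ofAlg.dense

theorem induction_on {p : ScalarModule H B → Prop} (z : ScalarModule H B) (hp : IsClosed {z | p z})
    (ih : ∀ t, p (ofAlg H B t)) : p z := denseRange_ofAlg.induction_on z hp ih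

theorem induction_on₂ {p : ScalarModule H B → ScalarModule H B → Prop} (z w : ScalarModule H B)
    (hp : IsClosed {x : ScalarModule H B × ScalarModule H B | p x.1 x.2})
    (ih : ∀ s t, p (ofAlg H B s) (ofAlg H B t)) : p z w :=
  denseRange_ofAlg.induction_on₂ hp ih z w

/-- The inner product of `H ⊗ B`, as the continuous extension of that of `H ⊙ B`. -/
def innerFun : ScalarModule H B → ScalarModule H B → B :=
  Function.curry <| (isDenseInducing_ofAlg.prodMap isDenseInducing_ofAlg).extend
    (fun p => scalarForm H B ((PreScalarModule.mk H B).symm p.1) ((PreScalarModule.mk H B).symm p.2))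

/-- The inner product of `H ⊙ B` as an additive map. -/
def preInnerHom : PreScalarModule H B →+ PreScalarModule H B →+ B :=
  AddMonoidHom.mk' (fun z => AddMonoidHom.mk'
    (fun w => scalarForm H B ((PreScalarModule.mk H B).symm z) ((PreScalarModule.mk H B).symm w))
      (fun _ _ => by rw [map_add, map_add]))
    (fun _ _ => AddMonoidHom.ext fun _ => by
      change scalarForm H B _ _ = scalarForm H B _ _ + scalarForm H B _ _
      rw [map_add, map_add, LinearMap.add_apply])

theorem norm_preInner_le (z w : PreScalarModule H B) : ‖preInnerHom z w‖ ≤ ‖z‖ * ‖w‖ :=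
  PreScalarModule.norm_form_le z w

theorem continuous_preInner : Continuous fun p : PreScalarModule H B × PreScalarModule H B =>
    preInnerHom p.1 p.2 := by
  refine continuous_iff_continuousAt.mpr fun p => ?_
  rw [ContinuousAt, tendsto_iff_norm_sub_tendsto_zero]
  have hb : ∀ q : PreScalarModule H B × PreScalarModule H B,
      ‖preInnerHom q.1 q.2 - preInnerHom p.1 p.2‖
        ≤ ‖q.1 - p.1‖ * ‖q.2‖ + ‖p.1‖ * ‖q.2 - p.2‖ := by
    intro q
    have h : preInnerHom q.1 q.2 - preInnerHom p.1 p.2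
        = preInnerHom (q.1 - p.1) q.2 + preInnerHom p.1 (q.2 - p.2) := by
      rw [map_sub, map_sub, AddMonoidHom.sub_apply]; abel
    rw [h]
    exact (norm_add_le _ _).trans (add_le_add (norm_preInner_le _ _) (norm_preInner_le _ _))
  refine squeeze_zero (fun _ => norm_nonneg _) hb ?_
  have hc : Continuous fun q : PreScalarModule H B × PreScalarModule H B =>
      ‖q.1 - p.1‖ * ‖q.2‖ + ‖p.1‖ * ‖q.2 - p.2‖ :=
    ((continuous_fst.sub continuous_const).norm.mul continuous_snd.norm).add
      (continuous_const.mul (continuous_snd.sub continuous_const).norm)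
  have h0 := hc.tendsto p
  simpa using h0

theorem innerFun_ofAlg (z w : PreScalarModule H B) : innerFun (ofAlg H B z) (ofAlg H B w)
    = scalarForm H B ((PreScalarModule.mk H B).symm z) ((PreScalarModule.mk H B).symm w) :=
  (isDenseInducing_ofAlg.prodMap isDenseInducing_ofAlg).extend_eq continuous_preInner (z, w)

theorem continuous_innerFun :
    Continuous fun p : ScalarModule H B × ScalarModule H B => innerFun p.1 p.2 := by
  have di : IsDenseInducing ((ofAlg H B).toLinearMap.toAddMonoidHom) := isDenseInducing_ofAlg
  exact (di.extend_Z_bilin di continuous_preInner :)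

/-- A bounded linear map on `H ⊙ B` extends to `H ⊗ B`. -/
def extend (T : (H ⊗[ℂ] B) →ₗ[ℂ] (H ⊗[ℂ] B)) (C : ℝ)
    (hT : ∀ z, ‖PreScalarModule.mk H B (T z)‖ ≤ C * ‖PreScalarModule.mk H B z‖) :
    ScalarModule H B →L[ℂ] ScalarModule H B :=
  ContinuousLinearMap.completion (α := PreScalarModule H B) (β := PreScalarModule H B)
    (((PreScalarModule.mk H B).toLinearMap ∘ₗ T ∘ₗ
      (PreScalarModule.mk H B).symm.toLinearMap).mkContinuous C (fun _ => hT _))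

theorem extend_ofAlg (T : (H ⊗[ℂ] B) →ₗ[ℂ] (H ⊗[ℂ] B)) (C : ℝ)
    (hT : ∀ z, ‖PreScalarModule.mk H B (T z)‖ ≤ C * ‖PreScalarModule.mk H B z‖) (z : H ⊗[ℂ] B) :
    extend T C hT (ofAlg H B (PreScalarModule.mk H B z))
      = ofAlg H B (PreScalarModule.mk H B (T z)) :=
  ContinuousLinearMap.completion_apply_coe _ _

theorem rmul_bound (b : B) (z : H ⊗[ℂ] B) :
    ‖PreScalarModule.mk H B (scalarRmul H b z)‖ ≤ ‖b‖ * ‖PreScalarModule.mk H B z‖ := by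
  refine (sq_le_sq₀ (norm_nonneg _) (by positivity)).mp ?_
  rw [mul_pow, PreScalarModule.norm_sq, PreScalarModule.norm_sq]
  simp only [LinearEquiv.symm_apply_apply]
  rw [scalarForm_rmul, ← star_scalarForm, scalarForm_rmul, star_mul, star_scalarForm]
  refine (norm_mul_le _ _).trans ?_
  grw [norm_mul_le]
  rw [norm_star]
  apply le_of_eq; ring

theorem continuous_innerFun_right (x : ScalarModule H B) : Continuous fun w => innerFun x w :=
  continuous_innerFun.comp (continuous_const.prodMk continuous_id)

theorem continuous_innerFun_left (w : ScalarModule H B) : Continuous fun x => innerFun x w :=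
  continuous_innerFun.comp (continuous_id.prodMk continuous_const)

theorem continuous_innerFun_self : Continuous fun x : ScalarModule H B => innerFun x x :=
  continuous_innerFun.comp (continuous_id.prodMk continuous_id)

theorem innerFun_add (x y z : ScalarModule H B) :
    innerFun x (y + z) = innerFun x y + innerFun x z := by
  refine induction_on x (p := fun x => innerFun x (y + z) = innerFun x y + innerFun x z)
    (isClosed_eq (continuous_innerFun_left _)
      ((continuous_innerFun_left _).add (continuous_innerFun_left _))) fun x => ?_
  refine induction_on₂ y z (p := fun y z => innerFun (ofAlg H B x) (y + z)
    = innerFun (ofAlg H B x) y + innerFun (ofAlg H B x) z)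
    (isClosed_eq ((continuous_innerFun_right _).comp (continuous_fst.add continuous_snd))
      (((continuous_innerFun_right _).comp continuous_fst).add
        ((continuous_innerFun_right _).comp continuous_snd))) fun y z => ?_
  rw [← map_add, innerFun_ofAlg, innerFun_ofAlg, innerFun_ofAlg, map_add, map_add]

theorem innerFun_smul (x : ScalarModule H B) (c : ℂ) (y : ScalarModule H B) :
    innerFun x (c • y) = c • innerFun x y := by
  refine induction_on₂ x y (p := fun x y => innerFun x (c • y) = c • innerFun x y)
    (isClosed_eq (continuous_innerFun.comp (continuous_fst.prodMk (continuous_snd.const_smul c)))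
      (continuous_innerFun.const_smul c)) fun x y => ?_
  rw [← map_smul, innerFun_ofAlg, innerFun_ofAlg, map_smul, map_smul]

theorem innerFun_rmul (x y : ScalarModule H B) (b : B) :
    innerFun x (extend (scalarRmul H b) ‖b‖ (rmul_bound b) y) = innerFun x y * b := by
  have hT := (extend (scalarRmul H b) ‖b‖ (rmul_bound b)).continuous
  refine induction_on₂ x y (p := fun x y =>
    innerFun x (extend (scalarRmul H b) ‖b‖ (rmul_bound b) y) = innerFun x y * b)
    (isClosed_eq (continuous_innerFun.comp (continuous_fst.prodMk (hT.comp continuous_snd)))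
      (continuous_innerFun.mul continuous_const)) fun x y => ?_
  obtain ⟨y, rfl⟩ := (PreScalarModule.mk H B).surjective y
  rw [extend_ofAlg, innerFun_ofAlg, innerFun_ofAlg, LinearEquiv.symm_apply_apply,
    LinearEquiv.symm_apply_apply, scalarForm_rmul]

theorem star_innerFun (x y : ScalarModule H B) : star (innerFun x y) = innerFun y x := by
  refine induction_on₂ x y (p := fun x y => star (innerFun x y) = innerFun y x)
    (isClosed_eq continuous_innerFun.star
      (continuous_innerFun.comp (continuous_snd.prodMk continuous_fst))) fun x y => ?_
  rw [innerFun_ofAlg, innerFun_ofAlg, star_scalarForm]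

theorem innerFun_self_nonneg (x : ScalarModule H B) : 0 ≤ innerFun x x := by
  refine induction_on x (p := fun x => 0 ≤ innerFun x x)
    (CStarAlgebra.isClosed_nonneg.preimage continuous_innerFun_self) fun x => ?_
  rw [innerFun_ofAlg]
  exact scalarForm_self _

theorem norm_eq_innerFun (x : ScalarModule H B) : ‖x‖ = √‖innerFun x x‖ := by
  refine induction_on x (p := fun x => ‖x‖ = √‖innerFun x x‖)
    (isClosed_eq continuous_norm continuous_innerFun_self.norm.sqrt) fun x => ?_
  rw [innerFun_ofAlg, LinearIsometry.norm_map, PreScalarModule.norm_def]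

instance : HilbertModule B (ScalarModule H B) where
  inner := innerFun
  rsmul z b := extend (scalarRmul H b) ‖b‖ (rmul_bound b) z
  inner_add_right := innerFun_add
  inner_smul_right := innerFun_smul
  inner_rsmul_right := innerFun_rmul
  star_inner := star_innerFun
  inner_self_nonneg := innerFun_self_nonneg
  norm_eq := norm_eq_innerFun

section action

variable [CompleteSpace H]

/-- The operator `T ⊗ 1` on `H ⊙ B`. -/
def preOp (B : Type*) [NonUnitalCStarAlgebra B] (T : H →L[ℂ] H) :
    (H ⊗[ℂ] B) →ₗ[ℂ] (H ⊗[ℂ] B) :=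
  TensorProduct.map T.toLinearMap LinearMap.id

theorem scalarForm_preOp (T : H →L[ℂ] H) (z w : H ⊗[ℂ] B) :
    scalarForm H B (preOp B T z) w = scalarForm H B z (preOp B (star T) w) := by
  induction z using TensorProduct.induction_on with
  | zero => simp
  | add z₁ z₂ h₁ h₂ => simp [h₁, h₂]
  | tmul x h =>
    induction w using TensorProduct.induction_on with
    | zero => simp
    | add z₁ z₂ h₁ h₂ => rw [map_add, map_add, map_add, h₁, h₂]
    | tmul x' h' =>
      simp only [preOp, TensorProduct.map_tmul, scalarForm_tmul, LinearMap.id_apply,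
        ContinuousLinearMap.coe_coe]
      rw [ContinuousLinearMap.star_eq_adjoint, ContinuousLinearMap.adjoint_inner_right]

theorem preOp_mul (S T : H →L[ℂ] H) (z : H ⊗[ℂ] B) :
    preOp B (S * T) z = preOp B S (preOp B T z) := by
  induction z using TensorProduct.induction_on with
  | zero => simp
  | add z₁ z₂ h₁ h₂ => simp [h₁, h₂]
  | tmul x h => rfl

theorem preOp_add (S T : H →L[ℂ] H) (z : H ⊗[ℂ] B) :
    preOp B (S + T) z = preOp B S z + preOp B T z := by
  simp [preOp, TensorProduct.map_add_left]

theorem preOp_smul (c : ℂ) (T : H →L[ℂ] H) (z : H ⊗[ℂ] B) :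
    preOp B (c • T) z = c • preOp B T z := by
  simp [preOp, TensorProduct.map_smul_left]

theorem preOp_bound (T : H →L[ℂ] H) (z : H ⊗[ℂ] B) :
    ‖PreScalarModule.mk H B (preOp B T z)‖ ≤ ‖T‖ * ‖PreScalarModule.mk H B z‖ := by
  have hpos : star T * T ≤ ‖star T * T‖ • (1 : H →L[ℂ] H) := by
    have h := CStarAlgebra.star_mul_le_algebraMap_norm_sq (a := T)
    rw [Algebra.algebraMap_eq_smul_one] at h
    rwa [CStarRing.norm_star_mul_self, ← sq]
  rw [CStarRing.norm_star_mul_self, ← sub_nonneg,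
    CStarAlgebra.nonneg_iff_eq_star_mul_self] at hpos
  obtain ⟨S, hS⟩ := hpos
  have h1 : (((‖T‖ * ‖T‖ : ℝ) : ℂ) • (1 : H →L[ℂ] H)) = star T * T + star S * S := by
    rw [← hS, Complex.coe_smul]; abel
  have h2 : scalarForm H B z (preOp B (((‖T‖ * ‖T‖ : ℝ) : ℂ) • (1 : H →L[ℂ] H)) z)
      = scalarForm H B (preOp B T z) (preOp B T z)
        + scalarForm H B (preOp B S z) (preOp B S z) := by
    rw [h1, preOp_add, map_add, preOp_mul, preOp_mul, ← scalarForm_preOp, ← scalarForm_preOp]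
  have h3 : preOp B (1 : H →L[ℂ] H) z = z := by
    change TensorProduct.map LinearMap.id LinearMap.id z = z
    simp
  rw [preOp_smul, h3, map_smul] at h2
  have h4 : scalarForm H B (preOp B T z) (preOp B T z)
      ≤ ((‖T‖ * ‖T‖ : ℝ) : ℂ) • scalarForm H B z z := by
    rw [h2]; exact le_add_of_nonneg_right (scalarForm_self _)
  have h5 := CStarAlgebra.norm_le_norm_of_nonneg_of_le (scalarForm_self _) h4
  refine (sq_le_sq₀ (norm_nonneg _) (by positivity)).mp ?_
  rw [mul_pow, PreScalarModule.norm_sq, PreScalarModule.norm_sq]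
  simp only [LinearEquiv.symm_apply_apply]
  refine h5.trans ?_
  rw [norm_smul, Complex.norm_real, Real.norm_of_nonneg (by positivity), sq]

/-- The operator `T ⊗ 1` on `H ⊗ B`. -/
def op (B : Type*) [NonUnitalCStarAlgebra B] [PartialOrder B] [StarOrderedRing B]
    (T : H →L[ℂ] H) : ScalarModule H B →L[ℂ] ScalarModule H B :=
  extend (preOp B T) ‖T‖ (preOp_bound T)

theorem op_ofAlg (T : H →L[ℂ] H) (z : H ⊗[ℂ] B) :
    op B T (ofAlg H B (PreScalarModule.mk H B z))
      = ofAlg H B (PreScalarModule.mk H B (preOp B T z)) := extend_ofAlg _ _ _ _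

theorem innerFun_op (T : H →L[ℂ] H) (x y : ScalarModule H B) :
    innerFun (op B T x) y = innerFun x (op B (star T) y) := by
  have hT := (op B T).continuous
  have hS := (op B (star T)).continuous
  refine induction_on₂ x y (p := fun x y => innerFun (op B T x) y = innerFun x (op B (star T) y))
    (isClosed_eq (continuous_innerFun.comp ((hT.comp continuous_fst).prodMk continuous_snd))
      (continuous_innerFun.comp (continuous_fst.prodMk (hS.comp continuous_snd)))) fun x y => ?_
  obtain ⟨x, rfl⟩ := (PreScalarModule.mk H B).surjective x
  obtain ⟨y, rfl⟩ := (PreScalarModule.mk H B).surjective y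
  rw [op_ofAlg, op_ofAlg, innerFun_ofAlg, innerFun_ofAlg, LinearEquiv.symm_apply_apply,
    LinearEquiv.symm_apply_apply, LinearEquiv.symm_apply_apply, LinearEquiv.symm_apply_apply,
    scalarForm_preOp]

theorem ext_clm {f g : ScalarModule H B →L[ℂ] ScalarModule H B}
    (h : ∀ z : H ⊗[ℂ] B, f (ofAlg H B (PreScalarModule.mk H B z))
      = g (ofAlg H B (PreScalarModule.mk H B z))) : f = g := by
  ext z
  induction z using induction_on with
  | hp => exact isClosed_eq f.continuous g.continuous
  | ih z =>
    obtain ⟨z, rfl⟩ := (PreScalarModule.mk H B).surjective z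
    exact h z

end action

end ScalarModule

/-- The scalar representation `(H ⊗ B, π_H ⊗ 1_B)` of a `*`-representation `π_H : A → 𝓑(H)`. -/
def scalarCorr (B : Type*) [NonUnitalCStarAlgebra B] [PartialOrder B] [StarOrderedRing B]
    [CompleteSpace H] (πH : A →⋆ₙₐ[ℂ] (H →L[ℂ] H)) : LeftAction A B (ScalarModule H B) where
  toHom :=
    { toFun := fun a => ScalarModule.op B (πH a)
      map_smul' := fun c a => ScalarModule.ext_clm fun z => by
        simp [ScalarModule.op_ofAlg, ScalarModule.preOp_smul]
      map_zero' := ScalarModule.ext_clm fun z => by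
        have h := ScalarModule.preOp_smul (B := B) 0 (0 : H →L[ℂ] H) z
        rw [zero_smul, zero_smul] at h
        simp [ScalarModule.op_ofAlg, h]
      map_add' := fun a b => ScalarModule.ext_clm fun z => by
        simp [ScalarModule.op_ofAlg, ScalarModule.preOp_add]
      map_mul' := fun a b => ScalarModule.ext_clm fun z => by
        simp [ScalarModule.op_ofAlg, ScalarModule.preOp_mul] }
  adjoint a x y := by
    change ScalarModule.innerFun (ScalarModule.op B (πH a) x) y
      = ScalarModule.innerFun x (ScalarModule.op B (πH (star a)) y)
    rw [map_star]
    exact ScalarModule.innerFun_op _ _ _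

end scalar

end CStarCorr

end

noncomputable section

namespace CStarCorr

/-! ### Kernels and norms of representations, intertwining isometries, nondegeneracy -/

section general

/-! Weak containment is used as a norm inequality: `norm_le_of_ker_le` turns an inclusion of kernels
into `‖σ z‖ ≤ ‖τ z‖`. All estimates can then be made on the algebraic tensor product and extended by
density (`MaxTensor.norm_le_of_incl`).

Part 1. The map `a ⊗ h ↦ φ(a) h` identifies `A ⊗_φ H` with the essential subspace of `φ`, so the
representation attached to the identity correspondence is a subrepresentation of `φ × ρ`, and has
the same norms when `φ` is nondegenerate. The UFP therefore gives weak containment on applying it to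
the commutant of the universal representation `π_u`. For the converse, let `σ_A × σ_B` be
nondegenerate on `K` and `ξ` a unit vector. The functional `⟨ξ, σ_A(·) ξ⟩` is a state, so its GNS
space is a summand of the universal space `H_u`, and there is a contractive intertwiner `W : H_u →
K` with `W η = ξ` for a unit vector `η` (`exists_universal_intertwiner`). The compression `b ↦ W*
σ_B(b) W` takes values in `π_u(A)'`. It is only linear, but tensored with the identity of `A` it
sends `t` to some `s` for which `π_u × incl` gives `W* (σ_A × σ_B)(t) W`, while the representation
on `X ⊗ H_u` gives the compression along `1 ⊗ W` of the one on `X ⊗ K`. Weak containment at `s`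
bounds `⟨ξ, (σ_A × σ_B)(t) ξ⟩` by the norm of `t` on `X ⊗ K` (`WeaklyContained.norm_inner_le`).
Replacing `t` by `t* t` and varying `ξ` bounds the operator norm.

Part 2. The map `(h ⊗ a) ⊗ k ↦ h ⊗ φ(a) k` carries the representation attached to `H ⊗ A` to the
spatial representation `π_H ⊗ ρ`, onto a dense subspace if `φ` is nondegenerate. Hence the UFP of `H
⊗ A` says that every nondegenerate `σ_A × σ_B` is dominated by `π_H ⊗ σ_B`, that is, by a spatial
representation. This yields nuclearity, since any commuting pair may be cut down to a nondegenerate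
one (`exists_nondegenerate_pair`). If `A` is nuclear, replace `B` by the commutant of `σ_A`, whose
inclusion is faithful: the maximal norm there is the minimal one, and that is attained at the
faithful pair `π_H`, `incl` (`minNorm_eq_of_injective`). The equivalence with weak containment is
Part 1 for `X = H ⊗ A`. -/

theorem continuous_starHom {C D : Type*} [NonUnitalCStarAlgebra C] [NonUnitalCStarAlgebra D]
    (σ : C →⋆ₙₐ[ℂ] D) : Continuous σ :=
  AddMonoidHomClass.continuous_of_bound σ 1 fun z => by
    rw [one_mul]; exact NonUnitalStarAlgHom.norm_apply_le σ z

/-- If the kernel of `τ` is contained in that of `σ`, then `‖σ(z)‖ ≤ ‖τ(z)‖`. -/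
theorem norm_le_of_ker_le {C D E : Type*} [NonUnitalCStarAlgebra C] [NonUnitalCStarAlgebra D]
    [NonUnitalCStarAlgebra E] (σ : C →⋆ₙₐ[ℂ] D) (τ : C →⋆ₙₐ[ℂ] E)
    (h : ∀ z, τ z = 0 → σ z = 0) (z : C) : ‖σ z‖ ≤ ‖τ z‖ := by
  set a := star z * z with ha
  have hsa : IsSelfAdjoint a := .star_mul_self z
  have hτsa : IsSelfAdjoint (τ a) := hsa.map τ
  have hσsa : IsSelfAdjoint (σ a) := hsa.map σ
  set r := ‖τ a‖ with hr
  -- `f` vanishes exactly on `[-r, r]`, which contains the spectrum of `τ a`. So `τ (f(a)) = f(τ a)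
  -- = 0`, hence `f(σ a) = σ (f(a)) = 0`, which confines the spectrum of `σ a` to `[-r, r]`.
  let f : ℝ → ℝ := fun x => max (|x| - r) 0
  have hf : Continuous f := by fun_prop
  have hf0 : f 0 = 0 := by simp [f, hr]
  have h1 : τ (cfcₙ f a) = 0 := by
    rw [NonUnitalStarAlgHom.map_cfcₙ τ f a hf.continuousOn hf0
      (continuous_starHom τ) hsa hτsa]
    rw [← cfcₙ_zero ℝ (τ a)]
    refine cfcₙ_congr fun x hx => ?_
    have : ‖x‖ ≤ ‖τ a‖ := by
      have := norm_apply_le_norm_cfcₙ (fun x : ℝ => x) (τ a) hx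
      rwa [cfcₙ_id' ℝ (τ a)] at this
    simpa [f] using this
  have h2 := h _ h1
  rw [NonUnitalStarAlgHom.map_cfcₙ σ f a hf.continuousOn hf0 (continuous_starHom σ) hsa hσsa] at h2
  have h3 : ‖σ a‖ ≤ r := by
    rw [← cfcₙ_id' ℝ (σ a)]
    refine norm_cfcₙ_le fun x hx => ?_
    have := norm_apply_le_norm_cfcₙ f (σ a) hx hf.continuousOn
    rw [h2, norm_zero, norm_le_zero_iff] at this
    simpa [f] using this
  rw [hr, ha, map_mul, map_mul, map_star, map_star, CStarRing.norm_star_mul_self,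
    CStarRing.norm_star_mul_self] at h3
  nlinarith [norm_nonneg (σ z), norm_nonneg (τ z)]

/-- Two families of vectors with the same Gram matrix, the first of which is total, are related by
an isometry. -/
theorem exists_isometry_of_gram {ι E F : Type*} [NormedAddCommGroup E] [InnerProductSpace ℂ E]
    [NormedAddCommGroup F] [InnerProductSpace ℂ F] [CompleteSpace F]
    (e : ι → E) (f : ι → F) (he : Dense (Submodule.span ℂ (Set.range e) : Set E))
    (hef : ∀ i j, ⟪e i, e j⟫_ℂ = ⟪f i, f j⟫_ℂ) :
    ∃ U : E →L[ℂ] F, (∀ x, ‖U x‖ = ‖x‖) ∧ ∀ i, U (e i) = f i := by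
  -- On the free vector space over `ι` the two linear combination maps have equal norms, because
  -- norms depend only on the Gram matrix. So `Lf` factors through `Le`, and the quotient map
  -- extends from the dense range of `Le`.
  let Le := Finsupp.linearCombination ℂ e
  let Lf := Finsupp.linearCombination ℂ f
  have hL : ∀ x, ‖Lf x‖ = ‖Le x‖ := by
    intro x
    have h : ⟪Lf x, Lf x⟫_ℂ = ⟪Le x, Le x⟫_ℂ := by
      simp only [Le, Lf, Finsupp.linearCombination_apply, Finsupp.sum, sum_inner, inner_sum,
        inner_smul_left, inner_smul_right, hef]
    rw [@norm_eq_sqrt_re_inner ℂ, h, ← @norm_eq_sqrt_re_inner ℂ]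
  have hd : DenseRange Le := by
    rwa [DenseRange, ← LinearMap.coe_range, Finsupp.range_linearCombination]
  have hU : ∀ x, Lf.extendOfNorm Le (Le x) = Lf x :=
    LinearMap.extendOfNorm_eq hd ⟨1, fun x => by rw [hL, one_mul]⟩
  refine ⟨Lf.extendOfNorm Le, fun x => ?_, fun i => ?_⟩
  · refine hd.induction_on x (isClosed_eq (by fun_prop) continuous_norm) fun x => ?_
    rw [hU, hL]
  · simpa [Le, Lf] using hU (Finsupp.single i 1)

section intertwine

variable {E F : Type*} [NormedAddCommGroup E] [InnerProductSpace ℂ E]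
  [NormedAddCommGroup F] [InnerProductSpace ℂ F]

/-- Through `U`, the operator `S` becomes the restriction of `T` to the range of `U`. This and the
reverse inequality for dense range compare representations on interior tensor products with concrete
ones; dense range will come from nondegeneracy. -/
theorem norm_le_of_isometry_intertwine {U : E →L[ℂ] F} (hU : ∀ x, ‖U x‖ = ‖x‖)
    {S : E →L[ℂ] E} {T : F →L[ℂ] F} (h : ∀ x, U (S x) = T (U x)) : ‖S‖ ≤ ‖T‖ :=
  S.opNorm_le_bound (norm_nonneg _) fun x => by
    rw [← hU, h, ← hU x]; exact T.le_opNorm _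

theorem norm_le_of_denseRange_intertwine {U : E →L[ℂ] F} (hU : ∀ x, ‖U x‖ = ‖x‖)
    (hd : DenseRange U) {S : E →L[ℂ] E} {T : F →L[ℂ] F} (h : ∀ x, U (S x) = T (U x)) :
    ‖T‖ ≤ ‖S‖ :=
  T.opNorm_le_bound (norm_nonneg _) fun y => by
    refine hd.induction_on y (isClosed_le (by fun_prop) (by fun_prop)) fun x => ?_
    rw [← h, hU, hU]; exact S.le_opNorm _

end intertwine

/-- Since `σ(A)` is closed under adjoints, the orthogonal complement of `σ(A)H` is the common kernel
of the operators `σ(a)`. -/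
theorem isNondegenerate_iff {A H : Type*} [NonUnitalCStarAlgebra A]
    [NormedAddCommGroup H] [InnerProductSpace ℂ H] [CompleteSpace H]
    (σ : A →⋆ₙₐ[ℂ] (H →L[ℂ] H)) :
    IsNondegenerate σ ↔ ∀ h, (∀ a, σ a h = 0) → h = 0 := by
  rw [IsNondegenerate, Submodule.dense_iff_topologicalClosure_eq_top,
    Submodule.topologicalClosure_eq_top_iff, Submodule.eq_bot_iff]
  refine forall_congr' fun h => imp_congr ?_ Iff.rfl
  rw [Submodule.mem_orthogonal]
  constructor
  · intro hh a
    rw [← inner_self_eq_zero (𝕜 := ℂ), ← ContinuousLinearMap.adjoint_inner_left,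
      ← ContinuousLinearMap.star_eq_adjoint, ← map_star]
    exact hh _ (Submodule.subset_span ⟨star a, _, rfl⟩)
  · intro hh x hx
    induction hx using Submodule.span_induction with
    | mem x hx =>
      obtain ⟨a, k, rfl⟩ := hx
      rw [← ContinuousLinearMap.adjoint_inner_right, ← ContinuousLinearMap.star_eq_adjoint,
        ← map_star, hh, inner_zero_right]
    | zero => simp
    | add x y _ _ h1 h2 => rw [inner_add_left, h1, h2, add_zero]
    | smul c x _ h1 => rw [inner_smul_left, h1, mul_zero]

end general

/-! ### Functoriality of the interior tensor product in the Hilbert space -/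

section interiorMap

variable {B X H K : Type*} [NonUnitalCStarAlgebra B] [PartialOrder B] [StarOrderedRing B]
  [NormedAddCommGroup X] [NormedSpace ℂ X] [HilbertModule B X]
  [NormedAddCommGroup H] [InnerProductSpace ℂ H] [CompleteSpace H]
  [NormedAddCommGroup K] [InnerProductSpace ℂ K] [CompleteSpace K]
  {φ : B →⋆ₙₐ[ℂ] (H →L[ℂ] H)} {ψ : B →⋆ₙₐ[ℂ] (K →L[ℂ] K)}

theorem InteriorTensor.dense_span_tmul (φ : B →⋆ₙₐ[ℂ] (H →L[ℂ] H)) :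
    Dense (Submodule.span ℂ (Set.range fun p : X × H => InteriorTensor.tmul φ p.1 p.2) :
      Set (InteriorTensor X φ)) := by
  refine UniformSpace.Completion.denseRange_coe.mono ?_
  rintro _ ⟨z, rfl⟩
  obtain ⟨n, x, h, hz⟩ := exists_fin_sum ((PreInteriorTensor.mk φ).symm z)
  rw [LinearEquiv.symm_apply_eq, map_sum] at hz
  have hz' : (z : InteriorTensor X φ) = ∑ i, InteriorTensor.tmul φ (x i) (h i) := by
    have h1 : (z : InteriorTensor X φ) = UniformSpace.Completion.toComplL (𝕜 := ℂ) z := rfl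
    rw [h1, hz, map_sum]; rfl
  rw [hz']
  exact Submodule.sum_mem _ fun i _ => Submodule.subset_span ⟨(x i, h i), rfl⟩

/-- Factoring the Gram matrix as `Dᴴ D` reduces a norm in `X ⊗_φ H` to norms of vectors in `H`, on
which an intertwiner can be estimated directly. -/
theorem InteriorTensor.norm_sq_sum_tmul (φ : B →⋆ₙₐ[ℂ] (H →L[ℂ] H)) {n : ℕ} {x : Fin n → X}
    {D : Fin n → Fin n → B} (hD : ∀ i j, HilbertModule.inner (x i) (x j)
      = ∑ k, star (D k i) * D k j) (h : Fin n → H) :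
    ‖∑ i, InteriorTensor.tmul φ (x i) (h i)‖ ^ 2 = ∑ k, ‖∑ i, φ (D k i) (h i)‖ ^ 2 := by
  have key : ⟪∑ i, InteriorTensor.tmul φ (x i) (h i), ∑ i, InteriorTensor.tmul φ (x i) (h i)⟫_ℂ
      = ∑ k, ⟪∑ i, φ (D k i) (h i), ∑ i, φ (D k i) (h i)⟫_ℂ := by
    simp only [InteriorTensor.inner_tmul, hD, sum_inner, inner_sum, map_sum,
      map_mul, map_star, _root_.sum_apply, mul_apply_eq_comp,
      ContinuousLinearMap.star_eq_adjoint, ContinuousLinearMap.adjoint_inner_right]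
    conv_rhs => rw [Finset.sum_comm]
    refine Finset.sum_congr rfl fun i _ => ?_
    rw [Finset.sum_comm]
  simp only [inner_self_eq_norm_sq_to_K] at key
  exact_mod_cast key

/-- A bounded intertwiner `W` of `φ` and `ψ` induces a bounded operator `1 ⊗ W` from `X ⊗_φ H` to
`X ⊗_ψ K`. -/
theorem exists_interiorMap (X : Type*) [NormedAddCommGroup X] [NormedSpace ℂ X]
    [HilbertModule B X] (W : H →L[ℂ] K) (hW : ∀ b h, W (φ b h) = ψ b (W h)) :
    ∃ M : InteriorTensor X φ →L[ℂ] InteriorTensor X ψ, ‖M‖ ≤ ‖W‖ ∧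
      ∀ x h, M (InteriorTensor.tmul φ x h) = InteriorTensor.tmul ψ x (W h) := by
  let e := (UniformSpace.Completion.toComplL (𝕜 := ℂ) (E := PreInteriorTensor X φ)).toLinearMap ∘ₗ
    (PreInteriorTensor.mk φ).toLinearMap
  let f := (UniformSpace.Completion.toComplL (𝕜 := ℂ) (E := PreInteriorTensor X ψ)).toLinearMap ∘ₗ
    (PreInteriorTensor.mk ψ).toLinearMap ∘ₗ TensorProduct.map LinearMap.id W.toLinearMap
  have he : ∀ x h, e (x ⊗ₜ h) = InteriorTensor.tmul φ x h := fun _ _ => rfl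
  have hf : ∀ x h, f (x ⊗ₜ h) = InteriorTensor.tmul ψ x (W h) := fun _ _ => rfl
  have hd : DenseRange e :=
    UniformSpace.Completion.denseRange_coe (α := PreInteriorTensor X φ)
  have hb : ∀ z, ‖f z‖ ≤ ‖W‖ * ‖e z‖ := by
    intro z
    obtain ⟨n, x, h, rfl⟩ := exists_fin_sum z
    obtain ⟨D, hD⟩ := HilbertModule.exists_gram (A := B) x
    simp only [map_sum, he, hf]
    refine (sq_le_sq₀ (norm_nonneg _) (by positivity)).mp ?_
    rw [mul_pow, InteriorTensor.norm_sq_sum_tmul φ hD,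
      InteriorTensor.norm_sq_sum_tmul ψ hD fun i => W (h i), Finset.mul_sum]
    refine Finset.sum_le_sum fun k _ => ?_
    -- Each `ψ (D k i)` moves past `W`, so the `k`-th summand for `ψ` is the square norm of `W`
    -- applied to the `k`-th vector for `φ`, and the bound holds term by term.
    simp only [← hW, ← map_sum, ← mul_pow]
    gcongr
    exact W.le_opNorm _
  refine ⟨f.extendOfNorm e, LinearMap.opNorm_extendOfNorm_le hd (norm_nonneg _) hb, fun x h => ?_⟩
  rw [← he, LinearMap.extendOfNorm_eq hd ⟨_, hb⟩, hf]

end interiorMap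

/-! ### Vector states of nondegenerate representations; the GNS representation -/

section vectorState

variable {A H : Type*} [NonUnitalCStarAlgebra A] [PartialOrder A] [StarOrderedRing A]
  [NormedAddCommGroup H] [InnerProductSpace ℂ H] [CompleteSpace H]

theorem inner_rep_star_mul (σ : A →⋆ₙₐ[ℂ] (H →L[ℂ] H)) (a b : A) (h k : H) :
    ⟪h, σ (star a * b) k⟫_ℂ = ⟪σ a h, σ b k⟫_ℂ := by
  rw [map_mul, map_star, mul_apply_eq_comp, ContinuousLinearMap.star_eq_adjoint,
    ContinuousLinearMap.adjoint_inner_right]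

/-- The positive functional `a ↦ ⟨ξ, σ(a) ξ⟩`. -/
def vectorFunctional (σ : A →⋆ₙₐ[ℂ] (H →L[ℂ] H)) (ξ : H) : A →ₚ[ℂ] ℂ :=
  PositiveLinearMap.mk₀
    { toFun := fun a => ⟪ξ, σ a ξ⟫_ℂ
      map_add' := fun a b => by simp
      map_smul' := fun c a => by simp }
    (fun a ha => by
      obtain ⟨b, rfl⟩ := CStarAlgebra.nonneg_iff_eq_star_mul_self.mp ha
      change 0 ≤ ⟪ξ, σ (star b * b) ξ⟫_ℂ
      rw [inner_rep_star_mul, inner_self_eq_norm_sq_to_K]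
      change (0 : ℂ) ≤ (‖σ b ξ‖ : ℂ) ^ 2
      rw [← Complex.ofReal_pow]
      exact Complex.zero_le_real.mpr (sq_nonneg _))

theorem vectorFunctional_apply (σ : A →⋆ₙₐ[ℂ] (H →L[ℂ] H)) (ξ : H) (a : A) :
    vectorFunctional σ ξ a = ⟪ξ, σ a ξ⟫_ℂ := rfl

theorem invariant_orthogonal {A H : Type*} [NonUnitalCStarAlgebra A] [NormedAddCommGroup H]
    [InnerProductSpace ℂ H] [CompleteSpace H] {σ : A →⋆ₙₐ[ℂ] (H →L[ℂ] H)} {N : Submodule ℂ H}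
    (hN : ∀ a, ∀ x ∈ N, σ a x ∈ N) (a : A) : ∀ x ∈ Nᗮ, σ a x ∈ Nᗮ := by
  intro x hx y hy
  rw [← ContinuousLinearMap.adjoint_inner_left, ← ContinuousLinearMap.star_eq_adjoint,
    ← map_star]
  exact hx _ (hN _ _ hy)

/-- Split `ξ = y + z` along the closed invariant subspace `M`, the closure of `σ(A)ξ`. Then `σ(a) z
= σ(a) ξ - σ(a) y` lies in `M`, and also in its complement, which is invariant too. So every `σ(a)`
kills `z`, and nondegeneracy gives `z = 0`. -/
theorem IsNondegenerate.mem_closure_range {σ : A →⋆ₙₐ[ℂ] (H →L[ℂ] H)} (hσ : IsNondegenerate σ)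
    (ξ : H) : ξ ∈ closure (Set.range fun a => σ a ξ) := by
  let T : A →ₗ[ℂ] H :=
    { toFun := fun a => σ a ξ
      map_add' := fun a b => by simp
      map_smul' := fun c a => by simp }
  let M := (LinearMap.range T).topologicalClosure
  have hM : ∀ a, ∀ x ∈ M, σ a x ∈ M := by
    intro a x hx
    refine map_mem_closure (σ a).continuous hx ?_
    rintro _ ⟨b, rfl⟩
    exact ⟨a * b, by simp [T]⟩
  have : CompleteSpace M := (Submodule.isClosed_topologicalClosure _).completeSpace_coe
  obtain ⟨y, hy, z, hz, hyz⟩ := M.exists_add_mem_mem_orthogonal ξ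
  have hz0 : z = 0 := by
    refine (isNondegenerate_iff σ).mp hσ z fun a => ?_
    have h1 : σ a z ∈ M := by
      have h2 : σ a z = T a - σ a y := by
        change _ = σ a ξ - _
        rw [hyz, map_add, add_sub_cancel_left]
      rw [h2]
      exact M.sub_mem (Submodule.le_topologicalClosure _ ⟨a, rfl⟩) (hM _ _ hy)
    exact inner_self_eq_zero.mp (invariant_orthogonal hM a z hz _ h1)
  rw [hz0, add_zero] at hyz
  rw [← hyz] at hy
  exact hy

/-- A unit vector of a nondegenerate representation defines a state. -/
theorem isLUB_vectorFunctional {σ : A →⋆ₙₐ[ℂ] (H →L[ℂ] H)} (hσ : IsNondegenerate σ)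
    {ξ : H} (hξ : ‖ξ‖ = 1) :
    IsLUB {r : ℝ | ∃ b : A, ‖b‖ ≤ 1 ∧ r = ‖vectorFunctional σ ξ b‖} 1 := by
  have hop : ∀ b : A, ‖b‖ ≤ 1 → ∀ h, ‖σ b h‖ ≤ ‖h‖ := fun b hb h => by
    refine ((σ b).le_of_opNorm_le (NonUnitalStarAlgHom.norm_apply_le σ b) h).trans ?_
    nlinarith [norm_nonneg h]
  refine ⟨?_, fun c hc => le_of_forall_pos_le_add fun ε hε => ?_⟩
  · rintro _ ⟨b, hb, rfl⟩
    rw [vectorFunctional_apply]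
    refine (norm_inner_le_norm _ _).trans ?_
    rw [hξ, one_mul]
    exact (hop b hb ξ).trans hξ.le
  -- In the absence of a unit, norm one is approached along an approximate unit: with `σ(a)ξ` near
  -- `ξ` and `e * a` near `a`, the vector `σ(e)ξ` is within three times `ε / 3` of `ξ`, so the
  -- functional at `e` is within `ε` of `1`.
  · obtain ⟨_, ⟨a, rfl⟩, ha⟩ := Metric.mem_closure_iff.mp (hσ.mem_closure_range ξ) (ε / 3)
      (by positivity)
    rw [dist_eq_norm] at ha
    have hau := CStarAlgebra.increasingApproximateUnit (A := A)
    have hne := hau.neBot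
    have h1 : ∀ᶠ e in CStarAlgebra.approximateUnit A, ‖e * a - a‖ < ε / 3 := by
      have := (hau.tendsto_mul_right a)
      simpa [dist_eq_norm] using (Metric.tendsto_nhds.mp this) (ε / 3) (by positivity)
    obtain ⟨e, he1, he2⟩ := (h1.and hau.eventually_norm).exists
    have h2 : ‖σ e ξ - ξ‖ ≤ ε := by
      have h3 : σ e ξ - ξ = σ e (ξ - σ a ξ) + σ (e * a - a) ξ - (ξ - σ a ξ) := by
        simp
      rw [h3]
      refine (norm_sub_le _ _).trans ?_
      grw [norm_add_le, hop e he2, ha,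
        (σ (e * a - a)).le_of_opNorm_le (NonUnitalStarAlgHom.norm_apply_le σ _) ξ, he1, hξ]
      linarith
    have h4 : (1 : ℝ) ≤ ‖vectorFunctional σ ξ e‖ + ε := by
      have h5 : (1 : ℂ) = vectorFunctional σ ξ e - ⟪ξ, σ e ξ - ξ⟫_ℂ := by
        rw [vectorFunctional_apply, inner_sub_right, inner_self_eq_norm_sq_to_K, hξ]; simp
      calc (1 : ℝ) = ‖(1 : ℂ)‖ := by simp
        _ ≤ _ := by
          rw [h5]
          refine (norm_sub_le _ _).trans ?_
          gcongr
          refine (norm_inner_le_norm _ _).trans ?_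
          rwa [hξ, one_mul]
    have := hc ⟨e, he2, rfl⟩
    linarith

/-- The positive elements `b* b` span `A`, and the class of `b* b` in the GNS space is `π(b*)`
applied to the class of `b`. A vector killed by the representation is thus orthogonal to every
class. -/
theorem gns_isNondegenerate (f : A →ₚ[ℂ] ℂ) : IsNondegenerate f.gnsNonUnitalStarAlgHom := by
  rw [isNondegenerate_iff]
  intro h hh
  have h1 : ∀ c : A, ⟪h, (f.toPreGNS c : f.GNS)⟫_ℂ = 0 := by
    intro c
    have hc : c ∈ Submodule.span ℂ {a : A | 0 ≤ a} := by
      rw [CStarAlgebra.span_nonneg]; trivial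
    induction hc using Submodule.span_induction with
    | mem x hx =>
      obtain ⟨b, rfl⟩ := CStarAlgebra.nonneg_iff_eq_star_mul_self.mp hx
      have h2 : (f.toPreGNS (star b * b) : f.GNS)
          = f.gnsNonUnitalStarAlgHom (star b) (f.toPreGNS b : f.GNS) := by
        rw [PositiveLinearMap.gnsNonUnitalStarAlgHom_apply_coe]; rfl
      rw [h2, map_star, ContinuousLinearMap.star_eq_adjoint,
        ContinuousLinearMap.adjoint_inner_right, hh, inner_zero_left]
    | zero => rw [map_zero, UniformSpace.Completion.coe_zero, inner_zero_right]
    | add x y _ _ h2 h3 =>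
      rw [map_add, UniformSpace.Completion.coe_add, inner_add_right, h2, h3, add_zero]
    | smul c x _ h2 =>
      rw [map_smul, UniformSpace.Completion.coe_smul, inner_smul_right, h2, mul_zero]
  refine inner_self_eq_zero (𝕜 := ℂ).mp ?_
  exact UniformSpace.Completion.induction_on (p := fun k : f.GNS => ⟪h, k⟫_ℂ = 0) h
    (isClosed_eq (by fun_prop) continuous_const) fun k => h1 (f.ofPreGNS k)

end vectorState

/-! ### Reaching every vector from the universal representation -/

section universalRep

variable {A H : Type u} [NonUnitalCStarAlgebra A] [PartialOrder A] [StarOrderedRing A]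
  [NormedAddCommGroup H] [InnerProductSpace ℂ H] [CompleteSpace H]

theorem universalRep_apply (a : A) (h : UniversalSpace A) (f : State A) :
    universalRep A a h f = f.1.gnsNonUnitalStarAlgHom a (h f) := rfl

theorem universalRep_isNondegenerate : IsNondegenerate (universalRep A) := by
  rw [isNondegenerate_iff]
  intro h hh
  ext f
  refine (isNondegenerate_iff _).mp (gns_isNondegenerate f.1) (h f) fun a => ?_
  rw [← universalRep_apply, hh]
  rfl

/-- Every vector of a nondegenerate representation is the image of a vector of the universal
representation under a contractive intertwiner. -/
theorem exists_universal_intertwiner {σ : A →⋆ₙₐ[ℂ] (H →L[ℂ] H)} (hσ : IsNondegenerate σ)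
    {ξ : H} (hξ : ‖ξ‖ = 1) :
    ∃ (W : UniversalSpace A →L[ℂ] H) (η : UniversalSpace A), ‖W‖ ≤ 1 ∧
      (∀ a h, W (universalRep A a h) = σ a (W h)) ∧ W η = ξ ∧ ‖η‖ = 1 := by
  classical
  let f : State A := ⟨vectorFunctional σ ξ, isLUB_vectorFunctional hσ hξ⟩
  have hdense : Dense (Submodule.span ℂ (Set.range fun a => (f.1.toPreGNS a : f.1.GNS)) :
      Set f.1.GNS) := by
    refine (UniformSpace.Completion.denseRange_coe (α := f.1.PreGNS)).mono ?_
    rintro _ ⟨z, rfl⟩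
    exact Submodule.subset_span ⟨f.1.ofPreGNS z, rfl⟩
  obtain ⟨V, hV, hVe⟩ := exists_isometry_of_gram (fun a => (f.1.toPreGNS a : f.1.GNS))
    (fun a => σ a ξ) hdense fun a b => by
      rw [UniformSpace.Completion.inner_coe, PositiveLinearMap.preGNS_inner_def]
      exact inner_rep_star_mul σ a b ξ ξ
  have hVσ : ∀ a, V ∘L f.1.gnsNonUnitalStarAlgHom a = σ a ∘L V := by
    intro a
    refine ContinuousLinearMap.ext_on hdense ?_
    rintro _ ⟨b, rfl⟩
    simp only [ContinuousLinearMap.comp_apply, hVe,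
      PositiveLinearMap.gnsNonUnitalStarAlgHom_apply_coe]
    rw [← mul_apply_eq_comp, ← map_mul, ← hVe]
    rfl
  -- The GNS construction provides no cyclic vector here when `A` has no unit. Instead, the range of
  -- the isometry `V` is closed and contains `σ(A)ξ`, hence contains `ξ` by nondegeneracy.
  have hVr : ξ ∈ Set.range V := by
    have hcl : IsClosed (Set.range V) :=
      ((AddMonoidHomClass.isometry_iff_norm V).mpr hV).isClosedEmbedding.isClosed_range
    refine closure_minimal ?_ hcl (hσ.mem_closure_range ξ)
    rintro _ ⟨a, rfl⟩
    exact ⟨_, hVe a⟩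
  obtain ⟨η, hη⟩ := hVr
  -- `W` is the projection onto the summand of the state `f`, followed by `V`, and the unit vector
  -- sits in that summand. It intertwines because the universal representation acts coordinatewise.
  refine ⟨V ∘L lp.evalCLM ℂ (fun f : State A => f.1.GNS) 2 f, lp.single 2 f η, ?_, ?_, ?_, ?_⟩
  · refine ContinuousLinearMap.opNorm_le_bound _ zero_le_one fun h => ?_
    rw [ContinuousLinearMap.comp_apply, hV, one_mul]
    exact lp.norm_apply_le_norm (by simp) h f
  · intro a h
    exact congrArg (fun T : f.1.GNS →L[ℂ] H => T (h f)) (hVσ a)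
  · rw [← hη]
    change V (lp.single (E := fun f : State A => f.1.GNS) 2 f η f) = _
    rw [lp.single_apply_self]
  · rw [lp.norm_single (by simp), ← hV, hη, hξ]

end universalRep

/-! ### The interior tensor product of the identity correspondence -/

section identity

variable {A H : Type*} [NonUnitalCStarAlgebra A] [PartialOrder A] [StarOrderedRing A]
  [NormedAddCommGroup H] [InnerProductSpace ℂ H] [CompleteSpace H]

/-- The isometry `A ⊗_σ H → H`, `a ⊗ h ↦ σ(a) h`. -/
theorem exists_identity_isometry (σ : A →⋆ₙₐ[ℂ] (H →L[ℂ] H)) :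
    ∃ U : InteriorTensor A σ →L[ℂ] H, (∀ x, ‖U x‖ = ‖x‖) ∧
      (∀ a h, U (InteriorTensor.tmul σ a h) = σ a h) := by
  obtain ⟨U, hU, hUe⟩ := exists_isometry_of_gram
    (fun p : A × H => InteriorTensor.tmul σ p.1 p.2) (fun p => σ p.1 p.2)
    (InteriorTensor.dense_span_tmul σ) fun p q => by
      rw [InteriorTensor.inner_tmul]
      exact inner_rep_star_mul σ _ _ _ _
  exact ⟨U, hU, fun a h => hUe (a, h)⟩

theorem IsNondegenerate.denseRange {σ : A →⋆ₙₐ[ℂ] (H →L[ℂ] H)} (hσ : IsNondegenerate σ)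
    {E : Type*} [NormedAddCommGroup E] [NormedSpace ℂ E] {U : E →L[ℂ] H}
    (hU : ∀ a h, σ a h ∈ Set.range U) : DenseRange U := by
  refine Dense.mono ?_ hσ
  have : Submodule.span ℂ {x : H | ∃ a h, x = σ a h} ≤ LinearMap.range U.toLinearMap := by
    refine Submodule.span_le.mpr ?_
    rintro _ ⟨a, h, rfl⟩
    exact hU a h
  exact this

end identity

/-! ### Representations of the maximal tensor product, tested on algebraic tensors -/

section maxTensorReps

variable {A B H : Type u} [NonUnitalCStarAlgebra A] [NonUnitalCStarAlgebra B]
  [NormedAddCommGroup H] [InnerProductSpace ℂ H] [CompleteSpace H]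

/-- The canonical linear map `A ⊙ B → A ⊗_max B`. -/
def MaxTensor.incl (A B : Type u) [NonUnitalCStarAlgebra A] [NonUnitalCStarAlgebra B] :
    (A ⊗[ℂ] B) →ₗ[ℂ] MaxTensor A B :=
  (MaxTensor.ofAlg A B).toLinearMap ∘ₗ (PreMaxTensor.mk A B).toLinearMap

theorem MaxTensor.denseRange_incl : DenseRange (MaxTensor.incl A B) :=
  MaxTensor.denseRange_ofAlg (A := A) (B := B)

theorem MaxTensor.rep_incl {σ : MaxTensor A B →⋆ₙₐ[ℂ] (H →L[ℂ] H)} {σA : A →⋆ₙₐ[ℂ] (H →L[ℂ] H)}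
    {σB : B →⋆ₙₐ[ℂ] (H →L[ℂ] H)} (h : ∀ a b, σ (MaxTensor.tmul a b) = σA a * σB b)
    (t : A ⊗[ℂ] B) : σ (MaxTensor.incl A B t) = pairMap σA σB t := by
  induction t using TensorProduct.induction_on with
  | zero => simp
  | add s t hs ht => rw [map_add, map_add, map_add, hs, ht]
  | tmul a b => exact h a b

theorem MaxTensor.lift_incl {σA : A →⋆ₙₐ[ℂ] (H →L[ℂ] H)}
    {σB : B →⋆ₙₐ[ℂ] (H →L[ℂ] H)} (hc : ∀ a b, Commute (σA a) (σB b))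
    (t : A ⊗[ℂ] B) : MaxTensor.lift σA σB hc (MaxTensor.incl A B t) = pairMap σA σB t :=
  MaxTensor.rep_incl (MaxTensor.lift_tmul σA σB hc) t

/-- Needed because the transport of tensors along a merely linear map of the second factor is
available on the algebraic tensor product only. -/
theorem MaxTensor.norm_le_of_incl {D E : Type*} [NonUnitalCStarAlgebra D]
    [NonUnitalCStarAlgebra E] {σ : MaxTensor A B →⋆ₙₐ[ℂ] D} {τ : MaxTensor A B →⋆ₙₐ[ℂ] E}
    (h : ∀ t, ‖σ (MaxTensor.incl A B t)‖ ≤ ‖τ (MaxTensor.incl A B t)‖) (z : MaxTensor A B) :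
    ‖σ z‖ ≤ ‖τ z‖ :=
  MaxTensor.denseRange_incl.induction_on z
    (isClosed_le (continuous_starHom σ).norm (continuous_starHom τ).norm) h

/-- As `σ(a ⊗ b) = σ_B(b) σ_A(a)`, a vector killed by `σ_A(A)` is killed by all elementary tensors,
hence by `σ`. -/
theorem IsNondegenerate.of_maxTensor {σ : MaxTensor A B →⋆ₙₐ[ℂ] (H →L[ℂ] H)}
    {σA : A →⋆ₙₐ[ℂ] (H →L[ℂ] H)} {σB : B →⋆ₙₐ[ℂ] (H →L[ℂ] H)}
    (hc : ∀ a b, Commute (σA a) (σB b)) (hσ : IsNondegenerate σ)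
    (h : ∀ a b, σ (MaxTensor.tmul a b) = σA a * σB b) : IsNondegenerate σA := by
  rw [isNondegenerate_iff] at hσ ⊢
  intro x hx
  refine hσ x fun z => ?_
  refine MaxTensor.denseRange_incl.induction_on z
    (isClosed_eq ((continuous_starHom σ).clm_apply continuous_const) continuous_const) fun t => ?_
  rw [MaxTensor.rep_incl h]
  induction t using TensorProduct.induction_on with
  | zero => simp
  | add s t hs ht => rw [map_add, _root_.add_apply, hs, ht, add_zero]
  | tmul a b => rw [pairMap_tmul, (hc a b).eq, mul_apply_eq_comp, hx, map_zero]

/-- A representation whose vector functionals at unit vectors are dominated in norm by another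
representation is itself dominated by it. -/
theorem norm_pairMap_le_of_inner {K : Type*} [NormedAddCommGroup K] [InnerProductSpace ℂ K]
    [CompleteSpace K] {σA : A →⋆ₙₐ[ℂ] (H →L[ℂ] H)} {σB : B →⋆ₙₐ[ℂ] (H →L[ℂ] H)}
    (hσ : ∀ a b, Commute (σA a) (σB b)) {τA : A →⋆ₙₐ[ℂ] (K →L[ℂ] K)}
    {τB : B →⋆ₙₐ[ℂ] (K →L[ℂ] K)} (hτ : ∀ a b, Commute (τA a) (τB b))
    (h : ∀ ξ : H, ‖ξ‖ = 1 → ∀ t, ‖⟪ξ, pairMap σA σB t ξ⟫_ℂ‖ ≤ ‖pairMap τA τB t‖)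
    (t : A ⊗[ℂ] B) : ‖pairMap σA σB t‖ ≤ ‖pairMap τA τB t‖ := by
  refine ContinuousLinearMap.opNorm_le_of_unit_norm (norm_nonneg _) fun ξ hξ => ?_
  -- At `star t * t` the vector functional equals the square of the norm of `pairMap σA σB t ξ`, and
  -- the C*-identity squares the right-hand side.
  have h1 := h ξ hξ (star t * t)
  rw [pairMap_mul hσ, pairMap_mul hτ, pairMap_star hσ, pairMap_star hτ,
    CStarRing.norm_star_mul_self, mul_apply_eq_comp, ContinuousLinearMap.star_eq_adjoint,
    ContinuousLinearMap.adjoint_inner_right, inner_self_eq_norm_sq_to_K] at h1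
  have h2 : ‖pairMap σA σB t ξ‖ ^ 2 ≤ ‖pairMap τA τB t‖ ^ 2 := by
    rw [sq ‖pairMap τA τB t‖]
    simpa using h1
  exact (sq_le_sq₀ (norm_nonneg _) (norm_nonneg _)).mp h2

end maxTensorReps

/-! ### The identity correspondence gives back the original pair -/

section identityRep

variable {A C H : Type u} [NonUnitalCStarAlgebra A] [PartialOrder A] [StarOrderedRing A]
  [NonUnitalCStarAlgebra C] [NormedAddCommGroup H] [InnerProductSpace ℂ H] [CompleteSpace H]

/-- The identification of `A ⊗_φ H` with the essential subspace of `φ` carries `λ_A ⊗ ρ` to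
`φ × ρ`. -/
theorem pairMap_identity_intertwine {φ : A →⋆ₙₐ[ℂ] (H →L[ℂ] H)} {ρ : C →⋆ₙₐ[ℂ] (H →L[ℂ] H)}
    (hc : ∀ a c, Commute (φ a) (ρ c)) {U : InteriorTensor A φ →L[ℂ] H}
    (hU : ∀ a h, U (InteriorTensor.tmul φ a h) = φ a h) (t : A ⊗[ℂ] C)
    (x : InteriorTensor A φ) :
    U (pairMap (leftRep (identityCorr A) φ) (rightRep A φ ρ hc) t x) = pairMap φ ρ t (U x) := by
  induction t using TensorProduct.induction_on with
  | zero => simp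
  | add s t hs ht =>
    rw [map_add, map_add, _root_.add_apply, _root_.add_apply, map_add,
      hs, ht]
  | tmul a c =>
    rw [pairMap_tmul, pairMap_tmul]
    have h : U ∘L (leftRep (identityCorr A) φ a * rightRep A φ ρ hc c) = (φ a * ρ c) ∘L U := by
      refine InteriorTensor.ext_clm φ fun b h => ?_
      rw [ContinuousLinearMap.comp_apply, ContinuousLinearMap.comp_apply, mul_apply_eq_comp,
        mul_apply_eq_comp, rightRep_tmul, leftRep_tmul, hU, hU]
      change φ (a * b) (ρ c h) = _
      rw [map_mul, mul_apply_eq_comp, ← mul_apply_eq_comp (φ b), (hc b c).eq, mul_apply_eq_comp]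
    exact congrArg (fun T : InteriorTensor A φ →L[ℂ] H => T x) h

end identityRep

/-! ### Compression along an intertwiner into the commutant -/

section compress

variable {A B X H K : Type u} [NonUnitalCStarAlgebra A] [PartialOrder A] [StarOrderedRing A]
  [NonUnitalCStarAlgebra B] [NormedAddCommGroup X] [NormedSpace ℂ X] [HilbertModule A X]
  [NormedAddCommGroup H] [InnerProductSpace ℂ H] [CompleteSpace H]
  [NormedAddCommGroup K] [InnerProductSpace ℂ K] [CompleteSpace K]
  {φ : A →⋆ₙₐ[ℂ] (H →L[ℂ] H)} {σA : A →⋆ₙₐ[ℂ] (K →L[ℂ] K)} {σB : B →⋆ₙₐ[ℂ] (K →L[ℂ] K)}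

theorem adjoint_intertwine {W : H →L[ℂ] K} (hW : ∀ a h, W (φ a h) = σA a (W h)) (a : A) (k : K) :
    W.adjoint (σA a k) = φ a (W.adjoint k) := by
  refine ext_inner_right ℂ fun h => ?_
  rw [ContinuousLinearMap.adjoint_inner_left, ← star_star a, map_star σA, map_star φ,
    ContinuousLinearMap.star_eq_adjoint, ContinuousLinearMap.star_eq_adjoint,
    ContinuousLinearMap.adjoint_inner_left, ContinuousLinearMap.adjoint_inner_left,
    ContinuousLinearMap.adjoint_inner_left, hW]

/-- The compression `b ↦ W* σ_B(b) W` along an intertwiner `W` of `φ` and `σ_A`, as a map into the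
commutant of `φ`. -/
def compress (hc : ∀ a b, Commute (σA a) (σB b)) (W : H →L[ℂ] K)
    (hW : ∀ a h, W (φ a h) = σA a (W h)) : B →ₗ[ℂ] commutant φ where
  toFun b := ⟨W.adjoint ∘L σB b ∘L W, by
    -- `φ(a) W* σ_B(b) W = W* σ_A(a) σ_B(b) W = W* σ_B(b) σ_A(a) W = W* σ_B(b) W φ(a)`.
    have h : ∀ a, φ a * (W.adjoint ∘L σB b ∘L W) = (W.adjoint ∘L σB b ∘L W) * φ a := by
      intro a
      ext h
      have h1 := congrArg (fun T : K →L[ℂ] K => T (W h)) (hc a b).eq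
      simp only [mul_apply_eq_comp] at h1
      simp only [mul_apply_eq_comp, ContinuousLinearMap.comp_apply, hW]
      rw [← adjoint_intertwine hW, h1]
    refine (StarSubalgebra.mem_centralizer_iff ℂ).mpr ?_
    rintro _ ⟨a, rfl⟩
    exact ⟨h a, by rw [← map_star]; exact h (star a)⟩⟩
  map_add' b c := Subtype.ext <| by
    ext h; simp
  map_smul' c b := Subtype.ext <| by
    ext h; simp

theorem commutantIncl_compress (hc : ∀ a b, Commute (σA a) (σB b)) (W : H →L[ℂ] K)
    (hW : ∀ a h, W (φ a h) = σA a (W h)) (b : B) (h : H) :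
    commutantIncl φ (compress hc W hW b) h = W.adjoint (σB b (W h)) := rfl

/-- The compression is not multiplicative, but only `B` is compressed, and `φ(a) W* = W* σ_A(a)`
pulls the factor from `A` inside. Hence the whole product is compressed along `W`. -/
theorem pairMap_compress (hc : ∀ a b, Commute (σA a) (σB b)) (W : H →L[ℂ] K)
    (hW : ∀ a h, W (φ a h) = σA a (W h)) (t : A ⊗[ℂ] B) :
    pairMap φ (commutantIncl φ) ((compress hc W hW).lTensor A t)
      = W.adjoint ∘L pairMap σA σB t ∘L W := by
  induction t using TensorProduct.induction_on with
  | zero => simp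
  | add s t hs ht => simp only [map_add, hs, ht, ContinuousLinearMap.add_comp,
      ContinuousLinearMap.comp_add]
  | tmul a b =>
    ext h
    rw [LinearMap.lTensor_tmul, pairMap_tmul, pairMap_tmul, mul_apply_eq_comp,
      commutantIncl_compress, ← adjoint_intertwine hW]
    rfl

/-- If `M = 1 ⊗ W` then `M* = 1 ⊗ W*`: both sides have the same inner products with elementary
tensors, because `W` intertwines the actions of the module inner products. -/
theorem interiorMap_adjoint {W : H →L[ℂ] K} (hW : ∀ a h, W (φ a h) = σA a (W h))
    {M : InteriorTensor X φ →L[ℂ] InteriorTensor X σA}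
    (hM : ∀ x h, M (InteriorTensor.tmul φ x h) = InteriorTensor.tmul σA x (W h)) (x : X) (k : K) :
    M.adjoint (InteriorTensor.tmul σA x k) = InteriorTensor.tmul φ x (W.adjoint k) := by
  have h : (innerSL ℂ (M.adjoint (InteriorTensor.tmul σA x k)))
      = innerSL ℂ (InteriorTensor.tmul φ x (W.adjoint k)) := by
    refine InteriorTensor.ext_clm φ fun y h => ?_
    rw [innerSL_apply_apply, innerSL_apply_apply, ContinuousLinearMap.adjoint_inner_left, hM,
      InteriorTensor.inner_tmul, InteriorTensor.inner_tmul, ContinuousLinearMap.adjoint_inner_left,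
      hW]
  refine ext_inner_right ℂ fun z => ?_
  exact congrArg (fun T : InteriorTensor X φ →L[ℂ] ℂ => T z) h

/-- The counterpart of `pairMap_compress` on `X ⊗ H`, with `1 ⊗ W` in place of `W`. When `W` is a
contraction, the transported tensor therefore has norm at most that of `t` on `X ⊗ K`. -/
theorem pairMap_interior_compress (π : LeftAction A A X) (hc : ∀ a b, Commute (σA a) (σB b))
    (W : H →L[ℂ] K) (hW : ∀ a h, W (φ a h) = σA a (W h))
    {M : InteriorTensor X φ →L[ℂ] InteriorTensor X σA}
    (hM : ∀ x h, M (InteriorTensor.tmul φ x h) = InteriorTensor.tmul σA x (W h)) (t : A ⊗[ℂ] B) :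
    pairMap (leftRep π φ) (rightRep X φ (commutantIncl φ) (commute_commutantIncl φ))
        ((compress hc W hW).lTensor A t)
      = M.adjoint ∘L pairMap (leftRep π σA) (rightRep X σA σB hc) t ∘L M := by
  induction t using TensorProduct.induction_on with
  | zero => simp
  | add s t hs ht => simp only [map_add, hs, ht, ContinuousLinearMap.add_comp,
      ContinuousLinearMap.comp_add]
  | tmul a b =>
    refine InteriorTensor.ext_clm φ fun x h => ?_
    rw [LinearMap.lTensor_tmul, pairMap_tmul, pairMap_tmul, ContinuousLinearMap.comp_apply,
      ContinuousLinearMap.comp_apply, mul_apply_eq_comp, mul_apply_eq_comp, hM, rightRep_tmul,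
      rightRep_tmul, leftRep_tmul, leftRep_tmul, interiorMap_adjoint hW hM,
      commutantIncl_compress]

end compress

/-! ### The universal factorization property and weak containment -/

section factorization

variable {A X : Type u} [NonUnitalCStarAlgebra A] [PartialOrder A] [StarOrderedRing A]
  [NormedAddCommGroup X] [NormedSpace ℂ X] [HilbertModule A X]

theorem corrRep_incl {C H : Type u} [NonUnitalCStarAlgebra C] [NormedAddCommGroup H]
    [InnerProductSpace ℂ H] [CompleteSpace H] (π : LeftAction A A X)
    (φ : A →⋆ₙₐ[ℂ] (H →L[ℂ] H)) (ρ : C →⋆ₙₐ[ℂ] (H →L[ℂ] H)) (hc : ∀ a c, Commute (φ a) (ρ c))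
    (t : A ⊗[ℂ] C) :
    corrRep π φ ρ hc (MaxTensor.incl A C t) = pairMap (leftRep π φ) (rightRep X φ ρ hc) t :=
  MaxTensor.lift_incl _ t

/-- `A ⊗_φ H` embeds in `H` as the essential subspace of `φ`, so this compares a subrepresentation
with the whole of `φ × ρ`. For nondegenerate `φ` the embedding has dense range, which gives the
reverse inequality proved next. -/
theorem norm_corrRep_identity_le {C H : Type u} [NonUnitalCStarAlgebra C] [NormedAddCommGroup H]
    [InnerProductSpace ℂ H] [CompleteSpace H] (φ : A →⋆ₙₐ[ℂ] (H →L[ℂ] H))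
    (ρ : C →⋆ₙₐ[ℂ] (H →L[ℂ] H)) (hc : ∀ a c, Commute (φ a) (ρ c)) (z : MaxTensor A C) :
    ‖corrRep (identityCorr A) φ ρ hc z‖ ≤ ‖MaxTensor.lift φ ρ hc z‖ := by
  obtain ⟨U, hU, hUe⟩ := exists_identity_isometry φ
  refine MaxTensor.norm_le_of_incl (fun t => ?_) z
  rw [corrRep_incl, MaxTensor.lift_incl]
  exact norm_le_of_isometry_intertwine hU (pairMap_identity_intertwine hc hUe t)

theorem norm_pairMap_le_corrRep_identity {C H : Type u} [NonUnitalCStarAlgebra C]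
    [NormedAddCommGroup H] [InnerProductSpace ℂ H] [CompleteSpace H]
    {φ : A →⋆ₙₐ[ℂ] (H →L[ℂ] H)} (hφ : IsNondegenerate φ)
    (ρ : C →⋆ₙₐ[ℂ] (H →L[ℂ] H)) (hc : ∀ a c, Commute (φ a) (ρ c)) (t : A ⊗[ℂ] C) :
    ‖pairMap φ ρ t‖ ≤ ‖corrRep (identityCorr A) φ ρ hc (MaxTensor.incl A C t)‖ := by
  obtain ⟨U, hU, hUe⟩ := exists_identity_isometry φ
  rw [corrRep_incl]
  exact norm_le_of_denseRange_intertwine hU (hφ.denseRange fun a h => ⟨_, hUe a h⟩)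
    (pairMap_identity_intertwine hc hUe t)

/-- The UFP is applied to the commutant of `φ` and its inclusion; the identity correspondence yields
a subrepresentation of `φ × incl`, so it vanishes wherever the latter does. -/
theorem HasUFP.weaklyContained {π : LeftAction A A X} (h : HasUFP π) {H : Type u}
    [NormedAddCommGroup H] [InnerProductSpace ℂ H] [CompleteSpace H]
    {φ : A →⋆ₙₐ[ℂ] (H →L[ℂ] H)} (hφ : IsNondegenerate φ) :
    WeaklyContained (identityCorr A) π φ := by
  intro z hz
  have hcc := commute_commutantIncl φ
  have hnd : IsNondegenerate (MaxTensor.lift φ (commutantIncl φ) hcc) := by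
    rw [isNondegenerate_iff] at hφ ⊢
    intro x hx
    refine hφ x fun a => ?_
    -- The commutant is unital, so `a ⊗ 1` acts as `φ(a)` and nondegeneracy passes from `φ` to `φ ×
    -- incl`.
    have h1 := hx (MaxTensor.tmul a 1)
    rw [MaxTensor.lift_tmul, mul_apply_eq_comp] at h1
    exact h1
  have h0 := h (commutant φ) H _ φ (commutantIncl φ) hcc hnd (MaxTensor.lift_tmul _ _ _) z hz
  have hle := norm_corrRep_identity_le φ (commutantIncl φ) hcc z
  rw [h0, norm_zero, norm_le_zero_iff] at hle
  exact hle

/-- Weak containment with respect to `φ` controls the vector functionals at those vectors that lie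
in the image of a contractive intertwiner from `φ`. -/
theorem WeaklyContained.norm_inner_le {π : LeftAction A A X} {B H K : Type u}
    [NonUnitalCStarAlgebra B] [NormedAddCommGroup H] [InnerProductSpace ℂ H] [CompleteSpace H]
    [NormedAddCommGroup K] [InnerProductSpace ℂ K] [CompleteSpace K]
    {φ : A →⋆ₙₐ[ℂ] (H →L[ℂ] H)} (hφ : IsNondegenerate φ)
    (h : WeaklyContained (identityCorr A) π φ) {σA : A →⋆ₙₐ[ℂ] (K →L[ℂ] K)}
    {σB : B →⋆ₙₐ[ℂ] (K →L[ℂ] K)} (hc : ∀ a b, Commute (σA a) (σB b)) {W : H →L[ℂ] K}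
    (hW : ∀ a h, W (φ a h) = σA a (W h)) (hW1 : ‖W‖ ≤ 1) {η : H} (hη : ‖η‖ = 1)
    (t : A ⊗[ℂ] B) :
    ‖⟪W η, pairMap σA σB t (W η)⟫_ℂ‖ ≤ ‖pairMap (leftRep π σA) (rightRep X σA σB hc) t‖ := by
  have hcc := commute_commutantIncl φ
  obtain ⟨M, hM1, hM⟩ := exists_interiorMap X W hW
  set s := (compress hc W hW).lTensor A t with hs
  have h1 : ⟪W η, pairMap σA σB t (W η)⟫_ℂ = ⟪η, pairMap φ (commutantIncl φ) s η⟫_ℂ := by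
    rw [hs, pairMap_compress, ContinuousLinearMap.comp_apply,
      ContinuousLinearMap.adjoint_inner_right, ContinuousLinearMap.comp_apply]
  have h2 : ‖⟪η, pairMap φ (commutantIncl φ) s η⟫_ℂ‖ ≤ ‖pairMap φ (commutantIncl φ) s‖ := by
    refine (norm_inner_le_norm _ _).trans ?_
    rw [hη, one_mul]
    exact (ContinuousLinearMap.le_opNorm _ _).trans (by rw [hη, mul_one])
  have h3 := norm_pairMap_le_corrRep_identity hφ (commutantIncl φ) hcc s
  -- The only use of weak containment, at the transported tensor `s` rather than at `t`, since `s`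
  -- has its second leg in the commutant.
  have h4 := norm_le_of_ker_le _ _ h (MaxTensor.incl A _ s)
  have h5 : ‖corrRep π φ (commutantIncl φ) hcc (MaxTensor.incl A _ s)‖
      ≤ ‖pairMap (leftRep π σA) (rightRep X σA σB hc) t‖ := by
    rw [corrRep_incl, hs, pairMap_interior_compress π hc W hW hM]
    have hM' : ‖M‖ ≤ 1 := hM1.trans hW1
    set P := pairMap (leftRep π σA) (rightRep X σA σB hc) t
    calc ‖M.adjoint ∘L P ∘L M‖ ≤ ‖M.adjoint‖ * (‖P‖ * ‖M‖) :=
          (ContinuousLinearMap.opNorm_comp_le _ _).trans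
            (by gcongr; exact ContinuousLinearMap.opNorm_comp_le _ _)
      _ ≤ 1 * (‖P‖ * 1) := by rw [LinearIsometryEquiv.norm_map]; gcongr
      _ = ‖P‖ := by rw [one_mul, mul_one]
  rw [h1]
  exact h2.trans (h3.trans (h4.trans h5))

/-- The intertwiner from the universal representation depends on the vector `ξ`. The vector
functionals are bounded one at a time, and `norm_pairMap_le_of_inner` assembles these bounds into
one on the operator norm. -/
theorem WeaklyContainedUniv.hasUFP {π : LeftAction A A X}
    (h : WeaklyContainedUniv (identityCorr A) π) : HasUFP π := by
  intro B _ H _ _ _ σ σA σB hc hnd hσ z hz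
  have hle : ‖σ z‖ ≤ ‖corrRep π σA σB hc z‖ := by
    refine MaxTensor.norm_le_of_incl (fun t => ?_) z
    rw [MaxTensor.rep_incl hσ, corrRep_incl]
    refine norm_pairMap_le_of_inner hc (leftRep_commute_rightRep π σA σB hc) (fun ξ hξ t => ?_) t
    obtain ⟨W, η, hW1, hW, rfl, hη⟩ :=
      exists_universal_intertwiner (hnd.of_maxTensor hc hσ) hξ
    exact WeaklyContained.norm_inner_le universalRep_isNondegenerate h hc hW hW1 hη t
  rw [hz, norm_zero, norm_le_zero_iff] at hle
  exact hle

theorem hasUFP_iff_weaklyContainedUniv (π : LeftAction A A X) :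
    HasUFP π ↔ WeaklyContainedUniv (identityCorr A) π :=
  ⟨fun h => h.weaklyContained universalRep_isNondegenerate, WeaklyContainedUniv.hasUFP⟩

end factorization

/-! ### The Hilbert space tensor product and its amplifications -/

section hilbertTensor

variable {H K : Type*} [NormedAddCommGroup H] [InnerProductSpace ℂ H]
  [NormedAddCommGroup K] [InnerProductSpace ℂ K]

/-- The Hilbert space tensor product. -/
def HilbertTensor (H K : Type*) [NormedAddCommGroup H] [InnerProductSpace ℂ H]
    [NormedAddCommGroup K] [InnerProductSpace ℂ K] : Type _ :=
  UniformSpace.Completion (H ⊗[ℂ] K)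

instance : NormedAddCommGroup (HilbertTensor H K) :=
  inferInstanceAs (NormedAddCommGroup (UniformSpace.Completion (H ⊗[ℂ] K)))
instance : InnerProductSpace ℂ (HilbertTensor H K) :=
  inferInstanceAs (InnerProductSpace ℂ (UniformSpace.Completion (H ⊗[ℂ] K)))
instance : CompleteSpace (HilbertTensor H K) :=
  inferInstanceAs (CompleteSpace (UniformSpace.Completion (H ⊗[ℂ] K)))

/-- The canonical map from the algebraic to the Hilbert space tensor product. -/
def HilbertTensor.ofAlg (H K : Type*) [NormedAddCommGroup H] [InnerProductSpace ℂ H]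
    [NormedAddCommGroup K] [InnerProductSpace ℂ K] : (H ⊗[ℂ] K) →L[ℂ] HilbertTensor H K :=
  UniformSpace.Completion.toComplL

theorem HilbertTensor.denseRange_ofAlg : DenseRange (HilbertTensor.ofAlg H K) :=
  UniformSpace.Completion.denseRange_coe

/-- The elementary tensor `h ⊗ k` in the Hilbert space tensor product. -/
def htmul (h : H) (k : K) : HilbertTensor H K := HilbertTensor.ofAlg H K (h ⊗ₜ[ℂ] k)

theorem inner_htmul (h h' : H) (k k' : K) :
    ⟪htmul h k, htmul h' k'⟫_ℂ = ⟪h, h'⟫_ℂ * ⟪k, k'⟫_ℂ :=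
  (UniformSpace.Completion.inner_coe _ _).trans (by rw [TensorProduct.inner_tmul])

/-- The elementary tensor `h ⊗ k` as a continuous linear map of `k`. -/
def htmulL (h : H) : K →L[ℂ] HilbertTensor H K :=
  HilbertTensor.ofAlg H K ∘L TensorProduct.mkL ℂ H K h

theorem dense_span_htmul :
    Dense (Submodule.span ℂ (Set.range fun p : H × K => htmul p.1 p.2) :
      Set (HilbertTensor H K)) := by
  refine HilbertTensor.denseRange_ofAlg.mono ?_
  rintro _ ⟨z, rfl⟩
  obtain ⟨n, h, k, rfl⟩ := exists_fin_sum z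
  rw [map_sum]
  exact Submodule.sum_mem _ fun i _ => Submodule.subset_span ⟨(h i, k i), rfl⟩

theorem HilbertTensor.ext_clm {F : Type*} [NormedAddCommGroup F] [NormedSpace ℂ F]
    {f g : HilbertTensor H K →L[ℂ] F} (h : ∀ x y, f (htmul x y) = g (htmul x y)) : f = g :=
  ContinuousLinearMap.ext_on dense_span_htmul (by rintro _ ⟨p, rfl⟩; exact h _ _)

/-- The operator `S ⊗ R` on the Hilbert space tensor product. -/
def hilbertOp (S : H →L[ℂ] H) (R : K →L[ℂ] K) : HilbertTensor H K →L[ℂ] HilbertTensor H K :=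
  ContinuousLinearMap.completion (α := H ⊗[ℂ] K) (β := H ⊗[ℂ] K) (TensorProduct.mapL S R)

theorem hilbertOp_htmul (S : H →L[ℂ] H) (R : K →L[ℂ] K) (h : H) (k : K) :
    hilbertOp S R (htmul h k) = htmul (S h) (R k) :=
  ContinuousLinearMap.completion_apply_coe _ _

theorem add_htmul (h h' : H) (k : K) : htmul (h + h') k = htmul h k + htmul h' k := by
  rw [htmul, TensorProduct.add_tmul, map_add]; rfl

theorem smul_htmul (c : ℂ) (h : H) (k : K) : htmul (c • h) k = c • htmul h k := by
  rw [htmul, ← TensorProduct.smul_tmul', map_smul]; rfl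

theorem htmul_add (h : H) (k k' : K) : htmul h (k + k') = htmul h k + htmul h k' :=
  map_add (htmulL h) k k'

theorem htmul_smul (c : ℂ) (h : H) (k : K) : htmul h (c • k) = c • htmul h k :=
  map_smul (htmulL h) c k

/-- `hilbertOp` as a bilinear map. -/
def hilbertOpₗ (H K : Type*) [NormedAddCommGroup H] [InnerProductSpace ℂ H]
    [NormedAddCommGroup K] [InnerProductSpace ℂ K] :
    (H →L[ℂ] H) →ₗ[ℂ] (K →L[ℂ] K) →ₗ[ℂ] (HilbertTensor H K →L[ℂ] HilbertTensor H K) :=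
  LinearMap.mk₂ ℂ hilbertOp
    (fun _ _ _ => HilbertTensor.ext_clm fun _ _ => by simp [hilbertOp_htmul, add_htmul])
    (fun _ _ _ => HilbertTensor.ext_clm fun _ _ => by simp [hilbertOp_htmul, smul_htmul])
    (fun _ _ _ => HilbertTensor.ext_clm fun _ _ => by simp [hilbertOp_htmul, htmul_add])
    (fun _ _ _ => HilbertTensor.ext_clm fun _ _ => by simp [hilbertOp_htmul, htmul_smul])

theorem hilbertOpₗ_apply (S : H →L[ℂ] H) (R : K →L[ℂ] K) :
    hilbertOpₗ H K S R = hilbertOp S R := rfl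

theorem hilbertOpₗ_mul (S S' : H →L[ℂ] H) (R R' : K →L[ℂ] K) :
    hilbertOpₗ H K S R * hilbertOpₗ H K S' R' = hilbertOpₗ H K (S * S') (R * R') :=
  HilbertTensor.ext_clm fun h k => by
    simp only [mul_apply_eq_comp, hilbertOpₗ_apply, hilbertOp_htmul]

variable [CompleteSpace H] [CompleteSpace K]

theorem hilbertOpₗ_star (S : H →L[ℂ] H) (R : K →L[ℂ] K) :
    star (hilbertOpₗ H K S R) = hilbertOpₗ H K (star S) (star R) := by
  symm
  refine (ContinuousLinearMap.eq_adjoint_iff _ _).mpr fun z w => ?_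
  -- The adjoint relation is checked on elementary tensors and extended by density in one variable
  -- at a time; conjugate symmetry exchanges the two variables in between.
  have h : ∀ z, innerSL ℂ (hilbertOpₗ H K (star S) (star R) z)
      = (innerSL ℂ z) ∘L hilbertOpₗ H K S R := by
    intro z
    refine HilbertTensor.ext_clm fun h' k' => ?_
    have h1 : innerSL ℂ (htmul h' k') ∘L hilbertOpₗ H K (star S) (star R)
        = innerSL ℂ (hilbertOpₗ H K S R (htmul h' k')) := by
      refine HilbertTensor.ext_clm fun h k => ?_
      simp only [ContinuousLinearMap.comp_apply, innerSL_apply_apply, hilbertOpₗ_apply,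
        hilbertOp_htmul, inner_htmul, ContinuousLinearMap.star_eq_adjoint,
        ContinuousLinearMap.adjoint_inner_right]
    have h2 := congrArg (fun T : HilbertTensor H K →L[ℂ] ℂ => T z) h1
    simp only [ContinuousLinearMap.comp_apply, innerSL_apply_apply] at h2 ⊢
    rw [← inner_conj_symm, h2, inner_conj_symm]
  exact congrArg (fun T : HilbertTensor H K →L[ℂ] ℂ => T w) (h z)

/-- The amplification `S ↦ S ⊗ 1`. -/
def ampL (H K : Type*) [NormedAddCommGroup H] [InnerProductSpace ℂ H] [CompleteSpace H]
    [NormedAddCommGroup K] [InnerProductSpace ℂ K] [CompleteSpace K] :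
    (H →L[ℂ] H) →⋆ₙₐ[ℂ] (HilbertTensor H K →L[ℂ] HilbertTensor H K) where
  toFun S := hilbertOpₗ H K S 1
  map_smul' c S := by rw [map_smul]; rfl
  map_zero' := by rw [map_zero]; rfl
  map_add' S T := by rw [map_add]; rfl
  map_mul' S T := by rw [hilbertOpₗ_mul, one_mul]
  map_star' S := by rw [hilbertOpₗ_star, star_one]

/-- The amplification `R ↦ 1 ⊗ R`. -/
def ampR (H K : Type*) [NormedAddCommGroup H] [InnerProductSpace ℂ H] [CompleteSpace H]
    [NormedAddCommGroup K] [InnerProductSpace ℂ K] [CompleteSpace K] :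
    (K →L[ℂ] K) →⋆ₙₐ[ℂ] (HilbertTensor H K →L[ℂ] HilbertTensor H K) where
  toFun R := hilbertOpₗ H K 1 R
  map_smul' c R := by rw [map_smul]; rfl
  map_zero' := by rw [map_zero]
  map_add' S T := by rw [map_add]
  map_mul' S T := by rw [hilbertOpₗ_mul, one_mul]
  map_star' S := by rw [hilbertOpₗ_star, star_one]

theorem ampL_mul_ampR (S : H →L[ℂ] H) (R : K →L[ℂ] K) :
    ampL H K S * ampR H K R = hilbertOpₗ H K S R := by
  change hilbertOpₗ H K S 1 * hilbertOpₗ H K 1 R = _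
  rw [hilbertOpₗ_mul, one_mul, mul_one]

theorem commute_ampL_ampR (S : H →L[ℂ] H) (R : K →L[ℂ] K) :
    Commute (ampL H K S) (ampR H K R) := by
  change ampL H K S * ampR H K R = hilbertOpₗ H K 1 R * hilbertOpₗ H K S 1
  rw [ampL_mul_ampR, hilbertOpₗ_mul, one_mul, mul_one]

end hilbertTensor

/-! ### The spatial norm -/

section spatial

variable {A B H K : Type u} [NonUnitalCStarAlgebra A] [NonUnitalCStarAlgebra B]
  [NormedAddCommGroup H] [InnerProductSpace ℂ H] [CompleteSpace H]
  [NormedAddCommGroup K] [InnerProductSpace ℂ K] [CompleteSpace K]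

/-- The spatial representation `π ⊗ σ` of `A ⊙ B` on `H ⊗ K`. -/
def spatialRep (π : A →⋆ₙₐ[ℂ] (H →L[ℂ] H)) (σ : B →⋆ₙₐ[ℂ] (K →L[ℂ] K)) :
    (A ⊗[ℂ] B) →ₗ[ℂ] (HilbertTensor H K →L[ℂ] HilbertTensor H K) :=
  pairMap ((ampL H K).comp π) ((ampR H K).comp σ)

theorem spatialRep_tmul (π : A →⋆ₙₐ[ℂ] (H →L[ℂ] H)) (σ : B →⋆ₙₐ[ℂ] (K →L[ℂ] K)) (a : A) (b : B) :
    spatialRep π σ (a ⊗ₜ b) = hilbertOpₗ H K (π a) (σ b) :=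
  ampL_mul_ampR _ _

theorem spatialMap_eq_spatialRep (π : A →⋆ₙₐ[ℂ] (H →L[ℂ] H)) (σ : B →⋆ₙₐ[ℂ] (K →L[ℂ] K))
    (t : A ⊗[ℂ] B) : spatialMap π σ t = spatialRep π σ t :=
  LinearMap.congr_fun (f := spatialMap π σ) (g := spatialRep π σ)
    (TensorProduct.ext' fun a b => (spatialRep_tmul π σ a b).symm) t

theorem norm_spatialMap (π : A →⋆ₙₐ[ℂ] (H →L[ℂ] H)) (σ : B →⋆ₙₐ[ℂ] (K →L[ℂ] K))
    (t : A ⊗[ℂ] B) : ‖spatialMap π σ t‖ = ‖spatialRep π σ t‖ := by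
  rw [spatialMap_eq_spatialRep]
  rfl

theorem norm_spatialRep_le_maxNorm (π : A →⋆ₙₐ[ℂ] (H →L[ℂ] H)) (σ : B →⋆ₙₐ[ℂ] (K →L[ℂ] K))
    (t : A ⊗[ℂ] B) : ‖spatialRep π σ t‖ ≤ maxNorm t := by
  rw [spatialRep]
  exact le_maxNorm (H := HilbertTensor H K) (σA := (ampL H K).comp π) (σB := (ampR H K).comp σ)
    (fun a b => commute_ampL_ampR (π a) (σ b)) t

theorem norm_spatialRep_le_minNorm (π : A →⋆ₙₐ[ℂ] (H →L[ℂ] H)) (σ : B →⋆ₙₐ[ℂ] (K →L[ℂ] K))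
    (t : A ⊗[ℂ] B) : ‖spatialRep π σ t‖ ≤ minNorm t := by
  -- The maximal norm bounds the set whose supremum is the minimal norm.
  refine le_csSup ⟨maxNorm t, ?_⟩ ⟨H, _, _, _, K, _, _, _, π, σ, (norm_spatialMap π σ t).symm⟩
  rintro r ⟨H, _, _, _, K, _, _, _, π, σ, rfl⟩
  rw [norm_spatialMap]
  exact norm_spatialRep_le_maxNorm π σ t

theorem minNorm_le {t : A ⊗[ℂ] B} {c : ℝ} (hc : 0 ≤ c)
    (h : ∀ (H : Type u) [NormedAddCommGroup H] [InnerProductSpace ℂ H] [CompleteSpace H]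
      (K : Type u) [NormedAddCommGroup K] [InnerProductSpace ℂ K] [CompleteSpace K]
      (π : A →⋆ₙₐ[ℂ] (H →L[ℂ] H)) (σ : B →⋆ₙₐ[ℂ] (K →L[ℂ] K)), ‖spatialRep π σ t‖ ≤ c) :
    minNorm t ≤ c := by
  refine Real.sSup_le ?_ hc
  rintro r ⟨H, _, _, _, K, _, _, _, π, σ, rfl⟩
  rw [norm_spatialMap]
  exact h H K π σ

theorem minNorm_le_maxNorm (t : A ⊗[ℂ] B) : minNorm t ≤ maxNorm t :=
  minNorm_le (maxNorm_nonneg t) fun _ _ _ _ _ _ _ _ π σ => norm_spatialRep_le_maxNorm π σ t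

/-! ### Finite-dimensional compressions as matrices over `A` -/

section matrix

open InnerProductSpace

variable {n : ℕ} {e : Fin n → K}

/-- These rank-one operators are matrix units, which makes `matrixRep` multiplicative. -/
theorem rankOne_mul_rankOne (he : Orthonormal ℂ e) (i j k l : Fin n) :
    rankOne ℂ (e i) (e j) * rankOne ℂ (e k) (e l)
      = if j = k then rankOne ℂ (e i) (e l) else 0 := by
  rw [ContinuousLinearMap.mul_def, rankOne_comp_rankOne, orthonormal_iff_ite.mp he]
  split_ifs <;> simp

/-- The representation of `M_n(A)` on `H ⊗ K` given by a representation of `A` on `H` and an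
orthonormal family of `n` vectors in `K`. -/
def matrixRep (π : A →⋆ₙₐ[ℂ] (H →L[ℂ] H)) (he : Orthonormal ℂ e) :
    CStarMatrix (Fin n) (Fin n) A →⋆ₙₐ[ℂ] (HilbertTensor H K →L[ℂ] HilbertTensor H K) where
  toFun x := ∑ i, ∑ j, hilbertOpₗ H K (π (x i j)) (rankOne ℂ (e i) (e j))
  map_smul' c x := by simp [Finset.smul_sum]
  map_zero' := by simp
  map_add' x y := by simp [Finset.sum_add_distrib]
  map_mul' x y := by
    simp only [CStarMatrix.mul_apply, map_sum, map_mul, LinearMap.sum_apply, Finset.sum_mul,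
      Finset.mul_sum, hilbertOpₗ_mul, rankOne_mul_rankOne he]
    have h : ∀ i j k l, hilbertOpₗ H K (π (x i j) * π (y k l))
        (if j = k then rankOne ℂ (e i) (e l) else 0)
        = if j = k then hilbertOpₗ H K (π (x i j) * π (y k l)) (rankOne ℂ (e i) (e l)) else 0 := by
      intro i j k l
      split_ifs
      · rfl
      · rw [map_zero]
    simp only [h, Finset.sum_ite_eq', Finset.mem_univ, if_true]
    rw [Finset.sum_comm]
    conv_rhs => rw [Finset.sum_comm]
    exact Finset.sum_congr rfl fun l _ => Finset.sum_comm
  map_star' x := by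
    have h : ∀ i j, star (rankOne ℂ (e i) (e j)) = rankOne ℂ (e j) (e i) := fun i j =>
      adjoint_rankOne _ _
    simp only [star_sum, hilbertOpₗ_star, CStarMatrix.star_apply, map_star, h]
    rw [Finset.sum_comm]

theorem matrixRep_apply (π : A →⋆ₙₐ[ℂ] (H →L[ℂ] H)) (he : Orthonormal ℂ e)
    (x : CStarMatrix (Fin n) (Fin n) A) :
    matrixRep π he x = ∑ i, ∑ j, hilbertOpₗ H K (π (x i j)) (rankOne ℂ (e i) (e j)) := rfl

/-- The entry `x i j` is recovered from the inner products of `h' ⊗ e_i` with the image of `h ⊗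
e_j`. Injectivity makes the representation isometric, so that norms over different faithful `π` can
be compared through the matrix algebra. -/
theorem matrixRep_injective {π : A →⋆ₙₐ[ℂ] (H →L[ℂ] H)} (hπ : Function.Injective π)
    (he : Orthonormal ℂ e) : Function.Injective (matrixRep π he) := by
  refine (injective_iff_map_eq_zero _).mpr fun x hx => ?_
  ext i j
  rw [CStarMatrix.zero_apply]
  refine (injective_iff_map_eq_zero π).mp hπ _ ?_
  ext h
  refine ext_inner_left ℂ fun h' => ?_
  have h1 : ⟪htmul h' (e i), matrixRep π he x (htmul h (e j))⟫_ℂ = ⟪h', π (x i j) h⟫_ℂ := by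
    simp only [matrixRep_apply, _root_.sum_apply, inner_sum, hilbertOpₗ_apply, hilbertOp_htmul,
      inner_htmul, rankOne_apply, inner_smul_right, orthonormal_iff_ite.mp he]
    simp
  rw [← h1, hx]
  simp

/-- The matrix with entries `(1 ⊗ ⟨e_i, σ(·) e_j⟩)(t)`. -/
def matrixCoeff (A : Type u) [NonUnitalCStarAlgebra A] (σ : B →⋆ₙₐ[ℂ] (K →L[ℂ] K))
    (e : Fin n → K) : (A ⊗[ℂ] B) →ₗ[ℂ] CStarMatrix (Fin n) (Fin n) A :=
  TensorProduct.lift <| LinearMap.mk₂ ℂ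
    (fun a b => CStarMatrix.ofMatrix fun i j => ⟪e i, σ b (e j)⟫_ℂ • a)
    (fun _ _ _ => by ext; exact smul_add _ _ _)
    (fun _ _ _ => by ext; exact smul_comm _ _ _)
    (fun a b b' => by
      ext i j
      change ⟪e i, σ (b + b') (e j)⟫_ℂ • a = ⟪e i, σ b (e j)⟫_ℂ • a + ⟪e i, σ b' (e j)⟫_ℂ • a
      rw [map_add, _root_.add_apply, inner_add_right, add_smul])
    (fun c a b => by
      ext i j
      change ⟪e i, σ (c • b) (e j)⟫_ℂ • a = c • ⟪e i, σ b (e j)⟫_ℂ • a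
      rw [map_smul, _root_.smul_apply, inner_smul_right, mul_smul])

/-- The compression of `(π ⊗ σ)(t)` to a finite-dimensional subspace of the second factor. -/
theorem compression_spatialRep (π : A →⋆ₙₐ[ℂ] (H →L[ℂ] H)) (σ : B →⋆ₙₐ[ℂ] (K →L[ℂ] K))
    (he : Orthonormal ℂ e) (t : A ⊗[ℂ] B) :
    ampR H K (∑ i, rankOne ℂ (e i) (e i)) * spatialRep π σ t
        * ampR H K (∑ i, rankOne ℂ (e i) (e i))
      = matrixRep π he (matrixCoeff A σ e t) := by
  induction t using TensorProduct.induction_on with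
  | zero => simp
  | add s t hs ht => rw [map_add, map_add, map_add, mul_add, add_mul, hs, ht]
  | tmul a b =>
    have h1 : (∑ i, rankOne ℂ (e i) (e i)) * σ b * (∑ i, rankOne ℂ (e i) (e i))
        = ∑ i, ∑ j, ⟪e i, σ b (e j)⟫_ℂ • rankOne ℂ (e i) (e j) := by
      ext k
      simp only [mul_apply_eq_comp, _root_.sum_apply, rankOne_apply, map_sum, map_smul,
        _root_.smul_apply, smul_smul, Finset.smul_sum]
      rw [Finset.sum_comm]
      exact Finset.sum_congr rfl fun i _ => Finset.sum_congr rfl fun j _ => by rw [mul_comm]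
    have h2 : ∀ i j, matrixCoeff A σ e (a ⊗ₜ b) i j = ⟪e i, σ b (e j)⟫_ℂ • a := fun _ _ => rfl
    rw [matrixRep_apply, spatialRep_tmul]
    change hilbertOpₗ H K 1 _ * _ * hilbertOpₗ H K 1 _ = _
    rw [hilbertOpₗ_mul, hilbertOpₗ_mul, one_mul, mul_one, h1]
    simp only [map_sum, map_smul, h2, LinearMap.smul_apply]

theorem ampR_coe_of_mem (R : K →L[ℂ] K) (h : Fin n → H) (k : Fin n → K)
    (hR : ∀ i, R (k i) = k i) :
    ampR H K R (HilbertTensor.ofAlg H K (∑ i, h i ⊗ₜ[ℂ] k i))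
      = HilbertTensor.ofAlg H K (∑ i, h i ⊗ₜ[ℂ] k i) := by
  rw [map_sum, map_sum]
  refine Finset.sum_congr rfl fun i _ => ?_
  change hilbertOp 1 R (htmul (h i) (k i)) = htmul (h i) (k i)
  rw [hilbertOp_htmul, hR]
  rfl

end matrix

/-- The spatial norm does not depend on the choice of a faithful representation of the first
factor. -/
theorem norm_spatialRep_le_of_injective_left {H' : Type u} [NormedAddCommGroup H']
    [InnerProductSpace ℂ H'] [CompleteSpace H'] (π : A →⋆ₙₐ[ℂ] (H →L[ℂ] H))
    {π' : A →⋆ₙₐ[ℂ] (H' →L[ℂ] H')} (hπ' : Function.Injective π') (σ : B →⋆ₙₐ[ℂ] (K →L[ℂ] K))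
    (t : A ⊗[ℂ] B) : ‖spatialRep π σ t‖ ≤ ‖spatialRep π' σ t‖ := by
  have key : ∀ w z : H ⊗[ℂ] K, ‖⟪HilbertTensor.ofAlg H K z, spatialRep π σ t (HilbertTensor.ofAlg H K w)⟫_ℂ‖
      ≤ ‖spatialRep π' σ t‖ * ‖HilbertTensor.ofAlg H K z‖ * ‖HilbertTensor.ofAlg H K w‖ := by
    intro w z
    -- The C*-algebra structure on matrices over `A` relies on an order of `A`; the spectral order
    -- serves.
    let _ : PartialOrder A := CStarAlgebra.spectralOrder A
    have : StarOrderedRing A := CStarAlgebra.spectralOrderedRing A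
    obtain ⟨n, h, k, rfl⟩ := exists_fin_sum w
    obtain ⟨m, h', k', rfl⟩ := exists_fin_sum z
    -- `V` contains the second legs of both vectors, so the projection `1 ⊗ P` fixes them. Their
    -- matrix coefficient sees only the corner of `(π ⊗ σ)(t)` cut out by `1 ⊗ P`, which is the
    -- image of a matrix over `A` not depending on `π`.
    let V : Submodule ℂ K := Submodule.span ℂ (Set.range k ∪ Set.range k')
    have : FiniteDimensional ℂ V := FiniteDimensional.span_of_finite ℂ
      ((Set.finite_range k).union (Set.finite_range k'))
    let b := stdOrthonormalBasis ℂ V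
    let e : Fin (Module.finrank ℂ V) → K := fun i => b i
    have he : Orthonormal ℂ e := b.orthonormal.comp_linearIsometry V.subtypeₗᵢ
    have hP : V.starProjection = ∑ i, InnerProductSpace.rankOne ℂ (e i) (e i) :=
      b.starProjection_eq_sum_rankOne
    set P := ∑ i, InnerProductSpace.rankOne ℂ (e i) (e i) with hPdef
    have hPmem : ∀ x ∈ V, P x = x := fun x hx => by
      rw [← hP]; exact Submodule.starProjection_eq_self_iff.mpr hx
    have hPsa : star P = P := by
      simp [hPdef, star_sum, ContinuousLinearMap.star_eq_adjoint]
    have hP1 : ∀ (L : Type u) [NormedAddCommGroup L] [InnerProductSpace ℂ L] [CompleteSpace L],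
        ‖ampR L K P‖ ≤ 1 := fun L _ _ _ =>
      (NonUnitalStarAlgHom.norm_apply_le (ampR L K) P).trans
        (by rw [← hP]; exact V.starProjection_norm_le)
    have hPw := ampR_coe_of_mem P h k fun i => hPmem _ (Submodule.subset_span (.inl ⟨i, rfl⟩))
    have hPz := ampR_coe_of_mem P h' k' fun i => hPmem _ (Submodule.subset_span (.inr ⟨i, rfl⟩))
    set w : HilbertTensor H K := HilbertTensor.ofAlg H K (∑ i, h i ⊗ₜ[ℂ] k i)
    set z : HilbertTensor H K := HilbertTensor.ofAlg H K (∑ i, h' i ⊗ₜ[ℂ] k' i)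
    have h1 : ⟪z, spatialRep π σ t w⟫_ℂ = ⟪z, matrixRep π he (matrixCoeff A σ e t) w⟫_ℂ := by
      rw [← compression_spatialRep, mul_apply_eq_comp, mul_apply_eq_comp, ← hPdef, hPw]
      conv_lhs => rw [← hPz]
      rw [← ContinuousLinearMap.adjoint_inner_right, ← ContinuousLinearMap.star_eq_adjoint,
        ← map_star, hPsa]
    -- Representations are contractive and faithful ones isometric, so the norm of the corner for
    -- `π` is at most that for `π'`, which is a compression of `(π' ⊗ σ)(t)`.
    have h2 : ‖matrixRep π he (matrixCoeff A σ e t)‖ ≤ ‖spatialRep π' σ t‖ :=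
      calc ‖matrixRep π he (matrixCoeff A σ e t)‖
          ≤ ‖matrixCoeff A σ e t‖ := NonUnitalStarAlgHom.norm_apply_le _ _
        _ = ‖matrixRep π' he (matrixCoeff A σ e t)‖ :=
          (NonUnitalStarAlgHom.norm_map _ (matrixRep_injective hπ' he) _).symm
        _ ≤ ‖ampR H' K P‖ * ‖spatialRep π' σ t‖ * ‖ampR H' K P‖ := by
          rw [← compression_spatialRep]
          exact (norm_mul_le _ _).trans (by gcongr; exact norm_mul_le _ _)
        _ ≤ 1 * ‖spatialRep π' σ t‖ * 1 := by
          gcongr <;> exact hP1 H'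
        _ = ‖spatialRep π' σ t‖ := by rw [one_mul, mul_one]
    rw [h1]
    calc _ ≤ ‖z‖ * (‖matrixRep π he (matrixCoeff A σ e t)‖ * ‖w‖) :=
          (norm_inner_le_norm _ _).trans (by gcongr; exact ContinuousLinearMap.le_opNorm _ _)
      _ ≤ ‖z‖ * (‖spatialRep π' σ t‖ * ‖w‖) := by gcongr
      _ = _ := by ring
  have key2 : ∀ w z : HilbertTensor H K, ‖⟪z, spatialRep π σ t w⟫_ℂ‖
      ≤ ‖spatialRep π' σ t‖ * ‖z‖ * ‖w‖ := by
    intro w z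
    refine HilbertTensor.denseRange_ofAlg.induction_on₂ (p := fun w z =>
      ‖⟪z, spatialRep π σ t w⟫_ℂ‖ ≤ ‖spatialRep π' σ t‖ * ‖z‖ * ‖w‖) ?_ key w z
    apply isClosed_le <;> fun_prop
  refine ContinuousLinearMap.opNorm_le_of_re_inner_le (𝕜 := ℂ) (norm_nonneg _) fun x y hx hy => ?_
  have h3 := key2 x y
  rw [hx, hy, mul_one, mul_one, norm_inner_symm] at h3
  exact (RCLike.re_le_norm _).trans h3

/-- The flip of the tensor factors does not increase the spatial norm. -/
theorem norm_spatialRep_le_comm (π : A →⋆ₙₐ[ℂ] (H →L[ℂ] H)) (σ : B →⋆ₙₐ[ℂ] (K →L[ℂ] K))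
    (t : A ⊗[ℂ] B) :
    ‖spatialRep π σ t‖ ≤ ‖spatialRep σ π (TensorProduct.comm ℂ A B t)‖ := by
  obtain ⟨U, hU, hUe⟩ := exists_isometry_of_gram (fun p : H × K => htmul p.1 p.2)
    (fun p => htmul p.2 p.1) dense_span_htmul fun p q => by
      rw [inner_htmul, inner_htmul, mul_comm]
  refine norm_le_of_isometry_intertwine hU fun x => ?_
  induction t using TensorProduct.induction_on with
  | zero => simp
  | add s t hs ht =>
    rw [map_add, map_add, map_add, _root_.add_apply, _root_.add_apply, map_add, hs, ht]
  | tmul a b =>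
    rw [TensorProduct.comm_tmul, spatialRep_tmul, spatialRep_tmul]
    have h : U ∘L hilbertOpₗ H K (π a) (σ b) = hilbertOpₗ K H (σ b) (π a) ∘L U := by
      refine HilbertTensor.ext_clm fun h k => ?_
      have h1 : ∀ h k, U (htmul h k) = htmul k h := fun h k => hUe (h, k)
      simp only [ContinuousLinearMap.comp_apply, hilbertOpₗ_apply, hilbertOp_htmul, h1]
    exact congrArg (fun T : HilbertTensor H K →L[ℂ] HilbertTensor K H => T x) h

/-- The minimal norm is attained at any pair of faithful representations. -/
theorem minNorm_eq_of_injective {π : A →⋆ₙₐ[ℂ] (H →L[ℂ] H)} {σ : B →⋆ₙₐ[ℂ] (K →L[ℂ] K)}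
    (hπ : Function.Injective π) (hσ : Function.Injective σ) (t : A ⊗[ℂ] B) :
    minNorm t = ‖spatialRep π σ t‖ := by
  refine le_antisymm (minNorm_le (norm_nonneg _) ?_) (norm_spatialRep_le_minNorm π σ t)
  intro H' _ _ _ K' _ _ _ π' σ'
  -- Exchange the first representation, flip, exchange the other one, and flip back.
  have h1 := norm_spatialRep_le_of_injective_left π' hπ σ' t
  have h2 := norm_spatialRep_le_comm π σ' t
  have h3 := norm_spatialRep_le_of_injective_left σ' hσ π (TensorProduct.comm ℂ A B t)
  have h4 := norm_spatialRep_le_comm σ π (TensorProduct.comm ℂ A B t)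
  have h5 : TensorProduct.comm ℂ B A (TensorProduct.comm ℂ A B t) = t := by simp
  rw [h5] at h4
  exact h1.trans (h2.trans (h3.trans h4))

end spatial

/-! ### The scalar correspondence yields the spatial representation -/

section scalarRep

variable {A B H K : Type u} [NonUnitalCStarAlgebra A] [PartialOrder A] [StarOrderedRing A]
  [NonUnitalCStarAlgebra B]
  [NormedAddCommGroup H] [InnerProductSpace ℂ H] [CompleteSpace H]
  [NormedAddCommGroup K] [InnerProductSpace ℂ K] [CompleteSpace K]

theorem InteriorTensor.continuous_tmul_left {X : Type*} [NormedAddCommGroup X] [NormedSpace ℂ X]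
    [HilbertModule A X] (φ : A →⋆ₙₐ[ℂ] (K →L[ℂ] K)) (k : K) :
    Continuous fun x : X => InteriorTensor.tmul φ x k := by
  let T : X →ₗ[ℂ] InteriorTensor X φ :=
    { toFun := fun x => InteriorTensor.tmul φ x k
      map_add' := fun x y => InteriorTensor.add_tmul φ x y k
      map_smul' := fun c x => InteriorTensor.smul_tmul φ c x k }
  refine (T.mkContinuous ‖k‖ fun x => ?_).continuous
  rw [mul_comm]
  change ‖((PreInteriorTensor.mk φ (x ⊗ₜ[ℂ] k) : PreInteriorTensor X φ) : InteriorTensor X φ)‖ ≤ _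
  rw [UniformSpace.Completion.norm_coe]
  exact PreInteriorTensor.norm_tmul_le φ x k

/-- The elementary tensor `h ⊗ a` of `H ⊗ A`. -/
def ScalarModule.tmul (h : H) (a : A) : ScalarModule H A :=
  ScalarModule.ofAlg H A (PreScalarModule.mk H A (h ⊗ₜ a))

theorem ScalarModule.inner_tmul (h h' : H) (a a' : A) :
    HilbertModule.inner (A := A) (ScalarModule.tmul h a) (ScalarModule.tmul h' a')
      = ⟪h, h'⟫_ℂ • (star a * a') :=
  ScalarModule.innerFun_ofAlg _ _

theorem scalarCorr_tmul (πH : A →⋆ₙₐ[ℂ] (H →L[ℂ] H)) (c : A) (h : H) (a : A) :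
    (scalarCorr A πH).toHom c (ScalarModule.tmul h a) = ScalarModule.tmul (πH c h) a :=
  ScalarModule.op_ofAlg _ _

/-- For fixed `k` the map `x ↦ x ⊗ k` is continuous, so `x` may be taken in the algebraic tensor
product of `H` and `A`, dense in its completion. -/
theorem dense_span_scalar_tmul (φ : A →⋆ₙₐ[ℂ] (K →L[ℂ] K)) :
    Dense (Submodule.span ℂ (Set.range fun p : (H × A) × K =>
      InteriorTensor.tmul φ (ScalarModule.tmul p.1.1 p.1.2) p.2) :
      Set (InteriorTensor (ScalarModule H A) φ)) := by
  set S := Submodule.span ℂ (Set.range fun p : (H × A) × K =>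
      InteriorTensor.tmul φ (ScalarModule.tmul p.1.1 p.1.2) p.2)
  rw [Submodule.dense_iff_topologicalClosure_eq_top, eq_top_iff,
    ← Submodule.dense_iff_topologicalClosure_eq_top.mp
      (InteriorTensor.dense_span_tmul (X := ScalarModule H A) φ)]
  refine Submodule.topologicalClosure_minimal _ (Submodule.span_le.mpr ?_)
    S.isClosed_topologicalClosure
  rintro _ ⟨⟨x, k⟩, rfl⟩
  refine ScalarModule.induction_on x
    (p := fun x => InteriorTensor.tmul φ x k ∈ S.topologicalClosure)
    (S.isClosed_topologicalClosure.preimage (InteriorTensor.continuous_tmul_left φ k)) fun z => ?_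
  obtain ⟨z, rfl⟩ := (PreScalarModule.mk H A).surjective z
  induction z using TensorProduct.induction_on with
  | zero =>
    have h := InteriorTensor.smul_tmul φ 0 (0 : ScalarModule H A) k
    rw [zero_smul, zero_smul] at h
    rw [map_zero, map_zero, h]
    exact zero_mem _
  | add z w hz hw =>
    rw [map_add, map_add, InteriorTensor.add_tmul]
    exact add_mem hz hw
  | tmul h a => exact Submodule.le_topologicalClosure _ (Submodule.subset_span ⟨((h, a), k), rfl⟩)

/-- The isometry `(H ⊗ A) ⊗_φ K → H ⊗ K`, `(h ⊗ a) ⊗ k ↦ h ⊗ φ(a) k`. -/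
theorem exists_scalar_isometry (H : Type u) [NormedAddCommGroup H] [InnerProductSpace ℂ H]
    [CompleteSpace H] (φ : A →⋆ₙₐ[ℂ] (K →L[ℂ] K)) :
    ∃ U : InteriorTensor (ScalarModule H A) φ →L[ℂ] HilbertTensor H K, (∀ x, ‖U x‖ = ‖x‖) ∧
      ∀ h a k, U (InteriorTensor.tmul φ (ScalarModule.tmul h a) k) = htmul h (φ a k) := by
  obtain ⟨U, hU, hUe⟩ := exists_isometry_of_gram
    (fun p : (H × A) × K => InteriorTensor.tmul φ (ScalarModule.tmul p.1.1 p.1.2) p.2)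
    (fun p => htmul p.1.1 (φ p.1.2 p.2)) (dense_span_scalar_tmul φ) fun p q => by
      rw [InteriorTensor.inner_tmul, ScalarModule.inner_tmul, map_smul, _root_.smul_apply,
        inner_smul_right, inner_rep_star_mul, inner_htmul]
  exact ⟨U, hU, fun h a k => hUe ((h, a), k)⟩

/-- The range contains every `h ⊗ φ(a) k`, and by nondegeneracy the vectors `φ(a) k` are total in
`K`. -/
theorem denseRange_scalar_isometry {φ : A →⋆ₙₐ[ℂ] (K →L[ℂ] K)} (hφ : IsNondegenerate φ)
    {U : InteriorTensor (ScalarModule H A) φ →L[ℂ] HilbertTensor H K}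
    (hU : ∀ h a k, U (InteriorTensor.tmul φ (ScalarModule.tmul h a) k) = htmul h (φ a k)) :
    DenseRange U := by
  have hR : Dense ((LinearMap.range U.toLinearMap : Submodule ℂ (HilbertTensor H K)) :
      Set (HilbertTensor H K)) := by
    set R := LinearMap.range U.toLinearMap
    rw [Submodule.dense_iff_topologicalClosure_eq_top, eq_top_iff,
      ← Submodule.dense_iff_topologicalClosure_eq_top.mp (dense_span_htmul (H := H) (K := K))]
    refine Submodule.topologicalClosure_minimal _ (Submodule.span_le.mpr ?_)
      R.isClosed_topologicalClosure
    rintro _ ⟨⟨h, k⟩, rfl⟩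
    have hsub : Submodule.span ℂ {x : K | ∃ a h, x = φ a h}
        ≤ R.topologicalClosure.comap (htmulL h).toLinearMap := by
      refine Submodule.span_le.mpr ?_
      rintro _ ⟨a, k, rfl⟩
      exact Submodule.le_topologicalClosure _ ⟨_, hU h a k⟩
    have hcl : IsClosed {k : K | htmulL h k ∈ R.topologicalClosure} :=
      R.isClosed_topologicalClosure.preimage (htmulL h).continuous
    exact closure_minimal (fun x hx => hsub hx) hcl (hφ k)
  exact hR

/-- `A` acts on the leg `H` only, and `ρ(b)` commutes with the `φ(a)` that `U` applies to the leg
`K`. So `φ` enters the operators no more, only the range of `U`. -/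
theorem scalar_intertwine (πH : A →⋆ₙₐ[ℂ] (H →L[ℂ] H)) {φ : A →⋆ₙₐ[ℂ] (K →L[ℂ] K)}
    {ρ : B →⋆ₙₐ[ℂ] (K →L[ℂ] K)} (hc : ∀ a b, Commute (φ a) (ρ b))
    {U : InteriorTensor (ScalarModule H A) φ →L[ℂ] HilbertTensor H K}
    (hU : ∀ h a k, U (InteriorTensor.tmul φ (ScalarModule.tmul h a) k) = htmul h (φ a k))
    (t : A ⊗[ℂ] B) (x : InteriorTensor (ScalarModule H A) φ) :
    U (pairMap (leftRep (scalarCorr A πH) φ) (rightRep (ScalarModule H A) φ ρ hc) t x)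
      = spatialRep πH ρ t (U x) := by
  induction t using TensorProduct.induction_on with
  | zero => simp
  | add s t hs ht =>
    rw [map_add, map_add, _root_.add_apply, _root_.add_apply, map_add, hs, ht]
  | tmul c b =>
    rw [pairMap_tmul, spatialRep_tmul]
    have h : U ∘L (leftRep (scalarCorr A πH) φ c * rightRep (ScalarModule H A) φ ρ hc b)
        = hilbertOpₗ H K (πH c) (ρ b) ∘L U := by
      refine ContinuousLinearMap.ext_on (dense_span_scalar_tmul φ) ?_
      rintro _ ⟨⟨⟨h, a⟩, k⟩, rfl⟩
      have h1 := congrArg (fun T : K →L[ℂ] K => T k) (hc a b).eq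
      simp only [mul_apply_eq_comp] at h1
      simp only [ContinuousLinearMap.comp_apply, mul_apply_eq_comp, rightRep_tmul, leftRep_tmul,
        scalarCorr_tmul, hU, hilbertOpₗ_apply, hilbertOp_htmul, h1]
    exact congrArg
      (fun T : InteriorTensor (ScalarModule H A) φ →L[ℂ] HilbertTensor H K => T x) h

theorem norm_corrRep_scalar_le (πH : A →⋆ₙₐ[ℂ] (H →L[ℂ] H)) (φ : A →⋆ₙₐ[ℂ] (K →L[ℂ] K))
    (ρ : B →⋆ₙₐ[ℂ] (K →L[ℂ] K)) (hc : ∀ a b, Commute (φ a) (ρ b)) (t : A ⊗[ℂ] B) :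
    ‖corrRep (scalarCorr A πH) φ ρ hc (MaxTensor.incl A B t)‖ ≤ ‖spatialRep πH ρ t‖ := by
  obtain ⟨U, hU, hUe⟩ := exists_scalar_isometry H φ
  rw [corrRep_incl]
  exact norm_le_of_isometry_intertwine hU (scalar_intertwine πH hc hUe t)

theorem norm_spatialRep_le_corrRep_scalar (πH : A →⋆ₙₐ[ℂ] (H →L[ℂ] H))
    {φ : A →⋆ₙₐ[ℂ] (K →L[ℂ] K)} (hφ : IsNondegenerate φ)
    (ρ : B →⋆ₙₐ[ℂ] (K →L[ℂ] K)) (hc : ∀ a b, Commute (φ a) (ρ b)) (t : A ⊗[ℂ] B) :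
    ‖spatialRep πH ρ t‖ ≤ ‖corrRep (scalarCorr A πH) φ ρ hc (MaxTensor.incl A B t)‖ := by
  obtain ⟨U, hU, hUe⟩ := exists_scalar_isometry H φ
  rw [corrRep_incl]
  exact norm_le_of_denseRange_intertwine hU (denseRange_scalar_isometry hφ hUe)
    (scalar_intertwine πH hc hUe t)

end scalarRep

/-! ### Nuclearity and the scalar correspondence -/

section nuclear

variable {A B H K : Type u} [NonUnitalCStarAlgebra A] [NonUnitalCStarAlgebra B]
  [NormedAddCommGroup H] [InnerProductSpace ℂ H] [CompleteSpace H]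
  [NormedAddCommGroup K] [InnerProductSpace ℂ K] [CompleteSpace K]

/-- A representation with range in the commutant of `φ`, as a linear map into that commutant. -/
def toCommutant {φ : A →⋆ₙₐ[ℂ] (K →L[ℂ] K)} {ρ : B →⋆ₙₐ[ℂ] (K →L[ℂ] K)}
    (hc : ∀ a b, Commute (φ a) (ρ b)) : B →ₗ[ℂ] commutant φ where
  toFun b := ⟨ρ b, by
    refine (StarSubalgebra.mem_centralizer_iff ℂ).mpr ?_
    rintro _ ⟨a, rfl⟩
    exact ⟨hc a b, by rw [← map_star]; exact hc (star a) b⟩⟩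
  map_add' b c := Subtype.ext (map_add ρ b c)
  map_smul' c b := Subtype.ext (map_smul ρ c b)

/-- Together with `spatialRep_toCommutant`, this replaces a possibly unfaithful `ρ` by the faithful
inclusion of the commutant, where the minimal norm can be evaluated. -/
theorem pairMap_toCommutant {φ : A →⋆ₙₐ[ℂ] (K →L[ℂ] K)} {ρ : B →⋆ₙₐ[ℂ] (K →L[ℂ] K)}
    (hc : ∀ a b, Commute (φ a) (ρ b)) (σ : A →⋆ₙₐ[ℂ] (K →L[ℂ] K)) (t : A ⊗[ℂ] B) :
    pairMap σ (commutantIncl φ) ((toCommutant hc).lTensor A t) = pairMap σ ρ t := by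
  induction t using TensorProduct.induction_on with
  | zero => simp
  | add s t hs ht => simp only [map_add, hs, ht]
  | tmul a b => rfl

theorem spatialRep_toCommutant {φ : A →⋆ₙₐ[ℂ] (K →L[ℂ] K)} {ρ : B →⋆ₙₐ[ℂ] (K →L[ℂ] K)}
    (hc : ∀ a b, Commute (φ a) (ρ b)) (σ : A →⋆ₙₐ[ℂ] (H →L[ℂ] H)) (t : A ⊗[ℂ] B) :
    spatialRep σ (commutantIncl φ) ((toCommutant hc).lTensor A t) = spatialRep σ ρ t := by
  induction t using TensorProduct.induction_on with
  | zero => simp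
  | add s t hs ht => simp only [map_add, hs, ht]
  | tmul a b =>
    rw [LinearMap.lTensor_tmul, spatialRep_tmul, spatialRep_tmul]
    rfl

/-- The restriction of a representation to a closed invariant subspace. -/
def subRep (σ : A →⋆ₙₐ[ℂ] (K →L[ℂ] K)) (M : Submodule ℂ K) [CompleteSpace M]
    (hM : ∀ a, ∀ x ∈ M, σ a x ∈ M) : A →⋆ₙₐ[ℂ] (M →L[ℂ] M) where
  toFun a := (σ a ∘L M.subtypeL).codRestrict M fun x => hM a x x.2
  map_smul' c a := by ext; simp; rfl
  map_zero' := by ext; simp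
  map_add' a b := by ext; simp; rfl
  map_mul' a b := by ext; simp; rfl
  map_star' a := by
    refine (ContinuousLinearMap.eq_adjoint_iff _ _).mpr fun x y => ?_
    change ⟪σ (star a) x, (y : K)⟫_ℂ = ⟪(x : K), σ a y⟫_ℂ
    rw [map_star, ContinuousLinearMap.star_eq_adjoint, ContinuousLinearMap.adjoint_inner_left]

/-- Every commuting pair of representations can be replaced by one that is nondegenerate, without
changing norms. -/
theorem exists_nondegenerate_pair {σA : A →⋆ₙₐ[ℂ] (K →L[ℂ] K)} {σB : B →⋆ₙₐ[ℂ] (K →L[ℂ] K)}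
    (hc : ∀ a b, Commute (σA a) (σB b)) :
    ∃ (M : Submodule ℂ K) (_ : CompleteSpace M) (τA : A →⋆ₙₐ[ℂ] (M →L[ℂ] M))
      (τB : B →⋆ₙₐ[ℂ] (M →L[ℂ] M)) (hτ : ∀ a b, Commute (τA a) (τB b)),
      IsNondegenerate (MaxTensor.lift τA τB hτ) ∧
        ∀ t, ‖pairMap σA σB t‖ ≤ ‖pairMap τA τB t‖ := by
  -- `N` is the common kernel of all products `σ_A(a) σ_B(b)`. It is closed and invariant under both
  -- representations, and `σ_A × σ_B` vanishes on it. So the orthogonal complement carries the whole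
  -- norm, and a vector of the complement killed by the pair lies in `N` too, hence is zero.
  let N : Submodule ℂ K := ⨅ p : A × B, LinearMap.ker (σA p.1 * σB p.2).toLinearMap
  have hN : ∀ x, x ∈ N ↔ ∀ a b, σA a (σB b x) = 0 := by
    intro x
    simp only [N, Submodule.mem_iInf, LinearMap.mem_ker, Prod.forall]
    rfl
  have hcx : ∀ a b x, σA a (σB b x) = σB b (σA a x) := fun a b x =>
    congrArg (fun T : K →L[ℂ] K => T x) (hc a b).eq
  have hA : ∀ a, ∀ x ∈ N, σA a x ∈ N := by
    intro a x hx
    rw [hN] at hx ⊢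
    intro c b
    rw [← hcx, ← mul_apply_eq_comp, ← map_mul, hx]
  have hB : ∀ b, ∀ x ∈ N, σB b x ∈ N := by
    intro b x hx
    rw [hN] at hx ⊢
    intro a c
    rw [← mul_apply_eq_comp (σB c), ← map_mul, hx]
  have hM : CompleteSpace Nᗮ := N.isClosed_orthogonal.completeSpace_coe
  have hNc : IsClosed (N : Set K) := by
    simp only [N, Submodule.coe_iInf]
    exact isClosed_iInter fun p => (σA p.1 * σB p.2).isClosed_ker
  have hNcomplete : CompleteSpace N := hNc.completeSpace_coe
  let τA := subRep σA Nᗮ (invariant_orthogonal hA)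
  let τB := subRep σB Nᗮ (invariant_orthogonal hB)
  have hτ : ∀ a b, Commute (τA a) (τB b) := fun a b => by
    ext x
    exact hcx a b x
  have hcoe : ∀ t (x : Nᗮ), (pairMap τA τB t x : K) = pairMap σA σB t x := by
    intro t x
    induction t using TensorProduct.induction_on with
    | zero => simp
    | add s t hs ht =>
      rw [map_add, map_add, _root_.add_apply, _root_.add_apply, Submodule.coe_add, hs, ht]
    | tmul a b => rfl
  have hker : ∀ t, ∀ x ∈ N, pairMap σA σB t x = 0 := by
    intro t x hx
    induction t using TensorProduct.induction_on with
    | zero => simp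
    | add s t hs ht => rw [map_add, _root_.add_apply, hs, ht, add_zero]
    | tmul a b => exact (hN x).mp hx a b
  refine ⟨Nᗮ, hM, τA, τB, hτ, ?_, fun t => ?_⟩
  · rw [isNondegenerate_iff]
    intro x hx
    have hxN : (x : K) ∈ N := by
      rw [hN]
      intro a b
      have h := congrArg (fun y : Nᗮ => (y : K)) (hx (MaxTensor.tmul a b))
      rw [MaxTensor.lift_tmul] at h
      exact h
    exact Subtype.ext (inner_self_eq_zero.mp (x.2 _ hxN))
  · refine ContinuousLinearMap.opNorm_le_bound _ (norm_nonneg _) fun x => ?_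
    obtain ⟨y, hy, z, hz, rfl⟩ := N.exists_add_mem_mem_orthogonal x
    -- Pythagoras, as `y` and `z` are orthogonal.
    have hzn : ‖z‖ ≤ ‖y + z‖ := by
      have h := norm_add_sq_eq_norm_sq_add_norm_sq_of_inner_eq_zero y z (𝕜 := ℂ) (hz y hy)
      nlinarith [norm_nonneg z, norm_nonneg (y + z), mul_self_nonneg ‖y‖]
    rw [map_add, hker t y hy, zero_add, ← hcoe t ⟨z, hz⟩]
    refine ((pairMap τA τB t).le_opNorm ⟨z, hz⟩).trans ?_
    gcongr
    exact hzn

variable [PartialOrder A] [StarOrderedRing A]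

/-- Nuclearity is applied with the commutant of `σ_A` as second algebra: there `σ_A × incl` is
bounded by the maximal norm, which equals the norm in the faithful spatial representation `π_H ⊗
incl`, and this restricts to `π_H ⊗ σ_B`. -/
theorem IsNuclear.hasUFP (hA : IsNuclear A) {πH : A →⋆ₙₐ[ℂ] (H →L[ℂ] H)}
    (hπ : Function.Injective πH) : HasUFP (scalarCorr A πH) := by
  intro B _ K _ _ _ σ σA σB hc hnd hσ z hz
  have hle : ‖σ z‖ ≤ ‖corrRep (scalarCorr A πH) σA σB hc z‖ := by
    refine MaxTensor.norm_le_of_incl (fun t => ?_) z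
    have hinj : Function.Injective (commutantIncl σA) := Subtype.val_injective
    rw [MaxTensor.rep_incl hσ, ← pairMap_toCommutant hc]
    refine (le_maxNorm (commute_commutantIncl σA) _).trans ?_
    rw [hA, minNorm_eq_of_injective hπ hinj, spatialRep_toCommutant]
    exact norm_spatialRep_le_corrRep_scalar πH (hnd.of_maxTensor hc hσ) σB hc t
  rw [hz, norm_zero, norm_le_zero_iff] at hle
  exact hle

/-- A commuting pair, made nondegenerate, is dominated via the UFP by the spatial representation
`π_H ⊗ τ_B`, hence by the minimal norm. -/
theorem HasUFP.isNuclear {πH : A →⋆ₙₐ[ℂ] (H →L[ℂ] H)} (h : HasUFP (scalarCorr A πH)) :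
    IsNuclear A := by
  intro B _ t
  refine le_antisymm (maxNorm_le ?_ ?_) (minNorm_le_maxNorm t)
  -- The zero representation of `B` serves to show that the minimal norm is nonnegative.
  · exact (norm_nonneg _).trans (norm_spatialRep_le_minNorm πH (0 : B →⋆ₙₐ[ℂ] (H →L[ℂ] H)) t)
  intro K _ _ _ σA σB hc
  obtain ⟨M, _, τA, τB, hτ, hnd, hnorm⟩ := exists_nondegenerate_pair hc
  have h1 := norm_le_of_ker_le (MaxTensor.lift τA τB hτ) (corrRep (scalarCorr A πH) τA τB hτ)
    (h B M _ τA τB hτ hnd (MaxTensor.lift_tmul _ _ _)) (MaxTensor.incl A B t)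
  rw [MaxTensor.lift_incl] at h1
  exact (hnorm t).trans (h1.trans ((norm_corrRep_scalar_le πH τA τB hτ t).trans
    (norm_spatialRep_le_minNorm πH τB t)))

end nuclear

end CStarCorr

end

theorem mainTheorem3 {A : Type u} [NonUnitalCStarAlgebra A] [PartialOrder A] [StarOrderedRing A] :
    (∀ (X : Type u) [NormedAddCommGroup X] [NormedSpace ℂ X] [CompleteSpace X]
      [CStarCorr.HilbertModule A X] (π : CStarCorr.LeftAction A A X),
      CStarCorr.HasUFP π ↔ CStarCorr.WeaklyContainedUniv (CStarCorr.identityCorr A) π) ∧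
    (∀ (H : Type u) [NormedAddCommGroup H] [InnerProductSpace ℂ H] [CompleteSpace H]
      (πH : A →⋆ₙₐ[ℂ] (H →L[ℂ] H)), Function.Injective πH →
      List.TFAE [CStarCorr.IsNuclear A,
        CStarCorr.HasUFP (CStarCorr.scalarCorr A πH),
        CStarCorr.WeaklyContainedUniv (CStarCorr.identityCorr A)
          (CStarCorr.scalarCorr A πH)]) := by
  refine ⟨fun X _ _ _ _ π => CStarCorr.hasUFP_iff_weaklyContainedUniv π, ?_⟩
  intro H _ _ _ πH hπ
  tfae_have 1 → 2 := fun h => h.hasUFP hπ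
  tfae_have 2 → 1 := fun h => h.isNuclear
  -- Part 1 for the correspondence `H ⊗ A`.
  tfae_have 2 ↔ 3 := CStarCorr.hasUFP_iff_weaklyContainedUniv _
  tfae_finish
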